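/- Let $(M,g,J)$ be a Kähler manifold of complex dimension $n\ge 2$, with Kähler form $\omega=\frac{\sqrt{-1}}{2}\,g_{\alpha\bar\beta}\,dz^\alpha\wedge d\bar z^\beta$ in holomorphic coordinates (so $\omega(X,Y)=g(JX,Y)$, and $g_{\alpha\bar\beta}=\delta_{\alpha\beta}$ for the Euclidean metric), let $(N,h)$ be a Riemannian manifold, and let $f:M\to N$ be a smooth harmonic map. Put $E=f^*(TN\otimes\mathbb C)$, and let $d'f=\frac12(df-\sqrt{-1}\,df\circ J)\in\Omega^{1,0}(E)$, $d''f=\frac12(df+\sqrt{-1}\,df\circ J)\in\Omega^{0,1}(E)$. Let $d'_E:\Omega^{p,q}(E)\to\Omega^{p+1,q}(E)$ and $d''_E:\Omega^{p,q}(E)\to\Omega^{p,q+1}(E)$ be the operators induced by the $(1,0)$- and $(0,1)$-parts of the pullback of the Levi-Civita connection of $N$: in local coordinates $(y^i)$ of $N$, with the frame $\partial/\partial f^i=\partial/\partial y^i\circ f$, one has $(d'_E\psi)^i=d'\psi^i+\Gamma^i_{jk}(f)\,d'f^j\wedge\psi^k$, and likewise for $d''_E$. For $E$-valued forms $\psi=\psi^i\otimes\partial/\partial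 f^i$, $\xi=\xi^i\otimes\partial/\partial f^i$ put $\{\psi,\xi\}=h_{ij}(f)\,\psi^i\wedge\overline{\xi^j}$. For an $E$-valued $(1,1)$-form $\phi=\phi^i_{\alpha\bar\beta}\,dz^\alpha\wedge d\bar z^\beta\otimes\partial/\partial f^i$ put $|\phi|^2=h_{ij}\,g^{\alpha\bar\mu}g^{\nu\bar\beta}\,\phi^i_{\alpha\bar\beta}\,\overline{\phi^j_{\mu\bar\nu}}$. Finally let $R_{ijkl}=\langle R(\partial_i,\partial_j)\partial_k,\partial_l\rangle$ be the Riemann curvature tensor of $N$, where $R(X,Y)=[\nabla_X,\nabla_Y]-\nabla_{[X,Y]}$ (so $R_{ijji}>0$ on the round sphere for $i\neq j$ in an orthonormal frame), and let $$Q_0=-\,g^{\alpha\bar\delta}g^{\gamma\bar\beta}\,R_{ijkl}\,\frac{\partial f^i}{\partial z^\alpha}\frac{\partial f^k}{\partial\bar z^\beta}\frac{\partial f^j}{\partial z^\gamma}\frac{\partial f^l}{\partial\bar z^\delta}.$$ Then, in all holomorphic coordinates of $M$ and all local coordinates of $N$, $$d\{d''_E d'f,\;d''f-d'f\}\wedge\frac{\omega^{n-2}}{(n-2)!}=8\left(|d'_E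 d''f|^2+Q_0\right)\frac{\omega^n}{n!},$$ and the left-hand side is exact: it equals $d\left(\{d''_E d'f,\;d''f-d'f\}\wedge\frac{\omega^{n-2}}{(n-2)!}\right)$. -/

import Mathlib

open Set Manifold Bundle
open scoped ContDiff

noncomputable section

namespace KahlerBochner

/-! ### Complex-valued differential forms on `ℂⁿ` -/

/-- The model space `ℂⁿ` of the domain. -/
abbrev CSpace (n : ℕ) : Type := EuclideanSpace ℂ (Fin n)

/-- The model space `ℝᵐ` of the target. -/
abbrev RSpace (m : ℕ) : Type := EuclideanSpace ℝ (Fin m)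

/-- Complex-valued real-multilinear alternating `k`-forms on `ℂⁿ`. -/
abbrev CForm (n k : ℕ) : Type := CSpace n [⋀^Fin k]→L[ℝ] ℂ

/-- The complex structure `J` (multiplication by `√-1`) as a real-linear map. -/
def cplxJ (n : ℕ) : CSpace n →L[ℝ] CSpace n :=
  (Complex.I • ContinuousLinearMap.id ℂ (CSpace n)).restrictScalars ℝ

/-- The real coordinate vector `∂/∂x^α` in `ℂⁿ`, where `z^α = x^α + √-1 y^α`. -/
def eX {n : ℕ} (α : Fin n) : CSpace n := EuclideanSpace.single α 1

/-- The real coordinate vector `∂/∂y^α` in `ℂⁿ`, where `z^α = x^α + √-1 y^α`. -/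
def eY {n : ℕ} (α : Fin n) : CSpace n := EuclideanSpace.single α Complex.I

/-- The real coordinate frame of `ℂⁿ`: the vectors `∂/∂x^α`, then the vectors `∂/∂y^α`. -/
def realFrame (n : ℕ) : Fin n ⊕ Fin n → CSpace n := Sum.elim eX eY

/-- The coordinate frame `∂/∂y^i` of `ℝᵐ`. -/
def stdFrame (m : ℕ) : Fin m → RSpace m := fun i => EuclideanSpace.single i 1

theorem continuous_wedge_aux {n k l : ℕ} (η : CForm n k) (ζ : CForm n l) :
    Continuous fun v : Fin (k + l) → CSpace n =>
      ((LinearMap.mul' ℝ ℂ).compAlternatingMap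
        ((η.toAlternatingMap).domCoprod (ζ.toAlternatingMap)))
        (v ∘ (finSumFinEquiv : Fin k ⊕ Fin l ≃ Fin (k + l))) := by
  simp only [LinearMap.compAlternatingMap_apply, AlternatingMap.domCoprod_apply,
    sum_apply, map_sum]
  refine continuous_finsetSum _ fun q _ => ?_
  induction q using Quotient.inductionOn' with | _ σ
  have key : (fun v : Fin (k + l) → CSpace n =>
      (LinearMap.mul' ℝ ℂ) ((AlternatingMap.domCoprod.summand η.toAlternatingMap
        ζ.toAlternatingMap (Quotient.mk'' σ)) (v ∘ finSumFinEquiv))) =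
      fun v => ((Equiv.Perm.sign σ : ℤ) : ℂ) *
        (η (fun i => v (finSumFinEquiv (σ (Sum.inl i)))) *
          ζ (fun i => v (finSumFinEquiv (σ (Sum.inr i))))) := by
    funext v
    rw [AlternatingMap.domCoprod.summand_mk'']
    rcases Int.units_eq_one_or (Equiv.Perm.sign σ) with h | h <;> rw [h] <;>
      simp [MultilinearMap.domCoprod_apply]
  rw [key]
  have hη : Continuous fun v : Fin (k + l) → CSpace n =>
      η (fun i => v (finSumFinEquiv (σ (Sum.inl i)))) :=
    η.cont.comp (continuous_pi fun i => continuous_apply (finSumFinEquiv (σ (Sum.inl i))))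
  have hζ : Continuous fun v : Fin (k + l) → CSpace n =>
      ζ (fun i => v (finSumFinEquiv (σ (Sum.inr i)))) :=
    ζ.cont.comp (continuous_pi fun i => continuous_apply (finSumFinEquiv (σ (Sum.inr i))))
  exact continuous_const.mul (hη.mul hζ)

/-- The wedge product of forms, normalised as a sum over shuffles:
`(α ∧ β)(v, w) = α(v)β(w) - α(w)β(v)` for `1`-forms. -/
def wedge {n k l : ℕ} (η : CForm n k) (ζ : CForm n l) : CForm n (k + l) :=
  { ((LinearMap.mul' ℝ ℂ).compAlternatingMap
      ((η.toAlternatingMap).domCoprod (ζ.toAlternatingMap))).domDomCongr finSumFinEquiv with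
    cont := continuous_wedge_aux η ζ }

/-- The wedge power `η^k = η ∧ ⋯ ∧ η` of a `2`-form. -/
def wedgePow {n : ℕ} (η : CForm n 2) : (k : ℕ) → CForm n (2 * k)
  | 0 => ContinuousAlternatingMap.constOfIsEmpty ℝ (CSpace n) (Fin 0) (1 : ℂ)
  | k + 1 => wedge (wedgePow η k) η

/-- The divided power `η^k / k!` of a `2`-form. -/
def divPow {n : ℕ} (η : CForm n 2) (k : ℕ) : CForm n (2 * k) :=
  ((Nat.factorial k : ℂ)⁻¹) • wedgePow η k

/-- Regard a form of degree `k` as a form of degree `l` when `k = l`. -/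
def castDeg {n k l : ℕ} (h : k = l) (η : CForm n k) : CForm n l := h ▸ η

/-- Complex conjugation of forms. -/
def conjForm {n k : ℕ} (η : CForm n k) : CForm n k :=
  (Complex.conjCLE : ℂ →L[ℝ] ℂ).compContinuousAlternatingMap η

/-- A real-linear map `ℂⁿ → ℂ` as a `1`-form. -/
def oneForm {n : ℕ} (L : CSpace n →L[ℝ] ℂ) : CForm n 1 :=
  ContinuousAlternatingMap.ofSubsingleton ℝ (CSpace n) ℂ (0 : Fin 1) L

/-- The `1`-form `dz^α`. -/
def dz {n : ℕ} (α : Fin n) : CForm n 1 :=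
  oneForm ((EuclideanSpace.proj α : CSpace n →L[ℂ] ℂ).restrictScalars ℝ)

/-- The `1`-form `d\bar z^α`. -/
def dzbar {n : ℕ} (α : Fin n) : CForm n 1 := conjForm (dz α)

/-- The operator `d'` on forms: `d'η = ∑ dz^α ∧ ∂η/∂z^α`, the derivative being taken on the
coefficients of `η`, with `∂/∂z^α = (∂/∂x^α - √-1 ∂/∂y^α)/2`. -/
def dPrime {n k : ℕ} (η : CSpace n → CForm n k) (z : CSpace n) : CForm n (1 + k) :=
  ∑ α, wedge (dz α)
    ((1 / 2 : ℂ) • (fderiv ℝ η z (eX α) - Complex.I • fderiv ℝ η z (eY α)))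

/-- The operator `d''` on forms: `d''η = ∑ d\bar z^α ∧ ∂η/∂\bar z^α`, with
`∂/∂\bar z^α = (∂/∂x^α + √-1 ∂/∂y^α)/2`. -/
def dDoublePrime {n k : ℕ} (η : CSpace n → CForm n k) (z : CSpace n) : CForm n (1 + k) :=
  ∑ α, wedge (dzbar α)
    ((1 / 2 : ℂ) • (fderiv ℝ η z (eX α) + Complex.I • fderiv ℝ η z (eY α)))

/-! ### Riemannian metrics in coordinates -/

section Metric

variable {E : Type*} [NormedAddCommGroup E] [NormedSpace ℝ E]

/-- The Riemannian metric `g` in the chart `φ`, at the coordinate point `z`, applied to two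
coordinate vectors `v`, `w`. -/
def chartMetric {X : Type*} [TopologicalSpace X] [ChartedSpace E X] [IsManifold 𝓘(ℝ, E) ∞ X]
    (g : ContMDiffRiemannianMetric 𝓘(ℝ, E) ∞ E (fun x : X => TangentSpace 𝓘(ℝ, E) x))
    (φ : OpenPartialHomeomorph X E) (z v w : E) : ℝ :=
  g.inner (φ.symm z) (mfderiv 𝓘(ℝ, E) 𝓘(ℝ, E) φ.symm z v) (mfderiv 𝓘(ℝ, E) 𝓘(ℝ, E) φ.symm z w)

/-- The coefficients `g_{ab}` of a metric in the chart `φ` with respect to a frame `b` of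
coordinate vectors. -/
def metricMatrix {X : Type*} [TopologicalSpace X] [ChartedSpace E X] [IsManifold 𝓘(ℝ, E) ∞ X]
    {ι : Type*}
    (g : ContMDiffRiemannianMetric 𝓘(ℝ, E) ∞ E (fun x : X => TangentSpace 𝓘(ℝ, E) x))
    (φ : OpenPartialHomeomorph X E) (b : ι → E) (z : E) : Matrix ι ι ℝ :=
  Matrix.of fun a c => chartMetric g φ z (b a) (b c)

variable {ι : Type*} [Fintype ι] [DecidableEq ι]

/-- The Christoffel symbols
`Γ^c_{ad} = ½ g^{ce} (∂_a g_{ed} + ∂_d g_{ea} - ∂_e g_{ad})` of the Levi-Civita connection, for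
metric coefficients `G` with respect to the frame `b` of coordinate vectors. -/
def christoffel (b : ι → E) (G : E → Matrix ι ι ℝ) (c a d : ι) (x : E) : ℝ :=
  (1 / 2 : ℝ) * ∑ e, (G x)⁻¹ c e *
    (fderiv ℝ (fun y => G y e d) x (b a) + fderiv ℝ (fun y => G y e a) x (b d)
      - fderiv ℝ (fun y => G y a d) x (b e))

/-- The components `R_{ijk}{}^l` of the curvature operator,
`R(∂_i, ∂_j) ∂_k = (∇_i ∇_j - ∇_j ∇_i) ∂_k = R_{ijk}{}^l ∂_l`. -/
def curvatureUp (b : ι → E) (G : E → Matrix ι ι ℝ) (i j k l : ι) (x : E) : ℝ :=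
  fderiv ℝ (christoffel b G l j k) x (b i) - fderiv ℝ (christoffel b G l i k) x (b j)
    + ∑ p, (christoffel b G l i p x * christoffel b G p j k x
        - christoffel b G l j p x * christoffel b G p i k x)

/-- The Riemann curvature tensor `R_{ijkl} = ⟨R(∂_i, ∂_j) ∂_k, ∂_l⟩`; with this convention
`R_{ijji}` is positive on the round sphere. -/
def curvature (b : ι → E) (G : E → Matrix ι ι ℝ) (i j k l : ι) (x : E) : ℝ :=
  ∑ p, G x l p * curvatureUp b G i j k p x

/-- The tension field of a map `F` into `ℝᵐ` in coordinates,
`τ^i = g^{ac} (∂_a ∂_c F^i - Γ^e_{ac} ∂_e F^i + Γ^i_{jk}(F) ∂_a F^j ∂_c F^k)`; here `G` are the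
metric coefficients of the domain in the frame `b` and `H` those of the target. -/
def tension {m : ℕ} (b : ι → E) (G : E → Matrix ι ι ℝ)
    (H : RSpace m → Matrix (Fin m) (Fin m) ℝ) (F : E → RSpace m) (i : Fin m) (x : E) : ℝ :=
  ∑ a, ∑ c, (G x)⁻¹ a c *
    (fderiv ℝ (fun y => fderiv ℝ (fun w => F w i) y (b c)) x (b a)
      - ∑ e, christoffel b G e a c x * fderiv ℝ (fun w => F w i) x (b e)
      + ∑ j, ∑ k, christoffel (stdFrame m) H i j k (F x) *
          fderiv ℝ (fun w => F w j) x (b a) * fderiv ℝ (fun w => F w k) x (b c))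

end Metric

/-! ### The Kähler condition -/

section Kahler

variable {n : ℕ} {M : Type*} [TopologicalSpace M] [ChartedSpace (CSpace n) M]
  [IsManifold 𝓘(ℝ, CSpace n) ∞ M]

/-- The Hermitian coefficients `g_{α\bar β}` of a `J`-invariant metric in the chart `φ`, with the
normalisation `g_{α\bar β} = δ_{αβ}` for the Euclidean metric `∑ (dx^α)² + (dy^α)²`. -/
def hermMatrix
    (g : ContMDiffRiemannianMetric 𝓘(ℝ, CSpace n) ∞ (CSpace n)
      (fun x : M => TangentSpace 𝓘(ℝ, CSpace n) x))
    (φ : OpenPartialHomeomorph M (CSpace n)) (z : CSpace n) : Matrix (Fin n) (Fin n) ℂ :=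
  Matrix.of fun α β => (chartMetric g φ z (eX α) (eX β) : ℂ)
    + Complex.I * (chartMetric g φ z (eX α) (eY β) : ℂ)

/-- The Kähler form `ω = (√-1/2) g_{α\bar β} dz^α ∧ d\bar z^β` in the chart `φ`; for a
`J`-invariant metric this is `ω(v, w) = g(Jv, w)`. -/
def kahlerForm
    (g : ContMDiffRiemannianMetric 𝓘(ℝ, CSpace n) ∞ (CSpace n)
      (fun x : M => TangentSpace 𝓘(ℝ, CSpace n) x))
    (φ : OpenPartialHomeomorph M (CSpace n)) (z : CSpace n) : CForm n 2 :=
  ∑ α, ∑ β, (Complex.I / 2 * hermMatrix g φ z α β) • wedge (dz α) (dzbar β)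

/-- The metric `g` on the complex manifold `M` is Kähler: in every holomorphic chart it is
invariant under the complex structure, and its Kähler form is closed. -/
structure IsKahler [IsManifold 𝓘(ℂ, CSpace n) ω M]
    (g : ContMDiffRiemannianMetric 𝓘(ℝ, CSpace n) ∞ (CSpace n)
      (fun x : M => TangentSpace 𝓘(ℝ, CSpace n) x)) : Prop where
  hermitian : ∀ φ ∈ IsManifold.maximalAtlas 𝓘(ℂ, CSpace n) ω M, ∀ z ∈ φ.target,
    ∀ v w : CSpace n, chartMetric g φ z (cplxJ n v) (cplxJ n w) = chartMetric g φ z v w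
  closed : ∀ φ ∈ IsManifold.maximalAtlas 𝓘(ℂ, CSpace n) ω M, ∀ z ∈ φ.target,
    extDeriv (kahlerForm g φ) z = 0

end Kahler

/-! ### Forms with values in `E = f^*(TN ⊗ ℂ)`

In local coordinates `F = (F^1, …, F^m)` of the map `f` is a function `ℂⁿ → ℝᵐ`, and an
`E`-valued form `ψ = ψ^i ⊗ ∂/∂f^i` is its family `i ↦ ψ^i` of components in the local frame
`∂/∂f^i = ∂/∂y^i ∘ f`. The metric coefficients of the target are `H = (h_{ij})`. -/

section Bundle

variable {n m : ℕ}

/-- `E`-valued `k`-forms, by components in the local frame `∂/∂f^i`. -/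
abbrev EForm (n m k : ℕ) : Type := Fin m → CSpace n → CForm n k

/-- The real differential of the `i`-th component of `F`, with complex values. -/
def dComp (F : CSpace n → RSpace m) (i : Fin m) (z : CSpace n) : CSpace n →L[ℝ] ℂ :=
  Complex.ofRealCLM.comp (fderiv ℝ (fun w => F w i) z)

/-- `d'f = ½ (df - √-1 df ∘ J)`, an `E`-valued `(1,0)`-form. -/
def dPrimeMap (F : CSpace n → RSpace m) : EForm n m 1 := fun i z =>
  oneForm ((1 / 2 : ℂ) • (dComp F i z - Complex.I • (dComp F i z).comp (cplxJ n)))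

/-- `d''f = ½ (df + √-1 df ∘ J)`, an `E`-valued `(0,1)`-form. -/
def dDoublePrimeMap (F : CSpace n → RSpace m) : EForm n m 1 := fun i z =>
  oneForm ((1 / 2 : ℂ) • (dComp F i z + Complex.I • (dComp F i z).comp (cplxJ n)))

/-- The operator `d'_E` induced by the `(1,0)`-part of the pullback of the Levi-Civita
connection: `(d'_E ψ)^i = d'ψ^i + Γ^i_{jk}(f) d'f^j ∧ ψ^k`. -/
def dPrimeE {k : ℕ} (H : RSpace m → Matrix (Fin m) (Fin m) ℝ) (F : CSpace n → RSpace m)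
    (ψ : EForm n m k) : EForm n m (1 + k) := fun i z =>
  dPrime (ψ i) z + ∑ j, ∑ p, ((christoffel (stdFrame m) H i j p (F z) : ℝ) : ℂ) •
    wedge (dPrimeMap F j z) (ψ p z)

/-- The operator `d''_E` induced by the `(0,1)`-part of the pullback of the Levi-Civita
connection: `(d''_E ψ)^i = d''ψ^i + Γ^i_{jk}(f) d''f^j ∧ ψ^k`. -/
def dDoublePrimeE {k : ℕ} (H : RSpace m → Matrix (Fin m) (Fin m) ℝ) (F : CSpace n → RSpace m)
    (ψ : EForm n m k) : EForm n m (1 + k) := fun i z =>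
  dDoublePrime (ψ i) z + ∑ j, ∑ p, ((christoffel (stdFrame m) H i j p (F z) : ℝ) : ℂ) •
    wedge (dDoublePrimeMap F j z) (ψ p z)

/-- The bracket `{ψ, ξ} = h_{ij}(f) ψ^i ∧ \overline{ξ^j}`. -/
def bracket {k l : ℕ} (H : RSpace m → Matrix (Fin m) (Fin m) ℝ) (F : CSpace n → RSpace m)
    (ψ : EForm n m k) (ξ : EForm n m l) (z : CSpace n) : CForm n (k + l) :=
  ∑ i, ∑ j, ((H (F z) i j : ℝ) : ℂ) • wedge (ψ i z) (conjForm (ξ j z))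

/-- The coefficient `φ_{α\bar β} = φ(∂/∂z^α, ∂/∂\bar z^β)` of `dz^α ∧ d\bar z^β` in a `2`-form
(the form being extended complex bilinearly). -/
def comp11 (η : CForm n 2) (α β : Fin n) : ℂ :=
  (1 / 4 : ℂ) * (η ![eX α, eX β] + Complex.I * η ![eX α, eY β]
    - Complex.I * η ![eY α, eX β] + η ![eY α, eY β])

/-- The inverse `g^{α\bar β}` of the Hermitian coefficients, `g^{α\bar β} g_{γ\bar β} = δ^α_γ`. -/
def hermInv (G : Matrix (Fin n) (Fin n) ℂ) (α β : Fin n) : ℂ := (G⁻¹) β α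

/-- The pointwise squared norm of an `E`-valued `(1,1)`-form `φ^i_{α\bar β} dz^α ∧ d\bar z^β`,
`|φ|² = h_{ij} g^{α\bar μ} g^{ν\bar β} φ^i_{α\bar β} \overline{φ^j_{μ\bar ν}}`, which is
`∑ |φ^i_{α\bar β}|²` in orthonormal frames. -/
def normSq11 (H : Matrix (Fin m) (Fin m) ℝ) (G : Matrix (Fin n) (Fin n) ℂ)
    (φ : Fin m → CForm n 2) : ℂ :=
  ∑ i, ∑ j, ∑ α, ∑ β, ∑ μ, ∑ ν, ((H i j : ℝ) : ℂ) * hermInv G α μ * hermInv G ν β *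
    comp11 (φ i) α β * (starRingEnd ℂ) (comp11 (φ j) μ ν)

/-- `∂F^i/∂z^α`. -/
def dFz (F : CSpace n → RSpace m) (i : Fin m) (α : Fin n) (z : CSpace n) : ℂ :=
  (1 / 2 : ℂ) * (dComp F i z (eX α) - Complex.I * dComp F i z (eY α))

/-- `∂F^i/∂\bar z^α`. -/
def dFzbar (F : CSpace n → RSpace m) (i : Fin m) (α : Fin n) (z : CSpace n) : ℂ :=
  (1 / 2 : ℂ) * (dComp F i z (eX α) + Complex.I * dComp F i z (eY α))

/-- The curvature term
`Q₀ = - g^{α\bar δ} g^{γ\bar β} R_{ijkl}(f) ∂f^i/∂z^α ∂f^k/∂\bar z^β ∂f^j/∂z^γ ∂f^l/∂\bar z^δ`. -/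
def Q0 (H : RSpace m → Matrix (Fin m) (Fin m) ℝ) (G : CSpace n → Matrix (Fin n) (Fin n) ℂ)
    (F : CSpace n → RSpace m) (z : CSpace n) : ℂ :=
  -∑ α, ∑ β, ∑ γ, ∑ δ, ∑ i, ∑ j, ∑ k, ∑ l,
    hermInv (G z) α δ * hermInv (G z) γ β *
      ((curvature (stdFrame m) H i j k l (F z) : ℝ) : ℂ) *
      dFz F i α z * dFzbar F k β z * dFz F j γ z * dFzbar F l δ z

/-- The `3`-form `{d''_E d'f, d''f - d'f}`. -/
def mochizukiForm (H : RSpace m → Matrix (Fin m) (Fin m) ℝ) (F : CSpace n → RSpace m) :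
    CSpace n → CForm n (1 + 1 + 1) :=
  bracket H F (dDoublePrimeE H F (dPrimeMap F)) (dDoublePrimeMap F - dPrimeMap F)

end Bundle

/-- The map `f` in the charts `φ` of `M` and `ψ` of `N`. -/
def coordMap {n m : ℕ} {M N : Type*} [TopologicalSpace M] [TopologicalSpace N] (f : M → N)
    (φ : OpenPartialHomeomorph M (CSpace n)) (ψ : OpenPartialHomeomorph N (RSpace m)) :
    CSpace n → RSpace m :=
  ψ ∘ f ∘ φ.symm

/-- The metric coefficients `h_{ij}` of `N` in the chart `ψ`. -/
def targetMatrix {m : ℕ} {N : Type*} [TopologicalSpace N] [ChartedSpace (RSpace m) N]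
    [IsManifold 𝓘(ℝ, RSpace m) ∞ N]
    (h : ContMDiffRiemannianMetric 𝓘(ℝ, RSpace m) ∞ (RSpace m)
      (fun y : N => TangentSpace 𝓘(ℝ, RSpace m) y))
    (ψ : OpenPartialHomeomorph N (RSpace m)) : RSpace m → Matrix (Fin m) (Fin m) ℝ :=
  metricMatrix h ψ (stdFrame m)

/-- A map `f` is harmonic: its tension field vanishes in all smooth local coordinates of `M`
and `N`. -/
def IsHarmonic {n m : ℕ} {M : Type*} [TopologicalSpace M] [ChartedSpace (CSpace n) M]
    [IsManifold 𝓘(ℝ, CSpace n) ∞ M] {N : Type*} [TopologicalSpace N] [ChartedSpace (RSpace m) N]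
    [IsManifold 𝓘(ℝ, RSpace m) ∞ N]
    (g : ContMDiffRiemannianMetric 𝓘(ℝ, CSpace n) ∞ (CSpace n)
      (fun x : M => TangentSpace 𝓘(ℝ, CSpace n) x))
    (h : ContMDiffRiemannianMetric 𝓘(ℝ, RSpace m) ∞ (RSpace m)
      (fun y : N => TangentSpace 𝓘(ℝ, RSpace m) y))
    (f : M → N) : Prop :=
  ∀ φ ∈ IsManifold.maximalAtlas 𝓘(ℝ, CSpace n) ∞ M,
  ∀ ψ ∈ IsManifold.maximalAtlas 𝓘(ℝ, RSpace m) ∞ N,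
  ∀ z ∈ φ.target, f (φ.symm z) ∈ ψ.source →
    ∀ i, tension (realFrame n) (metricMatrix g φ (realFrame n))
      (targetMatrix h ψ) (coordMap f φ ψ) i z = 0

end KahlerBochner

end

open KahlerBochner

noncomputable section

namespace KahlerBochner

/-! Write `p^i = d'f^i`, `q^i = d''f^i`, `s^i = d(d'f^i)`, and let `D` be the pullback of the
Levi-Civita connection. Put `A^i = (d''_E d'f)^i = s^i + Γ^i_{jk} q^j ∧ p^k`. Since `f` is real,
conjugation exchanges `p` and `q`, so the form to be differentiated is `h_{ij} A^i ∧ (p^j - q^j)`.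

Metric compatibility turns `d` of this form into `h_{ij} (DA^i ∧ (p^j - q^j) + A^i ∧ D(p - q)^j)`.
As the connection has no torsion, `D(p - q) = 2A`. As `dd = 0`, `DA` contains no second derivatives
of `f`: it is the curvature expression `½ R(q,q)p - ½ R(p,p)q`. This is
`toExt_extDeriv_mochizukiForm`, resting on the algebraic identities `second_derivative_identity` and
`bracket_derivative_identity`.

It remains to wedge with `ω^{n-2}/(n-2)!`. Four `1`-forms wedged with it give the Pfaffian of their
pairings under the Poisson bivector of `ω`, times `ω^n/n!` (`ι_mul_ι_mul_ι_mul_ι_mul_divPow`). The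
only nonzero pairings are between `dz^α` and `d\bar z^β`, equal to `∓2√-1 g^{α\bar β}`. * In `2
h_{ij} A^i ∧ A^j` the Pfaffian yields `8 |d'_E d''f|²` minus a multiple of a product of traces. The
trace vanishes for harmonic `f`: holomorphic coordinates of a Kähler metric satisfy `g^{ac} Γ^e_{ac}
= 0` (`IsKahler.sum_inv_mul_christoffel`), so the tension field is, up to a factor, the Hermitian
trace of the Levi form. * In the curvature part the four resulting contractions coincide up to sign
by the symmetries of `R` (`curvature_contraction`) and add up to `8 Q₀`.

Exactness is the Leibniz rule together with `dω = 0`.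

All computations take place in the exterior algebra of `ℂ`-valued functionals. The map `toExt` is
injective, takes wedge to product and ignores casts of degree, so identities of forms become
identities in one associative algebra where contraction is available. -/

/-! ### Embedding forms into an exterior algebra -/

/-- Complex-valued real-linear functionals on `ℂⁿ`. -/
abbrev CDual (n : ℕ) : Type := CSpace n →L[ℝ] ℂ

/-- The exterior algebra of all complex-valued forms on `ℂⁿ`. -/
abbrev ExtAlg (n : ℕ) : Type := ExteriorAlgebra ℂ (CDual n)

/-- The coframe dual to `realFrame`. -/
def realCoframe (n : ℕ) : Fin n ⊕ Fin n → CDual n :=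
  Sum.elim
    (fun α => Complex.ofRealCLM.comp (Complex.reCLM.comp
      ((EuclideanSpace.proj α : CSpace n →L[ℂ] ℂ).restrictScalars ℝ)))
    (fun α => Complex.ofRealCLM.comp (Complex.imCLM.comp
      ((EuclideanSpace.proj α : CSpace n →L[ℂ] ℂ).restrictScalars ℝ)))

/-- The real coordinates with respect to `realFrame`. -/
def realCoord {n : ℕ} (v : CSpace n) : Fin n ⊕ Fin n → ℝ :=
  Sum.elim (fun α => (v α).re) (fun α => (v α).im)

theorem realCoframe_apply {n : ℕ} (a : Fin n ⊕ Fin n) (v : CSpace n) :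
    realCoframe n a v = (realCoord v a : ℂ) := by
  rcases a with a | a <;> simp [realCoframe, realCoord]

theorem sum_realCoord_smul {n : ℕ} (v : CSpace n) :
    ∑ a, realCoord v a • realFrame n a = v := by
  ext β
  simp only [Fintype.sum_sum_type, realCoord, realFrame, Sum.elim_inl, Sum.elim_inr, eX, eY]
  simp only [PiLp.add_apply, WithLp.ofLp_sum, Finset.sum_apply, PiLp.smul_apply,
    PiLp.single_apply, smul_ite, smul_zero, Finset.sum_ite_eq, Finset.mem_univ, if_true]
  apply Complex.ext <;> simp

theorem dual_eq_sum_realCoframe {n : ℕ} (θ : CDual n) :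
    θ = ∑ a, θ (realFrame n a) • realCoframe n a := by
  ext v
  conv_lhs => rw [← sum_realCoord_smul v]
  simp [realCoframe_apply, mul_comm]

/-- The unnormalised image of a function of `k` vectors in the exterior algebra. -/
def toExtAux {n : ℕ} (k : ℕ) (η : (Fin k → CSpace n) → ℂ) : ExtAlg n :=
  ∑ I : Fin k → Fin n ⊕ Fin n,
    η (realFrame n ∘ I) • ExteriorAlgebra.ιMulti ℂ k (realCoframe n ∘ I)

/-- The image of a form in the exterior algebra. -/
def toExt {n k : ℕ} : CForm n k →ₗ[ℂ] ExtAlg n where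
  -- The sum in `toExtAux` runs over all multi-indices rather than the increasing ones, which
  -- overcounts by `k!`.
  toFun η := ((Nat.factorial k : ℂ)⁻¹) • toExtAux k η
  map_add' η ζ := by
    simp [toExtAux, add_smul, Finset.sum_add_distrib]
  map_smul' c η := by
    simp [toExtAux, Finset.smul_sum, smul_smul, mul_left_comm]

theorem toExt_apply {n k : ℕ} (η : CForm n k) :
    toExt η = ((Nat.factorial k : ℂ)⁻¹) • toExtAux k η := rfl

/-- Evaluation of functionals at a vector. -/
def evalVec {n : ℕ} (v : CSpace n) : Module.Dual ℂ (CDual n) where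
  toFun θ := θ v
  map_add' _ _ := rfl
  map_smul' _ _ := rfl

/-- Evaluation of an element of the exterior algebra on `k` vectors. -/
def extEval {n k : ℕ} (w : Fin k → CSpace n) : ExtAlg n →ₗ[ℂ] ℂ :=
  ExteriorAlgebra.liftAlternating (Pi.single k
    (Matrix.detRowAlternating.compLinearMap
      (LinearMap.pi fun j : Fin k => evalVec (w j))))

theorem extEval_ιMulti {n k : ℕ} (w : Fin k → CSpace n) (θ : Fin k → CDual n) :
    extEval w (ExteriorAlgebra.ιMulti ℂ k θ) = (Matrix.of fun i j => θ i (w j)).det := by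
  rw [extEval, ExteriorAlgebra.liftAlternating_apply_ιMulti, Pi.single_eq_same]
  rfl

/-- Makes `toExt` injective. Expanding the determinant, each of the `k!` permutations contributes
the multilinear expansion of `η w` in the real frame, and this cancels `1/k!`. -/
theorem extEval_toExt {n k : ℕ} (w : Fin k → CSpace n) (η : CForm n k) :
    extEval w (toExt η) = η w := by
  have h1 : η w = ∑ I : Fin k → Fin n ⊕ Fin n,
      (∏ i, (realCoord (w i) (I i) : ℂ)) * η (realFrame n ∘ I) := by
    conv_lhs => rw [show w = fun i => ∑ a, realCoord (w i) a • realFrame n a from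
      funext fun i => (sum_realCoord_smul (w i)).symm]
    have := η.toMultilinearMap.map_sum (fun i a => realCoord (w i) a • realFrame n a)
    refine this.trans (Finset.sum_congr rfl fun I _ => ?_)
    rw [MultilinearMap.map_smul_univ]
    simp only [Complex.real_smul, Complex.ofReal_prod]
    rfl
  -- Reindexing the multi-index by `σ` produces a second factor `sign σ` from `η`, so the two signs
  -- cancel.
  have h2 : ∀ σ : Equiv.Perm (Fin k), ∑ I : Fin k → Fin n ⊕ Fin n, η (realFrame n ∘ I) *
      ((Equiv.Perm.sign σ : ℤ) : ℂ) * ∏ i, (realCoord (w i) (I (σ i)) : ℂ) = η w := by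
    intro σ
    rw [h1, ← Equiv.sum_comp (Equiv.arrowCongr σ (Equiv.refl (Fin n ⊕ Fin n)))]
    refine Finset.sum_congr rfl fun I _ => ?_
    have := η.toAlternatingMap.map_perm (realFrame n ∘ I) σ⁻¹
    change η ((realFrame n ∘ I) ∘ ⇑(σ⁻¹)) = _ • η (realFrame n ∘ I) at this
    have e : realFrame n ∘ (Equiv.arrowCongr σ (Equiv.refl (Fin n ⊕ Fin n))) I
        = (realFrame n ∘ I) ∘ ⇑(σ⁻¹) := by
      ext; rfl
    rw [e, this]
    rcases Int.units_eq_one_or (Equiv.Perm.sign σ) with h | h <;>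
      simp [h, Equiv.Perm.sign_inv, Equiv.arrowCongr, mul_comm]
  rw [toExt_apply, toExtAux, map_smul, map_sum]
  simp_rw [map_smul, extEval_ιMulti, Matrix.det_apply, smul_eq_mul, Finset.mul_sum]
  rw [Finset.sum_comm]
  simp only [Matrix.of_apply]
  have : ∀ σ : Equiv.Perm (Fin k), (∑ I : Fin k → Fin n ⊕ Fin n, (k.factorial : ℂ)⁻¹ * (η (realFrame n ∘ I) *
      (Equiv.Perm.sign σ • ∏ i, (realCoframe n ∘ I) (σ i) (w i)))) =
      (k.factorial : ℂ)⁻¹ * η w := by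
    intro σ
    rw [← h2 σ, Finset.mul_sum]
    refine Finset.sum_congr rfl fun I _ => ?_
    rcases Int.units_eq_one_or (Equiv.Perm.sign σ) with h | h <;> simp [h, realCoframe_apply]
  rw [Finset.sum_congr rfl fun σ _ => this σ]
  have hk : (k.factorial : ℂ) ≠ 0 := by exact_mod_cast k.factorial_ne_zero
  simp [Fintype.card_perm, hk]

theorem toExt_injective {n k : ℕ} : Function.Injective (toExt : CForm n k → ExtAlg n) := by
  intro η ζ h
  ext w
  rw [← extEval_toExt, h, extEval_toExt]

theorem toExt_castDeg {n k l : ℕ} (h : k = l) (η : CForm n k) : toExt (castDeg h η) = toExt η := by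
  subst h; rfl

/-- More than `2n` vectors of `ℂⁿ` are dependent over `ℝ`. The vanishing of forms of degree `2n + 1`
is what the Pfaffian formula is extracted from. -/
theorem toExt_eq_zero_of_lt {n k : ℕ} (h : 2 * n < k) (η : CForm n k) : toExt η = 0 := by
  have : η = 0 := by
    ext v
    refine η.toAlternatingMap.map_linearDependent v fun hv => ?_
    have h1 := hv.fintype_card_le_finrank
    have h2 : Module.finrank ℝ (CSpace n) = 2 * n := by
      rw [finrank_real_of_complex]; simp
    rw [h2, Fintype.card_fin] at h1
    omega
  rw [this, map_zero]

theorem toExt_oneForm {n : ℕ} (θ : CDual n) : toExt (oneForm θ) = ExteriorAlgebra.ι ℂ θ := by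
  rw [toExt_apply, toExtAux]
  conv_rhs => rw [dual_eq_sum_realCoframe θ, map_sum]
  rw [← Equiv.sum_comp (Equiv.funUnique (Fin 1) (Fin n ⊕ Fin n)).symm]
  simp [oneForm, ExteriorAlgebra.ιMulti_succ_apply]

/-- The alternating coframe product absorbs both the permutation and its sign; hence every summand
of an alternatization has the same image. -/
theorem toExtAux_domDomCongr_perm {n k : ℕ} (η : (Fin k → CSpace n) → ℂ) (σ : Equiv.Perm (Fin k)) :
    toExtAux k (fun v => ((Equiv.Perm.sign σ : ℤ) : ℂ) * η (v ∘ σ)) = toExtAux k η := by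
  rw [toExtAux, toExtAux, ← Equiv.sum_comp (Equiv.arrowCongr σ (Equiv.refl (Fin n ⊕ Fin n)))]
  refine Finset.sum_congr rfl fun I _ => ?_
  have e1 : (realFrame n ∘ (Equiv.arrowCongr σ (Equiv.refl (Fin n ⊕ Fin n))) I) ∘ σ
      = realFrame n ∘ I := by
    ext i : 1; simp [Equiv.arrowCongr]
  have e2 : realCoframe n ∘ (Equiv.arrowCongr σ (Equiv.refl (Fin n ⊕ Fin n))) I
      = (realCoframe n ∘ I) ∘ ⇑(σ⁻¹) := by
    ext; rfl
  rw [e1, e2, AlternatingMap.map_perm]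
  rcases Int.units_eq_one_or (Equiv.Perm.sign σ) with h | h <;> simp [h, Equiv.Perm.sign_inv]

/-- A shuffle is a coset of `S_k × S_l`, so the factor `k! l!` replaces the sum over shuffles by a
sum over all permutations. -/
theorem factorial_mul_wedge {n k l : ℕ} (η : CForm n k) (ζ : CForm n l)
    (v : Fin (k + l) → CSpace n) :
    ((k.factorial : ℂ) * l.factorial) * wedge η ζ v =
      ∑ σ : Equiv.Perm (Fin k ⊕ Fin l), ((Equiv.Perm.sign σ : ℤ) : ℂ) *
        (η (fun i => v (finSumFinEquiv (σ (Sum.inl i)))) *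
          ζ (fun i => v (finSumFinEquiv (σ (Sum.inr i))))) := by
  have h1 : wedge η ζ v = (LinearMap.mul' ℝ ℂ)
      ((η.toAlternatingMap.domCoprod ζ.toAlternatingMap) (v ∘ finSumFinEquiv)) := rfl
  have h2 := congrArg (fun f => (LinearMap.mul' ℝ ℂ) (f (v ∘ finSumFinEquiv)))
    (MultilinearMap.domCoprod_alternization_eq η.toAlternatingMap ζ.toAlternatingMap)
  simp only [AlternatingMap.smul_apply, map_nsmul, ← h1, MultilinearMap.alternatization_apply,
    map_sum, Fintype.card_fin] at h2
  rw [nsmul_eq_mul, Nat.cast_mul] at h2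
  rw [← h2]
  refine Finset.sum_congr rfl fun σ _ => ?_
  rcases Int.units_eq_one_or (Equiv.Perm.sign σ) with h | h <;>
    simp [h, MultilinearMap.domCoprod_apply]

/-- After multiplication by `k! l!` the wedge is a sum over `(k+l)!` permutations, all with the same
image, namely that of the unsymmetrised product `η ⊗ ζ`. The three factorials then cancel. -/
theorem toExt_wedge {n k l : ℕ} (η : CForm n k) (ζ : CForm n l) :
    toExt (wedge η ζ) = toExt η * toExt ζ := by
  have hk : (k.factorial : ℂ) ≠ 0 := by exact_mod_cast k.factorial_ne_zero
  have hl : (l.factorial : ℂ) ≠ 0 := by exact_mod_cast l.factorial_ne_zero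
  have hkl : ((k + l).factorial : ℂ) ≠ 0 := by exact_mod_cast (k + l).factorial_ne_zero
  have h0 : toExtAux (k + l) (fun v => η (fun i => v (finSumFinEquiv (Sum.inl i))) *
      ζ (fun i => v (finSumFinEquiv (Sum.inr i)))) = toExtAux k η * toExtAux l ζ := by
    rw [toExtAux, toExtAux, toExtAux, Finset.sum_mul_sum, ← Fintype.sum_prod_type',
      ← Equiv.sum_comp (Fin.appendEquiv k l)]
    refine Finset.sum_congr rfl fun I _ => ?_
    have e : realCoframe n ∘ (Fin.appendEquiv k l) I =
        Fin.append (realCoframe n ∘ I.1) (realCoframe n ∘ I.2) := by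
      ext i : 1
      refine Fin.addCases (fun i => ?_) (fun i => ?_) i <;> simp [Fin.appendEquiv]
    rw [smul_mul_smul_comm, ExteriorAlgebra.ιMulti_mul_ιMulti, e]
    congr 3 <;> ext i : 1 <;> simp [Fin.appendEquiv]
  have h1 : ((k.factorial : ℂ) * l.factorial) • toExtAux (k + l) (wedge η ζ) =
      ((k + l).factorial : ℂ) • (toExtAux k η * toExtAux l ζ) := by
    have e : ((k.factorial : ℂ) * l.factorial) • toExtAux (k + l) (wedge η ζ) =
        ∑ σ : Equiv.Perm (Fin k ⊕ Fin l), toExtAux (k + l) (fun v =>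
          ((Equiv.Perm.sign σ : ℤ) : ℂ) * (η (fun i => v (finSumFinEquiv (σ (Sum.inl i)))) *
          ζ (fun i => v (finSumFinEquiv (σ (Sum.inr i)))))) := by
      simp only [toExtAux]
      rw [Finset.sum_comm, Finset.smul_sum]
      refine Finset.sum_congr rfl fun I _ => ?_
      rw [smul_smul, factorial_mul_wedge, Finset.sum_smul]
    have hcard : (k + l).factorial =
        (Finset.univ : Finset (Equiv.Perm (Fin k ⊕ Fin l))).card := by
      simp [Finset.card_univ, Fintype.card_perm]
    rw [e, ← h0, hcard, Nat.cast_smul_eq_nsmul, ← Finset.sum_const]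
    refine Finset.sum_congr rfl fun σ _ => ?_
    have := toExtAux_domDomCongr_perm (n := n) (fun v => η (fun i => v (finSumFinEquiv (Sum.inl i))) *
      ζ (fun i => v (finSumFinEquiv (Sum.inr i)))) (Equiv.permCongr finSumFinEquiv σ)
    rw [← this]
    simp [Equiv.Perm.sign_permCongr]
  rw [toExt_apply, toExt_apply, toExt_apply, smul_mul_smul_comm,
    ← inv_smul_smul₀ (mul_ne_zero hk hl) (toExtAux (k + l) (wedge η ζ)), h1]
  simp only [smul_smul]
  congr 1
  field_simp

/-- Gives `d = ∑ dx^a ∧ ∂_a` in the exterior algebra. Moving the distinguished slot `i` to the front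
costs `(-1)^i`, the sign already in the alternatization, so the `k + 1` summands agree and
`(k+1)/(k+1)! = 1/k!`. -/
theorem toExt_alternatizeUncurryFin {n k : ℕ} (f : CSpace n →L[ℝ] CForm n k) :
    toExt (ContinuousAlternatingMap.alternatizeUncurryFin f) =
      ∑ a, ExteriorAlgebra.ι ℂ (realCoframe n a) * toExt (f (realFrame n a)) := by
  have hk : (k.factorial : ℂ) ≠ 0 := by exact_mod_cast k.factorial_ne_zero
  have hk1 : ((k : ℂ) + 1) ≠ 0 := by exact_mod_cast k.succ_ne_zero
  have h1 : toExtAux (k + 1) (ContinuousAlternatingMap.alternatizeUncurryFin f) =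
      ((k + 1 : ℕ) : ℂ) • ∑ a, ExteriorAlgebra.ι ℂ (realCoframe n a) *
        toExtAux k (f (realFrame n a)) := by
    have e : toExtAux (k + 1) (ContinuousAlternatingMap.alternatizeUncurryFin f) =
        ∑ i : Fin (k + 1), ∑ I : Fin (k + 1) → Fin n ⊕ Fin n,
          ((-1 : ℂ) ^ (i : ℕ) * f (realFrame n (I i)) (i.removeNth (realFrame n ∘ I))) •
            ExteriorAlgebra.ιMulti ℂ (k + 1) (realCoframe n ∘ I) := by
      rw [toExtAux, Finset.sum_comm]
      refine Finset.sum_congr rfl fun I _ => ?_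
      rw [ContinuousAlternatingMap.alternatizeUncurryFin_apply, Finset.sum_smul]
      simp
    rw [e, Nat.cast_smul_eq_nsmul]
    conv_rhs => rw [← Fintype.card_fin (k + 1), ← Finset.card_univ, ← Finset.sum_const]
    refine Finset.sum_congr rfl fun i _ => ?_
    rw [← Equiv.sum_comp (Fin.insertNthEquiv (fun _ => Fin n ⊕ Fin n) i), Fintype.sum_prod_type]
    refine Finset.sum_congr rfl fun a _ => ?_
    rw [toExtAux, Finset.mul_sum]
    refine Finset.sum_congr rfl fun I _ => ?_
    have e1 : realCoframe n ∘ (Fin.insertNthEquiv (fun _ => Fin n ⊕ Fin n) i) (a, I)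
        = i.insertNth (realCoframe n a) (realCoframe n ∘ I) := by
      ext j : 1
      refine Fin.succAboveCases i ?_ (fun j => ?_) j <;> simp
    have e2 : i.removeNth (realFrame n ∘ (Fin.insertNthEquiv (fun _ => Fin n ⊕ Fin n) i) (a, I))
        = realFrame n ∘ I := by
      ext j : 1
      simp [Fin.removeNth]
    rw [e1, e2, AlternatingMap.map_insertNth, ExteriorAlgebra.ιMulti_succ_apply]
    have e3 : ((-1 : ℂ) ^ (i : ℕ)) * (-1) ^ (i : ℕ) = 1 := by rw [← mul_pow]; simp
    simp only [Matrix.vecCons, Matrix.vecTail, Fin.cons_zero, Fin.cons_succ, Function.comp_def,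
      Fin.insertNthEquiv_apply, Fin.insertNth_apply_same, mul_smul_comm]
    rw [← Int.cast_smul_eq_zsmul ℂ, smul_smul]
    congr 1
    push_cast
    rw [mul_right_comm, e3, one_mul]
  rw [toExt_apply, h1]
  simp only [toExt_apply, mul_smul_comm, ← Finset.smul_sum, smul_smul]
  congr 1
  rw [Nat.factorial_succ]
  push_cast
  field_simp

theorem toExt_extDeriv {n k : ℕ} (η : CSpace n → CForm n k) (z : CSpace n) :
    toExt (extDeriv η z) = ∑ a, ExteriorAlgebra.ι ℂ (realCoframe n a) *
      toExt (fderiv ℝ η z (realFrame n a)) :=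
  toExt_alternatizeUncurryFin _

theorem ι_mul_toExt {n k : ℕ} (θ : CDual n) (η : CForm n k) :
    ExteriorAlgebra.ι ℂ θ * toExt η = (-1 : ℂ) ^ k • (toExt η * ExteriorAlgebra.ι ℂ θ) := by
  have h : ∀ (k : ℕ) (v : Fin k → CDual n), ExteriorAlgebra.ι ℂ θ * ExteriorAlgebra.ιMulti ℂ k v =
      (-1 : ℂ) ^ k • (ExteriorAlgebra.ιMulti ℂ k v * ExteriorAlgebra.ι ℂ θ) := by
    intro k
    induction k with
    | zero => intro v; simp
    | succ k ih =>
      intro v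
      rw [ExteriorAlgebra.ιMulti_succ_apply, ← mul_assoc,
        eq_neg_of_add_eq_zero_left (ExteriorAlgebra.ι_add_mul_swap θ (v 0)), neg_mul, mul_assoc,
        ih, pow_succ]
      simp [mul_assoc]
  rw [toExt_apply, toExtAux]
  simp only [mul_smul_comm, smul_mul_assoc, Finset.mul_sum, Finset.sum_mul, h, Finset.smul_sum]
  refine Finset.sum_congr rfl fun I _ => ?_
  simp only [smul_smul]
  congr 1
  ring

/-! ### Calculus of forms -/

theorem wedge_add_left {n k l : ℕ} (η η' : CForm n k) (ζ : CForm n l) :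
    wedge (η + η') ζ = wedge η ζ + wedge η' ζ :=
  toExt_injective (by simp only [toExt_wedge, map_add, add_mul])

theorem wedge_add_right {n k l : ℕ} (η : CForm n k) (ζ ζ' : CForm n l) :
    wedge η (ζ + ζ') = wedge η ζ + wedge η ζ' :=
  toExt_injective (by simp only [toExt_wedge, map_add, mul_add])

theorem wedge_smul_left {n k l : ℕ} (c : ℂ) (η : CForm n k) (ζ : CForm n l) :
    wedge (c • η) ζ = c • wedge η ζ :=
  toExt_injective (by simp only [toExt_wedge, map_smul, smul_mul_assoc])

theorem wedge_smul_right {n k l : ℕ} (c : ℂ) (η : CForm n k) (ζ : CForm n l) :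
    wedge η (c • ζ) = c • wedge η ζ :=
  toExt_injective (by simp only [toExt_wedge, map_smul, mul_smul_comm])

/-- A crude bound, one term per permutation; it serves only to make `wedge` a bounded bilinear map,
hence differentiable. -/
theorem norm_wedge_le {n k l : ℕ} (η : CForm n k) (ζ : CForm n l) :
    ‖wedge η ζ‖ ≤ (k + l).factorial * ‖η‖ * ‖ζ‖ := by
  refine ContinuousAlternatingMap.opNorm_le_bound _ (by positivity) fun v => ?_
  have h := congrArg norm (factorial_mul_wedge η ζ v)
  rw [norm_mul, norm_mul, Complex.norm_natCast, Complex.norm_natCast] at h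
  have h1 : (1 : ℝ) ≤ (k.factorial : ℝ) * l.factorial := by
    exact_mod_cast Nat.mul_pos k.factorial_pos l.factorial_pos
  refine (le_mul_of_one_le_left (norm_nonneg _) h1).trans (h.le.trans ?_)
  refine (norm_sum_le _ _).trans ?_
  have h2 : ∀ σ : Equiv.Perm (Fin k ⊕ Fin l), ‖((Equiv.Perm.sign σ : ℤ) : ℂ) *
        (η (fun i => v (finSumFinEquiv (σ (Sum.inl i)))) *
          ζ (fun i => v (finSumFinEquiv (σ (Sum.inr i)))))‖ ≤ ‖η‖ * ‖ζ‖ * ∏ i, ‖v i‖ := by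
    intro σ
    have e : ∏ i, ‖v i‖ = (∏ i, ‖v (finSumFinEquiv (σ (Sum.inl i)))‖) *
        ∏ i, ‖v (finSumFinEquiv (σ (Sum.inr i)))‖ := by
      rw [← Equiv.prod_comp (σ.trans finSumFinEquiv), Fintype.prod_sum_type]
      rfl
    have s : ‖((Equiv.Perm.sign σ : ℤ) : ℂ)‖ = 1 := by
      rcases Int.units_eq_one_or (Equiv.Perm.sign σ) with h | h <;> simp [h]
    rw [norm_mul, s, one_mul, norm_mul, e]
    calc _ ≤ (‖η‖ * ∏ i, ‖v (finSumFinEquiv (σ (Sum.inl i)))‖) *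
          (‖ζ‖ * ∏ i, ‖v (finSumFinEquiv (σ (Sum.inr i)))‖) :=
          mul_le_mul (η.le_opNorm _) (ζ.le_opNorm _) (norm_nonneg _) (by positivity)
      _ = _ := by ring
  refine (Finset.sum_le_sum fun σ _ => h2 σ).trans (le_of_eq ?_)
  rw [Finset.sum_const, Finset.card_univ, Fintype.card_perm, Fintype.card_sum, Fintype.card_fin,
    Fintype.card_fin, nsmul_eq_mul]
  ring

theorem isBoundedBilinearMap_wedge (n k l : ℕ) :
    IsBoundedBilinearMap ℝ fun p : CForm n k × CForm n l => wedge p.1 p.2 where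
  add_left := wedge_add_left
  smul_left c η ζ := by
    have h := wedge_smul_left (c : ℂ) η ζ
    rwa [RCLike.real_smul_eq_coe_smul (K := ℂ) c η,
      RCLike.real_smul_eq_coe_smul (K := ℂ) c (wedge η ζ)]
  add_right := wedge_add_right
  smul_right c η ζ := by
    have h := wedge_smul_right (c : ℂ) η ζ
    rwa [RCLike.real_smul_eq_coe_smul (K := ℂ) c ζ,
      RCLike.real_smul_eq_coe_smul (K := ℂ) c (wedge η ζ)]
  bound := ⟨(k + l).factorial, by positivity, norm_wedge_le⟩

section Calculus

variable {n k l : ℕ} {z : CSpace n}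

theorem DifferentiableAt.wedgeForm {η : CSpace n → CForm n k} {ζ : CSpace n → CForm n l}
    (hη : DifferentiableAt ℝ η z) (hζ : DifferentiableAt ℝ ζ z) :
    DifferentiableAt ℝ (fun w => wedge (η w) (ζ w)) z :=
  by
  have := (((isBoundedBilinearMap_wedge n k l).hasFDerivAt (η z, ζ z)).comp z
    (hη.hasFDerivAt.prodMk hζ.hasFDerivAt)).differentiableAt
  exact this

theorem fderiv_wedge {η : CSpace n → CForm n k} {ζ : CSpace n → CForm n l}
    (hη : DifferentiableAt ℝ η z) (hζ : DifferentiableAt ℝ ζ z) (v : CSpace n) :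
    fderiv ℝ (fun w => wedge (η w) (ζ w)) z v =
      wedge (η z) (fderiv ℝ ζ z v) + wedge (fderiv ℝ η z v) (ζ z) := by
  have := (((isBoundedBilinearMap_wedge n k l).hasFDerivAt (η z, ζ z)).comp z
    (hη.hasFDerivAt.prodMk hζ.hasFDerivAt)).fderiv
  have h2 := congrArg (fun L => L v) this
  exact h2

theorem toExt_extDeriv_wedge {η : CSpace n → CForm n k} {ζ : CSpace n → CForm n l}
    (hη : DifferentiableAt ℝ η z) (hζ : DifferentiableAt ℝ ζ z) :
    toExt (extDeriv (fun w => wedge (η w) (ζ w)) z) =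
      toExt (extDeriv η z) * toExt (ζ z) + (-1 : ℂ) ^ k • (toExt (η z) * toExt (extDeriv ζ z)) := by
  simp only [toExt_extDeriv, fderiv_wedge hη hζ, map_add, toExt_wedge, mul_add,
    Finset.sum_add_distrib, Finset.sum_mul, Finset.mul_sum, Finset.smul_sum]
  rw [add_comm]
  congr 1
  · exact Finset.sum_congr rfl fun a _ => (mul_assoc _ _ _).symm
  · refine Finset.sum_congr rfl fun a _ => ?_
    rw [← mul_assoc, ι_mul_toExt, smul_mul_assoc, mul_assoc]

theorem toExt_extDeriv_smul {c : CSpace n → ℂ} {η : CSpace n → CForm n k}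
    (hc : DifferentiableAt ℝ c z) (hη : DifferentiableAt ℝ η z) :
    toExt (extDeriv (fun w => c w • η w) z) =
      ExteriorAlgebra.ι ℂ (fderiv ℝ c z) * toExt (η z) + c z • toExt (extDeriv η z) := by
  have h : ∀ v, toExt (fderiv ℝ (fun w => c w • η w) z v) =
      c z • toExt (fderiv ℝ η z v) + fderiv ℝ c z v • toExt (η z) := by
    intro v
    rw [fderiv_fun_smul hc hη, add_apply, ContinuousLinearMap.smulRight_apply, map_add, map_smul,
      smul_apply, map_smul]
  have h2 : ExteriorAlgebra.ι ℂ (fderiv ℝ c z) =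
      ∑ a, fderiv ℝ c z (realFrame n a) • ExteriorAlgebra.ι ℂ (realCoframe n a) := by
    conv_lhs => rw [dual_eq_sum_realCoframe (fderiv ℝ c z), map_sum]
    simp only [map_smul]
  rw [h2, toExt_extDeriv, toExt_extDeriv, Finset.sum_mul, Finset.smul_sum,
    ← Finset.sum_add_distrib]
  refine Finset.sum_congr rfl fun a _ => ?_
  rw [h, mul_add, mul_smul_comm, mul_smul_comm, smul_mul_assoc, add_comm]

theorem toExt_extDeriv_sum {ι' : Type*} (s : Finset ι') {η : ι' → CSpace n → CForm n k}
    (hη : ∀ i ∈ s, DifferentiableAt ℝ (η i) z) :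
    toExt (extDeriv (fun w => ∑ i ∈ s, η i w) z) = ∑ i ∈ s, toExt (extDeriv (η i) z) := by
  simp only [toExt_extDeriv, fderiv_fun_sum hη, sum_apply, map_sum,
    Finset.mul_sum]
  exact Finset.sum_comm

theorem toExt_extDeriv_smul_const {c : CSpace n → ℂ} (hc : DifferentiableAt ℝ c z)
    (η : CForm n k) : toExt (extDeriv (fun w => c w • η) z) =
      ExteriorAlgebra.ι ℂ (fderiv ℝ c z) * toExt η := by
  rw [toExt_extDeriv_smul hc (differentiableAt_const η)]
  simp [toExt_extDeriv]

theorem toExt_wedgePow (η : CForm n 2) (k : ℕ) : toExt (wedgePow η k) = toExt η ^ k := by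
  induction k with
  | zero =>
    rw [toExt_apply, toExtAux]
    change ((Nat.factorial 0 : ℂ)⁻¹) • ∑ I : Fin 0 → Fin n ⊕ Fin n, (1 : ℂ) • _ = _
    simp
  | succ k ih => rw [wedgePow, toExt_wedge, ih, pow_succ]

theorem toExt_divPow (η : CForm n 2) (k : ℕ) :
    toExt (divPow η k) = (k.factorial : ℂ)⁻¹ • toExt η ^ k := by
  rw [divPow, map_smul, toExt_wedgePow]

theorem DifferentiableAt.wedgePowForm {η : CSpace n → CForm n 2} (hη : DifferentiableAt ℝ η z)
    (k : ℕ) : DifferentiableAt ℝ (fun w => wedgePow (η w) k) z := by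
  induction k with
  | zero => exact differentiableAt_const _
  | succ k ih => exact DifferentiableAt.wedgeForm ih hη

/-- Closedness at the single point `z` suffices, because the Leibniz rule at `z` involves only
`extDeriv η z`. -/
theorem toExt_extDeriv_wedgePow_of_closed {η : CSpace n → CForm n 2}
    (hη : DifferentiableAt ℝ η z) (h : extDeriv η z = 0) (k : ℕ) :
    toExt (extDeriv (fun w => wedgePow (η w) k) z) = 0 := by
  induction k with
  | zero =>
    have : (fun w => wedgePow (η w) 0) = fun _ => wedgePow (0 : CForm n 2) 0 := rfl
    rw [this, toExt_extDeriv]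
    simp
  | succ k ih =>
    have : (fun w => wedgePow (η w) (k + 1)) = fun w => wedge (wedgePow (η w) k) (η w) := rfl
    rw [this, toExt_extDeriv_wedge (DifferentiableAt.wedgePowForm hη k) hη, ih, h]
    simp

/-- Multiplying by a divided power of a closed `2`-form commutes with the exterior derivative. -/
theorem toExt_extDeriv_wedge_divPow {η : CSpace n → CForm n l} {ζ : CSpace n → CForm n 2}
    (hη : DifferentiableAt ℝ η z) (hζ : DifferentiableAt ℝ ζ z) (h : extDeriv ζ z = 0) (k : ℕ) :
    toExt (extDeriv (fun w => wedge (η w) (divPow (ζ w) k)) z) =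
      toExt (extDeriv η z) * toExt (divPow (ζ z) k) := by
  have hd : DifferentiableAt ℝ (fun w => divPow (ζ w) k) z :=
    (DifferentiableAt.wedgePowForm hζ k).const_smul ((k.factorial : ℂ)⁻¹)
  have h0 : toExt (extDeriv (fun w => divPow (ζ w) k) z) = 0 := by
    have := toExt_extDeriv_smul (c := fun _ => (k.factorial : ℂ)⁻¹) (differentiableAt_const _)
      (DifferentiableAt.wedgePowForm hζ k)
    simp only [divPow]
    rw [this, toExt_extDeriv_wedgePow_of_closed hζ h]
    simp
  rw [toExt_extDeriv_wedge hη hd, h0]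
  simp

end Calculus

/-! ### Complex coframe and the Pfaffian formula -/

section Pfaffian

variable {n : ℕ}

/-- The functional `z^α`. -/
def dzL (α : Fin n) : CDual n := (EuclideanSpace.proj α : CSpace n →L[ℂ] ℂ).restrictScalars ℝ

/-- The functional `\bar z^α`. -/
def dzbarL (α : Fin n) : CDual n := (Complex.conjCLE : ℂ →L[ℝ] ℂ).comp (dzL α)

theorem dzL_apply (α : Fin n) (v : CSpace n) : dzL α v = v α := rfl

theorem dzbarL_apply (α : Fin n) (v : CSpace n) : dzbarL α v = (starRingEnd ℂ) (v α) := rfl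

theorem dz_eq (α : Fin n) : dz α = oneForm (dzL α) := rfl

theorem dzbar_eq (α : Fin n) : dzbar α = oneForm (dzbarL α) := rfl

/-- The complex vector `∂/∂z^α` as a functional on `1`-forms. -/
def delZ (α : Fin n) : Module.Dual ℂ (CDual n) :=
  (1 / 2 : ℂ) • (evalVec (eX α) - Complex.I • evalVec (eY α))

/-- The complex vector `∂/∂\bar z^α` as a functional on `1`-forms. -/
def delZbar (α : Fin n) : Module.Dual ℂ (CDual n) :=
  (1 / 2 : ℂ) • (evalVec (eX α) + Complex.I • evalVec (eY α))

theorem delZ_apply (α : Fin n) (θ : CDual n) :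
    delZ α θ = (1 / 2 : ℂ) * (θ (eX α) - Complex.I * θ (eY α)) := rfl

theorem delZbar_apply (α : Fin n) (θ : CDual n) :
    delZbar α θ = (1 / 2 : ℂ) * (θ (eX α) + Complex.I * θ (eY α)) := rfl

theorem delZ_dzL (α β : Fin n) : delZ α (dzL β) = if α = β then 1 else 0 := by
  by_cases h : α = β
  · subst h; norm_num [delZ_apply, dzL_apply, eX, eY]
  · simp [delZ_apply, dzL_apply, eX, eY, h, Ne.symm h]

theorem delZ_dzbarL (α β : Fin n) : delZ α (dzbarL β) = 0 := by
  by_cases h : α = β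
  · subst h; simp [delZ_apply, dzbarL_apply, eX, eY]
  · simp [delZ_apply, dzbarL_apply, eX, eY, Ne.symm h]

theorem delZbar_dzL (α β : Fin n) : delZbar α (dzL β) = 0 := by
  by_cases h : α = β
  · subst h; simp [delZbar_apply, dzL_apply, eX, eY]
  · simp [delZbar_apply, dzL_apply, eX, eY, Ne.symm h]

theorem delZbar_dzbarL (α β : Fin n) : delZbar α (dzbarL β) = if α = β then 1 else 0 := by
  by_cases h : α = β
  · subst h; norm_num [delZbar_apply, dzbarL_apply, eX, eY]
  · simp [delZbar_apply, dzbarL_apply, eX, eY, h, Ne.symm h]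

theorem dual_eq_sum_dz (θ : CDual n) :
    θ = ∑ α, (delZ α θ • dzL α + delZbar α θ • dzbarL α) := by
  conv_lhs => rw [dual_eq_sum_realCoframe θ]
  rw [Fintype.sum_sum_type, ← Finset.sum_add_distrib]
  refine Finset.sum_congr rfl fun α _ => ?_
  ext v
  simp only [add_apply, smul_apply, realCoframe_apply,
    realCoord, realFrame, Sum.elim_inl, Sum.elim_inr, delZ_apply, delZbar_apply, dzL_apply,
    dzbarL_apply, smul_eq_mul]
  have h1 : (starRingEnd ℂ) (v α) = (v α).re - (v α).im * Complex.I := by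
    apply Complex.ext <;> simp
  have h2 : v α = (v α).re + (v α).im * Complex.I := (Complex.re_add_im (v α)).symm
  rw [h1]
  conv_rhs => rw [h2]
  simp only [Complex.add_re, Complex.add_im, Complex.ofReal_re, Complex.mul_re, Complex.I_re,
    mul_zero, Complex.ofReal_im, Complex.I_im, mul_one, sub_self, add_zero, Complex.mul_im,
    zero_add]
  linear_combination ((θ (eY α)) * (v α).im) * Complex.I_sq

/-- The Poisson pairing of `1`-forms inverse to the `2`-form `(√-1/2) G_{αβ} dz^α ∧ d\bar z^β`. -/
def poisson (G : Matrix (Fin n) (Fin n) ℂ) (θ θ' : CDual n) : ℂ :=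
  -2 * Complex.I * ∑ α, ∑ β, hermInv G α β *
    (delZ α θ * delZbar β θ' - delZbar β θ * delZ α θ')

/-- The `2`-form `(√-1/2) G_{αβ} dz^α ∧ d\bar z^β`. -/
def hermForm (G : Matrix (Fin n) (Fin n) ℂ) : CForm n 2 :=
  ∑ α, ∑ β, (Complex.I / 2 * G α β) • wedge (dz α) (dzbar β)

theorem toExt_wedge_dz_dzbar (α β : Fin n) : toExt (wedge (dz α) (dzbar β) : CForm n 2) =
    ExteriorAlgebra.ι ℂ (dzL α) * ExteriorAlgebra.ι ℂ (dzbarL β) := by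
  rw [← toExt_oneForm, ← toExt_oneForm]
  exact toExt_wedge _ _

theorem toExt_hermForm (G : Matrix (Fin n) (Fin n) ℂ) :
    toExt (hermForm G) = ∑ α, ∑ β, (Complex.I / 2 * G α β) •
      (ExteriorAlgebra.ι ℂ (dzL α) * ExteriorAlgebra.ι ℂ (dzbarL β)) := by
  simp only [hermForm, map_sum, map_smul, toExt_wedge_dz_dzbar]

-- Contraction is an antiderivation; passing it through a `2`-form costs no sign.
open CliffordAlgebra in
theorem contractLeft_hermForm_mul (G : Matrix (Fin n) (Fin n) ℂ) (d : Module.Dual ℂ (CDual n))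
    (x : ExtAlg n) :
    contractLeft d (toExt (hermForm G) * x) =
      ExteriorAlgebra.ι ℂ (∑ α, ∑ β, (Complex.I / 2 * G α β) •
        (d (dzL α) • dzbarL β - d (dzbarL β) • dzL α)) * x
      + toExt (hermForm G) * contractLeft d x := by
  have h : ∀ θ θ' : CDual n, contractLeft d
      (ExteriorAlgebra.ι ℂ θ * ExteriorAlgebra.ι ℂ θ' * x : ExtAlg n) =
      ExteriorAlgebra.ι ℂ (d θ • θ' - d θ' • θ) * x
        + ExteriorAlgebra.ι ℂ θ * ExteriorAlgebra.ι ℂ θ' * contractLeft d x := by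
    intro θ θ'
    rw [mul_assoc, ExteriorAlgebra.ι, contractLeft_ι_mul, contractLeft_ι_mul]
    simp only [map_sub, map_smul, sub_mul, mul_sub, smul_mul_assoc, mul_smul_comm, mul_assoc]
    abel
  simp only [toExt_hermForm, Finset.sum_mul, map_sum, smul_mul_assoc, map_smul, h, smul_add,
    Finset.sum_add_distrib]

theorem ι_mul_toExt_two (θ : CDual n) (η : CForm n 2) :
    ExteriorAlgebra.ι ℂ θ * toExt η = toExt η * ExteriorAlgebra.ι ℂ θ := by
  simpa using ι_mul_toExt θ η

-- The power rule for a derivation: `2`-forms commute with `1`-forms, so contracting `ω^{k+1}` gives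
-- `(k+1) ξ ∧ ω^k`, with `ξ` the contraction of `ω`.
open CliffordAlgebra in
theorem contractLeft_divPow_hermForm (G : Matrix (Fin n) (Fin n) ℂ) (d : Module.Dual ℂ (CDual n))
    (ξ : CDual n) (hξ : ∑ α, ∑ β, (Complex.I / 2 * G α β) •
        (d (dzL α) • dzbarL β - d (dzbarL β) • dzL α) = ξ) (k : ℕ) :
    contractLeft d (toExt (divPow (hermForm G) (k + 1))) =
      ExteriorAlgebra.ι ℂ ξ * toExt (divPow (hermForm G) k) := by
  have h : ∀ k : ℕ, contractLeft d (toExt (hermForm G) ^ (k + 1)) =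
      ((k + 1 : ℕ) : ℂ) • (ExteriorAlgebra.ι ℂ ξ * toExt (hermForm G) ^ k) := by
    intro k
    induction k with
    | zero =>
      have := contractLeft_hermForm_mul G d 1
      rw [hξ, contractLeft_one, mul_zero, add_zero] at this
      simpa using this
    | succ k ih =>
      rw [pow_succ', contractLeft_hermForm_mul, hξ, ih, mul_smul_comm, ← mul_assoc,
        ← ι_mul_toExt_two, mul_assoc, ← pow_succ']
      push_cast
      module
  have hk : ((k : ℂ) + 1) ≠ 0 := by exact_mod_cast k.succ_ne_zero
  rw [toExt_divPow, toExt_divPow, map_smul, h, mul_smul_comm, smul_smul, Nat.factorial_succ]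
  congr 1
  push_cast
  field_simp

/-- The complex vector dual to a `1`-form with respect to `hermForm G`. -/
def hermDual (G : Matrix (Fin n) (Fin n) ℂ) (θ : CDual n) : Module.Dual ℂ (CDual n) :=
  ∑ α, ∑ β, (2 * Complex.I * hermInv G α β) • (delZ α θ • delZbar β - delZbar β θ • delZ α)

theorem hermDual_apply (G : Matrix (Fin n) (Fin n) ℂ) (θ θ' : CDual n) :
    hermDual G θ θ' = poisson G θ' θ := by
  simp only [hermDual, poisson, LinearMap.sum_apply, LinearMap.smul_apply, LinearMap.sub_apply,
    smul_eq_mul, Finset.mul_sum]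
  refine Finset.sum_congr rfl fun α _ => Finset.sum_congr rfl fun β _ => ?_
  ring

/-- The defining property of the dual vector: its contraction with `ω` is `θ`. The constant `2√-1`
in `hermDual` inverts the `√-1/2` of `ω` up to the sign fixed by the order of contraction. -/
theorem hermForm_hermDual {G : Matrix (Fin n) (Fin n) ℂ} (hG : IsUnit G.det) (θ : CDual n) :
    ∑ α, ∑ β, (Complex.I / 2 * G α β) •
      (hermDual G θ (dzL α) • dzbarL β - hermDual G θ (dzbarL β) • dzL α) = θ := by
  have h1 : ∀ α, hermDual G θ (dzL α) = ∑ β, -2 * Complex.I * hermInv G α β * delZbar β θ := by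
    intro α
    simp [hermDual_apply, poisson, delZ_dzL, delZbar_dzL, Finset.mul_sum, mul_assoc]
  have h2 : ∀ β, hermDual G θ (dzbarL β) = ∑ α, 2 * Complex.I * hermInv G α β * delZ α θ := by
    intro α
    simp [hermDual_apply, poisson, delZ_dzbarL, delZbar_dzbarL, Finset.mul_sum, mul_assoc]
  have h3 : ∀ β γ, ∑ α, G α β * hermInv G α γ = if β = γ then 1 else 0 := by
    intro β γ
    have := congrFun (congrFun (Matrix.nonsing_inv_mul G hG) γ) β
    rw [Matrix.mul_apply, Matrix.one_apply] at this
    simp only [hermInv, mul_comm (G _ _), this, eq_comm]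
  have h4 : ∀ α γ, ∑ β, G α β * hermInv G γ β = if α = γ then 1 else 0 := by
    intro α γ
    have := congrFun (congrFun (Matrix.mul_nonsing_inv G hG) α) γ
    rwa [Matrix.mul_apply, Matrix.one_apply] at this
  conv_rhs => rw [dual_eq_sum_dz θ, Finset.sum_add_distrib, add_comm]
  simp only [smul_sub, Finset.sum_sub_distrib]
  rw [sub_eq_add_neg]
  congr 1
  · rw [Finset.sum_comm]
    refine Finset.sum_congr rfl fun β _ => ?_
    simp only [smul_smul, ← Finset.sum_smul, h1, Finset.mul_sum]
    congr 1
    rw [Finset.sum_comm]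
    have : ∀ γ, ∑ α, Complex.I / 2 * G α β * (-2 * Complex.I * hermInv G α γ * delZbar γ θ) =
        if β = γ then delZbar γ θ else 0 := by
      intro γ
      rw [show (if β = γ then delZbar γ θ else 0) = (if β = γ then 1 else 0) * delZbar γ θ by simp,
        ← h3, Finset.sum_mul]
      refine Finset.sum_congr rfl fun α _ => ?_
      linear_combination (- G α β * hermInv G α γ * delZbar γ θ) * Complex.I_sq
    simp only [this, Finset.sum_ite_eq, Finset.mem_univ, if_true]
  · rw [← Finset.sum_neg_distrib]
    refine Finset.sum_congr rfl fun α _ => ?_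
    simp only [smul_smul, ← Finset.sum_smul, ← neg_smul, h2, Finset.mul_sum]
    congr 1
    rw [Finset.sum_comm, ← Finset.sum_neg_distrib]
    have : ∀ γ, -∑ β, Complex.I / 2 * G α β * (2 * Complex.I * hermInv G γ β * delZ γ θ) =
        if α = γ then delZ γ θ else 0 := by
      intro γ
      rw [show (if α = γ then delZ γ θ else 0) = (if α = γ then 1 else 0) * delZ γ θ by simp,
        ← h4, Finset.sum_mul, ← Finset.sum_neg_distrib]
      refine Finset.sum_congr rfl fun β _ => ?_
      linear_combination (- G α β * hermInv G γ β * delZ γ θ) * Complex.I_sq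
    simp only [this, Finset.sum_ite_eq, Finset.mem_univ, if_true]

-- `θ₁ ∧ ω^n/n!` vanishes for reasons of degree. Contracting this zero with the vector dual to `θ₂`
-- gives the difference of the two sides.
open CliffordAlgebra in
theorem ι_mul_ι_mul_divPow {G : Matrix (Fin n) (Fin n) ℂ} (hG : IsUnit G.det) (k : ℕ)
    (hk : n = k + 1) (θ₁ θ₂ : CDual n) :
    ExteriorAlgebra.ι ℂ θ₁ * ExteriorAlgebra.ι ℂ θ₂ * toExt (divPow (hermForm G) k) =
      poisson G θ₁ θ₂ • toExt (divPow (hermForm G) (k + 1)) := by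
  have h0 : ExteriorAlgebra.ι ℂ θ₁ * toExt (divPow (hermForm G) (k + 1)) = 0 := by
    rw [← toExt_oneForm, ← toExt_wedge]
    exact toExt_eq_zero_of_lt (by omega) _
  have h1 := congrArg (contractLeft (hermDual G θ₂)) h0
  rw [map_zero, ExteriorAlgebra.ι, contractLeft_ι_mul,
    contractLeft_divPow_hermForm G _ θ₂ (hermForm_hermDual hG θ₂), hermDual_apply, ← mul_assoc,
    sub_eq_zero] at h1
  exact h1.symm

open CliffordAlgebra in
/-- The product of four `1`-forms with `ω^{n-2}/(n-2)!` is a Pfaffian. -/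
theorem ι_mul_ι_mul_ι_mul_ι_mul_divPow {G : Matrix (Fin n) (Fin n) ℂ} (hG : IsUnit G.det) (k : ℕ)
    (hk : n = k + 2) (θ₁ θ₂ θ₃ θ₄ : CDual n) :
    ExteriorAlgebra.ι ℂ θ₁ * ExteriorAlgebra.ι ℂ θ₂ * ExteriorAlgebra.ι ℂ θ₃ *
        ExteriorAlgebra.ι ℂ θ₄ * toExt (divPow (hermForm G) k) =
      (poisson G θ₁ θ₄ * poisson G θ₂ θ₃ - poisson G θ₂ θ₄ * poisson G θ₁ θ₃
        + poisson G θ₃ θ₄ * poisson G θ₁ θ₂) • toExt (divPow (hermForm G) (k + 2)) := by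
  -- A form of degree `3 + 2(n-1) = 2n + 1`. Contraction with the vector dual to `θ₄` hits each of
  -- `θ₁, θ₂, θ₃` and `ω` once; each of the first three terms leaves two `1`-forms, evaluated by
  -- `ι_mul_ι_mul_divPow`.
  have h0 : ExteriorAlgebra.ι ℂ θ₁ * (ExteriorAlgebra.ι ℂ θ₂ * (ExteriorAlgebra.ι ℂ θ₃ *
      toExt (divPow (hermForm G) (k + 1)))) = 0 := by
    rw [← toExt_oneForm, ← toExt_oneForm, ← toExt_oneForm, ← toExt_wedge, ← toExt_wedge,
      ← toExt_wedge]
    exact toExt_eq_zero_of_lt (by omega) _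
  have h1 := congrArg (contractLeft (hermDual G θ₄)) h0
  simp only [ExteriorAlgebra.ι] at h1
  rw [map_zero, contractLeft_ι_mul, contractLeft_ι_mul, contractLeft_ι_mul,
    contractLeft_divPow_hermForm G _ θ₄ (hermForm_hermDual hG θ₄)] at h1
  simp only [hermDual_apply, mul_sub, mul_smul_comm, ← mul_assoc] at h1
  have e := ι_mul_ι_mul_divPow hG (k + 1) hk
  simp only [ExteriorAlgebra.ι] at e
  simp only [ExteriorAlgebra.ι]
  rw [e, e, e] at h1
  rw [add_smul, sub_smul, mul_smul, mul_smul, mul_smul, eq_comm, ← sub_eq_zero, ← h1,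
    ExteriorAlgebra.ι]
  abel

end Pfaffian

/-! ### Metrics in coordinates -/

section Coordinates

variable {E : Type*} [NormedAddCommGroup E] [NormedSpace ℝ E]

theorem contDiffAt_fderiv_apply {F : Type*} [NormedAddCommGroup F] [NormedSpace ℝ F]
    {f : E → F} {x : E} (hf : ContDiffAt ℝ ∞ f x) (v : E) :
    ContDiffAt ℝ ∞ (fun y => fderiv ℝ f y v) x :=
  (hf.fderiv_right (m := ∞) (by simp)).clm_apply contDiffAt_const

theorem fderiv_fderiv_comm {F : Type*} [NormedAddCommGroup F] [NormedSpace ℝ F]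
    {f : E → F} {x : E} (hf : ContDiffAt ℝ ∞ f x) (v w : E) :
    fderiv ℝ (fun y => fderiv ℝ f y v) x w = fderiv ℝ (fun y => fderiv ℝ f y w) x v := by
  have hd : DifferentiableAt ℝ (fderiv ℝ f) x :=
    (hf.fderiv_right (m := ∞) (by simp)).differentiableAt (by simp)
  rw [fderiv_clm_apply hd (differentiableAt_const v), fderiv_clm_apply hd (differentiableAt_const w)]
  have hs : IsSymmSndFDerivAt ℝ f x := hf.isSymmSndFDerivAt (by
    rw [minSmoothness_of_isRCLikeNormedField]; exact ENat.LEInfty.out)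
  simpa using hs w v

variable {ι : Type*} [Fintype ι] [DecidableEq ι]

/-- Smooth, symmetric, nondegenerate metric coefficients on an open set. -/
structure IsMetricOn (G : E → Matrix ι ι ℝ) (s : Set E) : Prop where
  isOpen : IsOpen s
  smooth : ∀ a c, ∀ x ∈ s, ContDiffAt ℝ ∞ (fun y => G y a c) x
  symm : ∀ x ∈ s, ∀ a c, G x a c = G x c a
  isUnit : ∀ x ∈ s, IsUnit (G x).det

theorem contDiffAt_det {A : E → Matrix ι ι ℝ} {x : E}
    (h : ∀ a c, ContDiffAt ℝ ∞ (fun y => A y a c) x) : ContDiffAt ℝ ∞ (fun y => (A y).det) x := by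
  simp only [Matrix.det_apply]
  refine ContDiffAt.sum fun σ _ => ?_
  simp only [Units.smul_def, zsmul_eq_mul]
  exact contDiffAt_const.mul (contDiffAt_prod fun i _ => h _ _)

theorem contDiffAt_matrix_inv {A : E → Matrix ι ι ℝ} {x : E}
    (h : ∀ a c, ContDiffAt ℝ ∞ (fun y => A y a c) x) (hu : IsUnit (A x).det) (a c : ι) :
    ContDiffAt ℝ ∞ (fun y => (A y)⁻¹ a c) x := by
  simp only [Matrix.inv_def, Matrix.smul_apply, Ring.inverse_eq_inv', smul_eq_mul,
    Matrix.adjugate_apply]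
  refine ((contDiffAt_det h).inv hu.ne_zero).mul (contDiffAt_det fun i j => ?_)
  simp only [Matrix.updateRow_apply]
  split_ifs
  · exact contDiffAt_const
  · exact h _ _

variable {G : E → Matrix ι ι ℝ} {s : Set E} (b : ι → E)

theorem IsMetricOn.contDiffAt_christoffel (hG : IsMetricOn G s) {x : E} (hx : x ∈ s) (c a d : ι) :
    ContDiffAt ℝ ∞ (christoffel b G c a d) x := by
  unfold christoffel
  refine contDiffAt_const.mul (ContDiffAt.sum fun e _ => ?_)
  refine (contDiffAt_matrix_inv (fun a c => hG.smooth a c x hx) (hG.isUnit x hx) c e).mul ?_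
  exact ((contDiffAt_fderiv_apply (hG.smooth _ _ x hx) _).add
    (contDiffAt_fderiv_apply (hG.smooth _ _ x hx) _)).sub
    (contDiffAt_fderiv_apply (hG.smooth _ _ x hx) _)

theorem IsMetricOn.fderiv_symm (hG : IsMetricOn G s) {x : E} (hx : x ∈ s) (a c : ι) :
    fderiv ℝ (fun y => G y a c) x = fderiv ℝ (fun y => G y c a) x :=
  Filter.EventuallyEq.fderiv_eq
    (Filter.mem_of_superset (hG.isOpen.mem_nhds hx) fun y hy => hG.symm y hy a c)

theorem IsMetricOn.christoffel_symm (hG : IsMetricOn G s) {x : E} (hx : x ∈ s) (c a d : ι) :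
    christoffel b G c a d x = christoffel b G c d a x := by
  unfold christoffel
  congr 1
  refine Finset.sum_congr rfl fun e _ => ?_
  rw [hG.fderiv_symm hx a d, add_comm (fderiv ℝ (fun y => G y e d) x (b a))]

/-- Christoffel symbols of the first kind: lowering the index cancels the inverse metric. -/
theorem IsMetricOn.sum_mul_christoffel (hG : IsMetricOn G s) {x : E} (hx : x ∈ s) (j a d : ι) :
    ∑ r, G x j r * christoffel b G r a d x = (1 / 2 : ℝ) *
      (fderiv ℝ (fun y => G y j d) x (b a) + fderiv ℝ (fun y => G y j a) x (b d)
      - fderiv ℝ (fun y => G y a d) x (b j)) := by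
  have h : ∀ e, ∑ r, G x j r * (G x)⁻¹ r e = if j = e then 1 else 0 := by
    intro e
    have := congrFun (congrFun (Matrix.mul_nonsing_inv (G x) (hG.isUnit x hx)) j) e
    rwa [Matrix.mul_apply, Matrix.one_apply] at this
  simp only [christoffel, Finset.mul_sum]
  rw [Finset.sum_comm]
  have h2 : ∀ e, ∑ r, G x j r * (1 / 2 * ((G x)⁻¹ r e *
      (fderiv ℝ (fun y => G y e d) x (b a) + fderiv ℝ (fun y => G y e a) x (b d)
      - fderiv ℝ (fun y => G y a d) x (b e)))) = (if j = e then 1 else 0) * (1 / 2 *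
      (fderiv ℝ (fun y => G y e d) x (b a) + fderiv ℝ (fun y => G y e a) x (b d)
      - fderiv ℝ (fun y => G y a d) x (b e))) := by
    intro e
    rw [← h, Finset.sum_mul]
    exact Finset.sum_congr rfl fun r _ => by ring
  simp only [h2, ite_mul, one_mul, zero_mul, Finset.sum_ite_eq, Finset.mem_univ, if_true]

/-- The Levi-Civita connection is compatible with the metric. -/
theorem IsMetricOn.fderiv_eq (hG : IsMetricOn G s) {x : E} (hx : x ∈ s) (l i j : ι) :
    fderiv ℝ (fun y => G y i j) x (b l) =
      ∑ r, (G x j r * christoffel b G r l i x + G x i r * christoffel b G r l j x) := by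
  rw [Finset.sum_add_distrib, hG.sum_mul_christoffel b hx, hG.sum_mul_christoffel b hx,
    hG.fderiv_symm hx j i, hG.fderiv_symm hx l i, hG.fderiv_symm hx l j]
  ring

theorem IsMetricOn.curvatureUp_antisymm (i j k l : ι) (x : E) :
    curvatureUp b G i j k l x = - curvatureUp b G j i k l x := by
  simp only [curvatureUp, Finset.sum_sub_distrib]
  ring

theorem curvature_antisymm (i j k l : ι) (x : E) :
    curvature b G i j k l x = - curvature b G j i k l x := by
  simp only [curvature, ← Finset.sum_neg_distrib]
  exact Finset.sum_congr rfl fun p _ => by rw [IsMetricOn.curvatureUp_antisymm]; ring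

theorem IsMetricOn.fderiv_christoffel_symm (hG : IsMetricOn G s) {x : E} (hx : x ∈ s)
    (c a d : ι) : fderiv ℝ (christoffel b G c a d) x = fderiv ℝ (christoffel b G c d a) x :=
  Filter.EventuallyEq.fderiv_eq
    (Filter.mem_of_superset (hG.isOpen.mem_nhds hx) fun _ hy => hG.christoffel_symm b hy c a d)

/-- By symmetry of `Γ` in its lower indices the cyclic sum cancels for each upper index `p`, before
lowering. -/
theorem IsMetricOn.curvature_bianchi (hG : IsMetricOn G s) {x : E} (hx : x ∈ s) (i j k l : ι) :
    curvature b G i j k l x + curvature b G j k i l x + curvature b G k i j l x = 0 := by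
  simp only [curvature, ← Finset.sum_add_distrib, ← mul_add]
  refine Finset.sum_eq_zero fun p _ => ?_
  convert mul_zero _
  simp only [curvatureUp, Finset.sum_sub_distrib]
  rw [hG.fderiv_christoffel_symm b hx p k j, hG.fderiv_christoffel_symm b hx p i k,
    hG.fderiv_christoffel_symm b hx p j i]
  simp only [hG.christoffel_symm b hx _ k j, hG.christoffel_symm b hx _ i k,
    hG.christoffel_symm b hx _ j i]
  ring

/-- The second derivatives of `g_{kl}` commute. Replacing each first derivative of `g` by `gΓ + gΓ`
twice turns this commutation into the antisymmetry. -/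
theorem IsMetricOn.curvature_antisymm_right (hG : IsMetricOn G s) {x : E} (hx : x ∈ s)
    (i j k l : ι) : curvature b G i j k l x = - curvature b G i j l k x := by
  have hev : ∀ a, (fun y => fderiv ℝ (fun w => G w k l) y (b a)) =ᶠ[nhds x] fun y =>
      ∑ r, (G y l r * christoffel b G r a k y + G y k r * christoffel b G r a l y) := fun a =>
    Filter.mem_of_superset (hG.isOpen.mem_nhds hx) fun y hy => hG.fderiv_eq b hy a k l
  have hΓ : ∀ c a d, DifferentiableAt ℝ (christoffel b G c a d) x := fun c a d =>
    (hG.contDiffAt_christoffel b hx c a d).differentiableAt (by simp)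
  have hd : ∀ a c, DifferentiableAt ℝ (fun y => G y a c) x := fun a c =>
    (hG.smooth a c x hx).differentiableAt (by simp)
  have h2 : ∀ a c, fderiv ℝ (fun y => fderiv ℝ (fun w => G w k l) y (b a)) x (b c) =
      ∑ r, (G x l r * fderiv ℝ (christoffel b G r a k) x (b c)
        + christoffel b G r a k x * fderiv ℝ (fun y => G y l r) x (b c)
        + (G x k r * fderiv ℝ (christoffel b G r a l) x (b c)
        + christoffel b G r a l x * fderiv ℝ (fun y => G y k r) x (b c))) := by
    intro a c
    rw [(hev a).fderiv_eq, fderiv_fun_sum fun r _ =>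
      ((hd l r).fun_mul (hΓ r a k)).fun_add ((hd k r).fun_mul (hΓ r a l)), sum_apply]
    refine Finset.sum_congr rfl fun r _ => ?_
    rw [fderiv_fun_add ((hd l r).fun_mul (hΓ r a k)) ((hd k r).fun_mul (hΓ r a l)),
      fderiv_fun_mul (hd l r) (hΓ r a k), fderiv_fun_mul (hd k r) (hΓ r a l)]
    simp
  have h3 := fderiv_fderiv_comm (hG.smooth k l x hx) (b i) (b j)
  rw [h2, h2] at h3
  simp only [hG.fderiv_eq b hx, Finset.mul_sum, Finset.sum_add_distrib, mul_add] at h3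
  simp only [curvature, curvatureUp, mul_add, mul_sub, Finset.sum_add_distrib,
    Finset.sum_sub_distrib, Finset.mul_sum]
  -- Terms `Γ g Γ` with `g` contracting both upper indices are symmetric and drop out of the
  -- commutator; those of `e2` form the quadratic part of the curvature.
  have e1 : ∀ a c u v : ι, ∑ r, ∑ p, christoffel b G r a u x * (G x r p * christoffel b G p c v x)
      = ∑ r, ∑ p, christoffel b G r c v x * (G x r p * christoffel b G p a u x) := by
    intro a c u v
    rw [Finset.sum_comm]
    refine Finset.sum_congr rfl fun r _ => Finset.sum_congr rfl fun p _ => ?_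
    rw [hG.symm x hx]
    ring
  have e2 : ∀ a c u v : ι, ∑ r, ∑ p, christoffel b G r a u x * (G x v p * christoffel b G p c r x)
      = ∑ r, ∑ p, G x v r * (christoffel b G r c p x * christoffel b G p a u x) := by
    intro a c u v
    rw [Finset.sum_comm]
    exact Finset.sum_congr rfl fun r _ => Finset.sum_congr rfl fun p _ => by ring
  simp only [e2] at h3
  have e3 := e1 i j k l
  have e4 := e1 i j l k
  linarith

/-- The pair symmetry of the curvature tensor. -/
theorem IsMetricOn.curvature_pair_symm (hG : IsMetricOn G s) {x : E} (hx : x ∈ s)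
    (i j k l : ι) : curvature b G i j k l x = curvature b G k l i j x := by
  have B := hG.curvature_bianchi b hx
  have A := fun i j k l => curvature_antisymm (G := G) b i j k l x
  have A' := hG.curvature_antisymm_right b hx
  -- The octahedron argument: the four Bianchi identities on the faces, combined with antisymmetry
  -- in each pair, leave only the pair symmetry.
  have b1 := B i j k l
  have b2 := B j k l i
  have b3 := B k l i j
  have b4 := B l i j k
  have a1 := A' j k i l
  have a2 := A' k i j l
  have a3 := A' i j k l
  have a4 := A' k l j i
  have a5 := A' l j k i
  have a6 := A' j k l i
  have a7 := A' l i k j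
  have a8 := A' i k l j
  have a9 := A' i j l k
  have a10 := A' j l i k
  have a11 := A' l i j k
  have c1 := A k i j l
  have c2 := A l j k i
  have c3 := A j l i k
  have c4 := A i k l j
  have c5 := A k i l j
  have c6 := A j l k i
  have c7 := A i k j l
  have c8 := A l j i k
  linarith

end Coordinates

/-! ### Metrics and maps in charts -/

section Charts

variable {E : Type*} [NormedAddCommGroup E] [NormedSpace ℝ E]
  {X : Type*} [TopologicalSpace X] [ChartedSpace E X] [IsManifold 𝓘(ℝ, E) ∞ X]
  (g : ContMDiffRiemannianMetric 𝓘(ℝ, E) ∞ E (fun x : X => TangentSpace 𝓘(ℝ, E) x))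
  {φ : OpenPartialHomeomorph X E}

/-- A coordinate vector field is the tangent map of `φ.symm` applied to a constant section; on the
open target the derivative within the set is the derivative. -/
theorem contMDiffAt_mfderiv_symm (hφ : φ ∈ IsManifold.maximalAtlas 𝓘(ℝ, E) ∞ X) {z : E}
    (hz : z ∈ φ.target) (v : E) :
    ContMDiffAt 𝓘(ℝ, E) (𝓘(ℝ, E).prod 𝓘(ℝ, E)) ∞
      (fun y => (⟨φ.symm y, mfderiv 𝓘(ℝ, E) 𝓘(ℝ, E) φ.symm y v⟩ :
        TotalSpace E (fun x : X => TangentSpace 𝓘(ℝ, E) x))) z := by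
  have h1 : ContMDiffOn 𝓘(ℝ, E) 𝓘(ℝ, E) ∞ φ.symm φ.target :=
    contMDiffOn_symm_of_mem_maximalAtlas hφ
  have h2 := h1.contMDiffOn_tangentMapWithin (m := ∞) (by simp) φ.open_target.uniqueMDiffOn
  have h3 : ContMDiffOn 𝓘(ℝ, E) (𝓘(ℝ, E).prod 𝓘(ℝ, E)) ∞
      (fun y => (⟨y, v⟩ : TangentBundle 𝓘(ℝ, E) E)) φ.target := by
    exact contMDiffOn_vectorSpace_iff_contDiffOn.mpr contDiffOn_const
  have h4 := (h2.comp h3 fun y hy => hy).contMDiffAt (φ.open_target.mem_nhds hz)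
  refine h4.congr_of_eventuallyEq (Filter.mem_of_superset (φ.open_target.mem_nhds hz) fun y hy => ?_)
  simp only [Set.mem_ofPred_eq, Function.comp, tangentMapWithin]
  rw [mfderivWithin_of_isOpen φ.open_target hy]

theorem contDiffAt_chartMetric (hφ : φ ∈ IsManifold.maximalAtlas 𝓘(ℝ, E) ∞ X) {z : E}
    (hz : z ∈ φ.target) (v w : E) : ContDiffAt ℝ ∞ (fun y => chartMetric g φ y v w) z := by
  rw [← contMDiffAt_iff_contDiffAt]
  have hb : ContMDiffAt 𝓘(ℝ, E) 𝓘(ℝ, E) ∞ φ.symm z :=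
    (contMDiffOn_symm_of_mem_maximalAtlas hφ).contMDiffAt (φ.open_target.mem_nhds hz)
  have : ContMDiffAt 𝓘(ℝ, E) (𝓘(ℝ, E).prod 𝓘(ℝ, ℝ)) ∞
      (fun y ↦ TotalSpace.mk' ℝ (E := Bundle.Trivial X ℝ) (φ.symm y) (chartMetric g φ y v w)) z := by
    unfold chartMetric
    rw [← contMDiffWithinAt_univ]
    apply ContMDiffWithinAt.clm_bundle_apply₂ (F₁ := E) (F₂ := E)
    · exact (g.contMDiff.contMDiffAt.comp z hb).contMDiffWithinAt
    · exact (contMDiffAt_mfderiv_symm hφ hz v).contMDiffWithinAt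
    · exact (contMDiffAt_mfderiv_symm hφ hz w).contMDiffWithinAt
  rw [Bundle.contMDiffAt_totalSpace] at this
  exact this.2

theorem chartMetric_symm (z v w : E) : chartMetric g φ z v w = chartMetric g φ z w v :=
  g.symm _ _ _

/-- The metric in a chart as a bilinear form. -/
def chartBilin (φ : OpenPartialHomeomorph X E) (z : E) : E →ₗ[ℝ] E →ₗ[ℝ] ℝ :=
  let D : E →ₗ[ℝ] TangentSpace 𝓘(ℝ, E) (φ.symm z) :=
    (mfderiv 𝓘(ℝ, E) 𝓘(ℝ, E) φ.symm z).toLinearMap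
  LinearMap.mk₂ ℝ (fun v w => g.inner (φ.symm z) (D v) (D w))
    (fun _ _ _ => by simp) (fun _ _ _ => by simp) (fun _ _ _ => by simp) (fun _ _ _ => by simp)

theorem chartBilin_apply (z v w : E) : chartBilin g φ z v w = chartMetric g φ z v w := rfl

theorem chartMetric_pos (hφ : φ ∈ IsManifold.maximalAtlas 𝓘(ℝ, E) ∞ X) {z : E}
    (hz : z ∈ φ.target) {v : E} (hv : v ≠ 0) : 0 < chartMetric g φ z v v := by
  refine g.pos _ _ fun h => hv ?_
  have hd : φ.MDifferentiable 𝓘(ℝ, E) 𝓘(ℝ, E) :=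
    ⟨(contMDiffOn_of_mem_maximalAtlas hφ).mdifferentiableOn (by simp),
      (contMDiffOn_symm_of_mem_maximalAtlas hφ).mdifferentiableOn (by simp)⟩
  have := hd.symm.mfderiv_injective (x := z) hz
  exact this (h.trans (map_zero _).symm)

variable {ι : Type*} [Fintype ι] [DecidableEq ι]

theorem isMetricOn_metricMatrix (hφ : φ ∈ IsManifold.maximalAtlas 𝓘(ℝ, E) ∞ X) {b : ι → E}
    (hb : LinearIndependent ℝ b) : IsMetricOn (metricMatrix g φ b) φ.target where
  isOpen := φ.open_target
  smooth a c x hx := contDiffAt_chartMetric g hφ hx (b a) (b c)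
  symm x _ a c := chartMetric_symm g x (b a) (b c)
  isUnit x hx := by
    rw [isUnit_iff_ne_zero]
    intro h0
    obtain ⟨v, hv, h⟩ := Matrix.exists_mulVec_eq_zero_iff.mpr h0
    -- A kernel vector of the Gram matrix is the coordinate vector of a nonzero tangent vector of
    -- length zero, contradicting positivity.
    have hne : ∑ a, v a • b a ≠ 0 := fun h1 => hv (funext fun a =>
      Fintype.linearIndependent_iff.mp hb v h1 a)
    have hpos := chartMetric_pos g hφ hx hne
    rw [← chartBilin_apply] at hpos
    simp only [map_sum, LinearMap.sum_apply, map_smul, LinearMap.smul_apply, chartBilin_apply,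
      smul_eq_mul] at hpos
    have h2 : ∀ a, ∑ c, v c * chartMetric g φ x (b c) (b a) = 0 := by
      intro a
      have := congrFun h a
      simp only [Matrix.mulVec, dotProduct, metricMatrix, Matrix.of_apply, Pi.zero_apply] at this
      rw [← this]
      exact Finset.sum_congr rfl fun c _ => by rw [chartMetric_symm, mul_comm]
    simp [h2] at hpos

end Charts

theorem linearIndependent_realFrame (n : ℕ) : LinearIndependent ℝ (realFrame n) := by
  rw [Fintype.linearIndependent_iff]
  intro c h
  have h2 : ∀ a, realCoord (∑ a, c a • realFrame n a) a = c a := by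
    intro a
    rcases a with α | α <;>
      simp [realCoord, realFrame, eX, eY, Fintype.sum_sum_type, Pi.single_apply]
  intro a
  rw [← h2 a, h]
  rcases a with α | α <;> simp [realCoord]

theorem linearIndependent_stdFrame (m : ℕ) : LinearIndependent ℝ (stdFrame m) := by
  rw [Fintype.linearIndependent_iff]
  intro c h i
  have := congrArg (fun v : RSpace m => v i) h
  simpa [stdFrame, Pi.single_apply] using this

/-- Complex analytic transition maps are real smooth. This lets harmonicity and smoothness, stated
in real charts, be used in holomorphic ones. -/
theorem mem_maximalAtlas_real_of_complex {n : ℕ} {M : Type*} [TopologicalSpace M]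
    [ChartedSpace (CSpace n) M] {φ : OpenPartialHomeomorph M (CSpace n)}
    (hφ : φ ∈ IsManifold.maximalAtlas 𝓘(ℂ, CSpace n) ω M) :
    φ ∈ IsManifold.maximalAtlas 𝓘(ℝ, CSpace n) ∞ M := by
  have key : ∀ e : OpenPartialHomeomorph (CSpace n) (CSpace n),
      e ∈ contDiffGroupoid ω 𝓘(ℂ, CSpace n) → e ∈ contDiffGroupoid ∞ 𝓘(ℝ, CSpace n) := by
    intro e he
    rw [contDiffGroupoid, mem_groupoid_of_pregroupoid] at he ⊢
    simp only [contDiffPregroupoid] at he ⊢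
    exact ⟨(he.1.restrict_scalars ℝ).of_le le_top, (he.2.restrict_scalars ℝ).of_le le_top⟩
  intro e he
  exact ⟨key _ (hφ e he).1, key _ (hφ e he).2⟩

section CoordMap

variable {n m : ℕ} {M : Type*} [TopologicalSpace M] {N : Type*} [TopologicalSpace N]
  {f : M → N} {φ : OpenPartialHomeomorph M (CSpace n)} {ψ : OpenPartialHomeomorph N (RSpace m)}

/-- The domain of the coordinate expression of `f`. -/
def coordDomain (f : M → N) (φ : OpenPartialHomeomorph M (CSpace n))
    (ψ : OpenPartialHomeomorph N (RSpace m)) : Set (CSpace n) :=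
  φ.target ∩ φ.symm ⁻¹' (f ⁻¹' ψ.source)

theorem isOpen_coordDomain (hf : Continuous f) : IsOpen (coordDomain f φ ψ) :=
  φ.symm.continuousOn.isOpen_inter_preimage φ.open_target (ψ.open_source.preimage hf)

theorem coordMap_mem_target {z : CSpace n} (hz : z ∈ coordDomain f φ ψ) :
    coordMap f φ ψ z ∈ ψ.target :=
  ψ.map_source hz.2

theorem contDiffAt_coordMap [ChartedSpace (CSpace n) M] [ChartedSpace (RSpace m) N]
    [IsManifold 𝓘(ℝ, CSpace n) ∞ M] [IsManifold 𝓘(ℝ, RSpace m) ∞ N]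
    (hf : ContMDiff 𝓘(ℝ, CSpace n) 𝓘(ℝ, RSpace m) ∞ f)
    (hφ : φ ∈ IsManifold.maximalAtlas 𝓘(ℝ, CSpace n) ∞ M)
    (hψ : ψ ∈ IsManifold.maximalAtlas 𝓘(ℝ, RSpace m) ∞ N) {z : CSpace n}
    (hz : z ∈ coordDomain f φ ψ) : ContDiffAt ℝ ∞ (coordMap f φ ψ) z := by
  rw [← contMDiffAt_iff_contDiffAt]
  have h1 : ContMDiffAt 𝓘(ℝ, CSpace n) 𝓘(ℝ, CSpace n) ∞ φ.symm z :=
    (contMDiffOn_symm_of_mem_maximalAtlas hφ).contMDiffAt (φ.open_target.mem_nhds hz.1)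
  have h2 : ContMDiffAt 𝓘(ℝ, RSpace m) 𝓘(ℝ, RSpace m) ∞ ψ (f (φ.symm z)) :=
    (contMDiffOn_of_mem_maximalAtlas hψ).contMDiffAt (ψ.open_source.mem_nhds hz.2)
  exact h2.comp z (hf.contMDiffAt.comp z h1)

end CoordMap

/-! ### Kähler metrics -/

theorem extEval_ι_mul_ι {n : ℕ} (θ θ' : CDual n) (v w : CSpace n) :
    extEval ![v, w] (ExteriorAlgebra.ι ℂ θ * ExteriorAlgebra.ι ℂ θ') =
      θ v * θ' w - θ w * θ' v := by
  have h : (ExteriorAlgebra.ι ℂ θ * ExteriorAlgebra.ι ℂ θ' : ExtAlg n) =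
      ExteriorAlgebra.ιMulti ℂ 2 ![θ, θ'] := by
    simp [ExteriorAlgebra.ιMulti_apply]
  rw [h, extEval_ιMulti, Matrix.det_fin_two]
  simp

section Kaehler

variable {n : ℕ} {M : Type*} [TopologicalSpace M] [ChartedSpace (CSpace n) M]
  [IsManifold 𝓘(ℝ, CSpace n) ∞ M]
  (g : ContMDiffRiemannianMetric 𝓘(ℝ, CSpace n) ∞ (CSpace n)
    (fun x : M => TangentSpace 𝓘(ℝ, CSpace n) x))
  {φ : OpenPartialHomeomorph M (CSpace n)}

theorem kahlerForm_eq (z : CSpace n) : kahlerForm g φ z = hermForm (hermMatrix g φ z) := rfl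

theorem cplxJ_eX (α : Fin n) : cplxJ n (eX α) = eY α := by
  ext β; by_cases h : β = α <;> simp [cplxJ, eX, eY, h]

theorem cplxJ_eY (α : Fin n) : cplxJ n (eY α) = -eX α := by
  ext β; by_cases h : β = α <;> simp [cplxJ, eX, eY, h]

theorem cplxJ_cplxJ (v : CSpace n) : cplxJ n (cplxJ n v) = -v := by
  ext β; simp [cplxJ, ← mul_assoc]

theorem cplxJ_apply (v : CSpace n) (α : Fin n) : cplxJ n v α = Complex.I * v α := rfl

theorem chartMetric_neg_left (z v w : CSpace n) :
    chartMetric g φ z (-v) w = -chartMetric g φ z v w := by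
  simp only [← chartBilin_apply, map_neg, LinearMap.neg_apply]

theorem contDiffAt_hermMatrix (hφ : φ ∈ IsManifold.maximalAtlas 𝓘(ℝ, CSpace n) ∞ M)
    {z : CSpace n} (hz : z ∈ φ.target) (α β : Fin n) :
    ContDiffAt ℝ ∞ (fun y => hermMatrix g φ y α β) z := by
  have h := fun v w => (Complex.ofRealCLM.contDiff (n := ∞)).contDiffAt.comp z
    (contDiffAt_chartMetric g hφ hz v w)
  exact (h _ _).add (contDiffAt_const.mul (h _ _))

theorem differentiableAt_kahlerForm (hφ : φ ∈ IsManifold.maximalAtlas 𝓘(ℝ, CSpace n) ∞ M)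
    {z : CSpace n} (hz : z ∈ φ.target) : DifferentiableAt ℝ (kahlerForm g φ) z := by
  unfold kahlerForm
  refine DifferentiableAt.fun_sum fun α _ => DifferentiableAt.fun_sum fun β _ => ?_
  exact (((contDiffAt_hermMatrix g hφ hz α β).differentiableAt (by simp)).const_mul _).smul_const _

variable {z : CSpace n}
  (hJ : ∀ v w, chartMetric g φ z (cplxJ n v) (cplxJ n w) = chartMetric g φ z v w)

include hJ

theorem chartMetric_eY_eY (α β : Fin n) :
    chartMetric g φ z (eY α) (eY β) = chartMetric g φ z (eX α) (eX β) := by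
  rw [← cplxJ_eX, ← cplxJ_eX, hJ]

theorem chartMetric_eY_eX (α β : Fin n) :
    chartMetric g φ z (eY α) (eX β) = -chartMetric g φ z (eX α) (eY β) := by
  rw [← hJ, cplxJ_eX, cplxJ_eY, chartMetric_neg_left]

theorem hermMatrix_conj (α β : Fin n) :
    (starRingEnd ℂ) (hermMatrix g φ z α β) = hermMatrix g φ z β α := by
  simp only [hermMatrix, Matrix.of_apply, map_add, map_mul, Complex.conj_ofReal, Complex.conj_I]
  rw [chartMetric_symm g z (eX β) (eX α), chartMetric_symm g z (eX β) (eY α),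
    chartMetric_eY_eX g hJ]
  push_cast
  ring

theorem chartMetric_eq_re (v w : CSpace n) : (chartMetric g φ z v w : ℝ) =
    (∑ α, ∑ β, hermMatrix g φ z α β * v α * (starRingEnd ℂ) (w β)).re := by
  have h : chartMetric g φ z v w = ∑ a, ∑ c, realCoord v a * (realCoord w c *
      chartMetric g φ z (realFrame n a) (realFrame n c)) := by
    conv_lhs => rw [← chartBilin_apply, ← sum_realCoord_smul v, ← sum_realCoord_smul w]
    simp only [map_sum, LinearMap.sum_apply, map_smul, LinearMap.smul_apply, chartBilin_apply,
      smul_eq_mul, Finset.mul_sum]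
    rw [Finset.sum_comm]
    exact Finset.sum_congr rfl fun a _ => Finset.sum_congr rfl fun c _ => by ring
  rw [h]
  simp only [Fintype.sum_sum_type, realCoord, realFrame, Sum.elim_inl, Sum.elim_inr,
    chartMetric_eY_eY g hJ, chartMetric_eY_eX g hJ, Complex.re_sum, ← Finset.sum_add_distrib]
  refine Finset.sum_congr rfl fun α _ => Finset.sum_congr rfl fun β _ => ?_
  simp [hermMatrix]
  ring

/-- Both sides are real parts of the Hermitian form, `g(Jv, w) = (Z + \bar Z)/2`. It turns
closedness of `ω` into an equation for first derivatives of the real metric. -/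
theorem kahlerForm_apply (v w : CSpace n) :
    kahlerForm g φ z ![v, w] = (chartMetric g φ z (cplxJ n v) w : ℂ) := by
  have h1 : kahlerForm g φ z ![v, w] = ∑ α, ∑ β, Complex.I / 2 * hermMatrix g φ z α β *
      (v α * (starRingEnd ℂ) (w β) - w α * (starRingEnd ℂ) (v β)) := by
    rw [← extEval_toExt, kahlerForm_eq, toExt_hermForm]
    simp only [map_sum, map_smul, extEval_ι_mul_ι, dzL_apply, dzbarL_apply, smul_eq_mul]
  have h2 := chartMetric_eq_re g hJ (cplxJ n v) w
  set Z := ∑ α, ∑ β, hermMatrix g φ z α β * cplxJ n v α * (starRingEnd ℂ) (w β) with hZ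
  have h3 : (starRingEnd ℂ) Z = ∑ α, ∑ β, hermMatrix g φ z α β *
      (-Complex.I * (starRingEnd ℂ) (v β)) * w α := by
    rw [hZ, Finset.sum_comm]
    simp only [map_sum, map_mul, hermMatrix_conj g hJ, cplxJ_apply, Complex.conj_I,
      Complex.conj_conj]
  rw [h2, h1, Complex.re_eq_add_conj, h3, hZ]
  simp only [← Finset.sum_add_distrib, Finset.sum_div, cplxJ_apply]
  refine Finset.sum_congr rfl fun α _ => Finset.sum_congr rfl fun β _ => ?_
  ring

theorem hermMatrix_inv_conj (α β : Fin n) :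
    (starRingEnd ℂ) ((hermMatrix g φ z)⁻¹ α β) = (hermMatrix g φ z)⁻¹ β α := by
  have h : (hermMatrix g φ z).IsHermitian := by
    ext α β
    rw [Matrix.conjTranspose_apply]
    exact hermMatrix_conj g hJ β α
  exact h.inv.apply β α

variable (hu : IsUnit (metricMatrix g φ (realFrame n) z).det)

include hu

theorem isUnit_det_hermMatrix : IsUnit (hermMatrix g φ z).det := by
  rw [isUnit_iff_ne_zero]
  intro h0
  obtain ⟨v, hv, h⟩ := Matrix.exists_mulVec_eq_zero_iff.mpr h0
  refine hu.ne_zero (Matrix.exists_mulVec_eq_zero_iff.mp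
    -- `h_{α\bar β}` is conjugate linear in its second argument, so a kernel vector `v` of the
    -- Hermitian matrix corresponds to the real coordinates of `\bar v`.
    ⟨Sum.elim (fun α => (v α).re) (fun α => -(v α).im), fun h1 => hv ?_, ?_⟩)
  · funext α
    have e1 := congrFun h1 (Sum.inl α)
    have e2 := congrFun h1 (Sum.inr α)
    simp only [Sum.elim_inl, Sum.elim_inr, Pi.zero_apply, neg_eq_zero] at e1 e2
    exact Complex.ext e1 e2
  · funext a
    rcases a with α | α
    · have := congrArg Complex.re (congrFun h α)
      simp only [Matrix.mulVec, dotProduct, Complex.re_sum, Pi.zero_apply, Complex.zero_re,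
        hermMatrix, Matrix.of_apply] at this
      simp only [Matrix.mulVec, dotProduct, metricMatrix, Matrix.of_apply, Fintype.sum_sum_type,
        realFrame, Sum.elim_inl, Sum.elim_inr, Pi.zero_apply, ← Finset.sum_add_distrib]
      rw [← this]
      refine Finset.sum_congr rfl fun β _ => ?_
      simp
      ring
    · have := congrArg Complex.im (congrFun h α)
      simp only [Matrix.mulVec, dotProduct, Complex.im_sum, Pi.zero_apply, Complex.zero_im,
        hermMatrix, Matrix.of_apply] at this
      simp only [Matrix.mulVec, dotProduct, metricMatrix, Matrix.of_apply, Fintype.sum_sum_type,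
        realFrame, Sum.elim_inl, Sum.elim_inr, Pi.zero_apply, ← Finset.sum_add_distrib,
        chartMetric_eY_eY g hJ, chartMetric_eY_eX g hJ]
      rw [← neg_eq_zero, ← this, ← Finset.sum_neg_distrib]
      refine Finset.sum_congr rfl fun β _ => ?_
      simp

/-- By `J`-invariance the real metric is the block matrix with rows `(A, B)` and `(-B, A)`, where `A
+ √-1 B` is the Hermitian matrix. Such blocks multiply like complex matrices, so inverses
correspond. -/
theorem metricMatrix_inv : (metricMatrix g φ (realFrame n) z)⁻¹ =
    Matrix.fromBlocks ((hermMatrix g φ z)⁻¹.map Complex.re) ((hermMatrix g φ z)⁻¹.map Complex.im)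
      (-(hermMatrix g φ z)⁻¹.map Complex.im) ((hermMatrix g φ z)⁻¹.map Complex.re) := by
  have h := Matrix.mul_nonsing_inv _ (isUnit_det_hermMatrix g hJ hu)
  set V := (hermMatrix g φ z)⁻¹
  have hre : ∀ α β, ∑ γ, (chartMetric g φ z (eX α) (eX γ) * (V γ β).re
      - chartMetric g φ z (eX α) (eY γ) * (V γ β).im) = if α = β then 1 else 0 := by
    intro α β
    have := congrArg Complex.re (congrFun (congrFun h α) β)
    rw [Matrix.mul_apply, Matrix.one_apply, Complex.re_sum] at this
    rw [show (if α = β then (1 : ℝ) else 0) = (if α = β then (1 : ℂ) else 0).re by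
      split_ifs <;> simp, ← this]
    exact Finset.sum_congr rfl fun γ _ => by simp [hermMatrix]
  have him : ∀ α β, ∑ γ, (chartMetric g φ z (eX α) (eX γ) * (V γ β).im
      + chartMetric g φ z (eX α) (eY γ) * (V γ β).re) = 0 := by
    intro α β
    have := congrArg Complex.im (congrFun (congrFun h α) β)
    rw [Matrix.mul_apply, Matrix.one_apply, Complex.im_sum] at this
    rw [show (0 : ℝ) = (if α = β then (1 : ℂ) else 0).im by split_ifs <;> simp, ← this]
    exact Finset.sum_congr rfl fun γ _ => by simp [hermMatrix]
  refine Matrix.inv_eq_right_inv ?_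
  ext a c
  rw [Matrix.mul_apply, Fintype.sum_sum_type, ← Finset.sum_add_distrib, Matrix.one_apply]
  rcases a with α | α <;> rcases c with β | β <;>
    simp only [metricMatrix, Matrix.of_apply, realFrame, Sum.elim_inl, Sum.elim_inr,
      Matrix.fromBlocks_apply₁₁, Matrix.fromBlocks_apply₁₂, Matrix.fromBlocks_apply₂₁,
      Matrix.fromBlocks_apply₂₂, Matrix.map_apply, Matrix.neg_apply, chartMetric_eY_eY g hJ,
      chartMetric_eY_eX g hJ, Sum.inl.injEq, Sum.inr.injEq, reduceCtorEq, if_false]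
  · rw [← hre]; exact Finset.sum_congr rfl fun γ _ => by ring
  · rw [← him]
  · rw [← neg_zero, ← him α β, ← Finset.sum_neg_distrib]
    exact Finset.sum_congr rfl fun γ _ => by ring
  · rw [← hre]; exact Finset.sum_congr rfl fun γ _ => by ring

/-- The trace of a symmetric real tensor is four times the Hermitian trace of its
`(1,1)`-part. -/
theorem sum_hermInv_mul {T : Fin n ⊕ Fin n → Fin n ⊕ Fin n → ℝ} (hT : ∀ a c, T a c = T c a)
    (h : ∑ a, ∑ c, (metricMatrix g φ (realFrame n) z)⁻¹ a c * T a c = 0) :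
    ∑ α, ∑ β, hermInv (hermMatrix g φ z) α β * ((1 / 4 : ℂ) *
      ((T (.inl α) (.inl β) : ℂ) + T (.inr α) (.inr β)
        + Complex.I * ((T (.inl α) (.inr β) : ℂ) - T (.inr α) (.inl β)))) = 0 := by
  have hc := hermMatrix_inv_conj g hJ
  rw [metricMatrix_inv g hJ hu] at h
  set V := (hermMatrix g φ z)⁻¹ with hV
  have hre : ∀ α β, (V α β).re = (V β α).re := fun α β => by rw [← hc β α, Complex.conj_re]
  have him : ∀ α β, (V α β).im = -(V β α).im := fun α β => by rw [← hc β α, Complex.conj_im]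
  simp only [Fintype.sum_sum_type, Matrix.fromBlocks_apply₁₁, Matrix.fromBlocks_apply₁₂,
    Matrix.fromBlocks_apply₂₁, Matrix.fromBlocks_apply₂₂, Matrix.map_apply, Matrix.neg_apply,
    ← Finset.sum_add_distrib] at h
  simp only [hermInv, ← hV]
  apply Complex.ext
  · rw [Complex.re_sum, Complex.zero_re, ← mul_zero (1 / 4 : ℝ), ← h, Finset.mul_sum]
    refine Finset.sum_congr rfl fun α _ => ?_
    rw [Complex.re_sum, Finset.mul_sum]
    refine Finset.sum_congr rfl fun β _ => ?_
    simp
    rw [hre α β, him α β]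
    ring
  · rw [Complex.im_sum, Complex.zero_im]
    -- The inverse is Hermitian and `T` symmetric, so exchanging `α` and `β` conjugates the summand;
    -- the imaginary part of the sum is its own negative.
    have e : ∀ α β, (V β α * ((1 / 4 : ℂ) * ((T (.inl α) (.inl β) : ℂ) + T (.inr α) (.inr β)
        + Complex.I * ((T (.inl α) (.inr β) : ℂ) - T (.inr α) (.inl β))))).im =
        -(V α β * ((1 / 4 : ℂ) * ((T (.inl β) (.inl α) : ℂ) + T (.inr β) (.inr α)
        + Complex.I * ((T (.inl β) (.inr α) : ℂ) - T (.inr β) (.inl α))))).im := by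
      intro α β
      simp
      rw [hre α β, him α β, hT (.inl β) (.inl α), hT (.inr β) (.inr α), hT (.inl β) (.inr α),
        hT (.inr β) (.inl α)]
      ring
    simp only [Complex.im_sum]
    have e2 := Finset.sum_congr (s₁ := (Finset.univ : Finset (Fin n))) rfl
      fun α _ => Finset.sum_congr (s₁ := (Finset.univ : Finset (Fin n))) rfl fun β _ => e α β
    simp only [Finset.sum_neg_distrib] at e2
    rw [Finset.sum_comm (f := fun α β => (V α β * _).im)] at e2
    linarith

end Kaehler

/-! ### First-order consequences of the closedness of the Kähler form -/

section KaehlerClosed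

variable {n : ℕ} {M : Type*} [TopologicalSpace M] [ChartedSpace (CSpace n) M]
  [IsManifold 𝓘(ℂ, CSpace n) ω M] [IsManifold 𝓘(ℝ, CSpace n) ∞ M]
  {g : ContMDiffRiemannianMetric 𝓘(ℝ, CSpace n) ∞ (CSpace n)
    (fun x : M => TangentSpace 𝓘(ℝ, CSpace n) x)}
  {φ : OpenPartialHomeomorph M (CSpace n)}

/-- The first-order form of the Kähler condition. -/
theorem IsKahler.fderiv_chartMetric (hg : IsKahler g)
    (hφ : φ ∈ IsManifold.maximalAtlas 𝓘(ℂ, CSpace n) ω M) {z : CSpace n} (hz : z ∈ φ.target)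
    (u v w : CSpace n) :
    fderiv ℝ (fun y => chartMetric g φ y u v) z w =
      fderiv ℝ (fun y => chartMetric g φ y v w) z u
        + fderiv ℝ (fun y => chartMetric g φ y (cplxJ n u) w) z (cplxJ n v) := by
  have hφ' := mem_maximalAtlas_real_of_complex hφ
  -- With `ω(a, c) = g(Ja, c)`, the triple `(u, Jv, w)` makes the three terms of `dω` equal to `-∂_u
  -- g(v, w)`, `-∂_{Jv} g(Ju, w)` and `∂_w g(u, v)`.
  have h0 := congrArg (fun η => η ![u, cplxJ n v, w]) (hg.closed φ hφ z hz)
  simp only [extDeriv_apply (differentiableAt_kahlerForm g hφ' hz)] at h0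
  have hk : ∀ a c : CSpace n, fderiv ℝ (fun y => kahlerForm g φ y ![a, c]) z =
      Complex.ofRealCLM.comp (fderiv ℝ (fun y => chartMetric g φ y (cplxJ n a) c) z) := by
    intro a c
    have e : (fun y => kahlerForm g φ y ![a, c]) =ᶠ[nhds z]
        (Complex.ofRealCLM ∘ fun y => chartMetric g φ y (cplxJ n a) c) :=
      Filter.mem_of_superset (φ.open_target.mem_nhds hz) fun y hy =>
        kahlerForm_apply g (hg.hermitian φ hφ y hy) a c
    rw [e.fderiv_eq]
    exact Complex.ofRealCLM.hasFDerivAt.comp z ((contDiffAt_chartMetric g hφ' hz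
      (cplxJ n a) c).differentiableAt (by simp)).hasFDerivAt |>.fderiv
  have r0 : Fin.removeNth 0 ![u, cplxJ n v, w] = ![cplxJ n v, w] := by
    ext i : 1; fin_cases i <;> rfl
  have r1 : Fin.removeNth 1 ![u, cplxJ n v, w] = ![u, w] := by
    ext i : 1; fin_cases i <;> rfl
  have r2 : Fin.removeNth 2 ![u, cplxJ n v, w] = ![u, cplxJ n v] := by
    ext i : 1; fin_cases i <;> rfl
  rw [Fin.sum_univ_three, r0, r1, r2, hk, hk, hk] at h0
  have h1 : (fun y => chartMetric g φ y (cplxJ n u) (cplxJ n v)) =ᶠ[nhds z]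
      fun y => chartMetric g φ y u v :=
    Filter.mem_of_superset (φ.open_target.mem_nhds hz) fun y hy => hg.hermitian φ hφ y hy u v
  have h2 : (fun y => chartMetric g φ y (cplxJ n (cplxJ n v)) w) =
      fun y => -chartMetric g φ y v w := by
    funext y
    rw [cplxJ_cplxJ, chartMetric_neg_left]
  rw [h1.fderiv_eq, h2, fderiv_fun_neg] at h0
  simp at h0
  have h3 := congrArg Complex.re h0
  simp at h3
  linarith

/-- Equivalently, real and imaginary parts of holomorphic coordinates are harmonic functions. This
removes the connection of the domain from the tension field. -/
theorem IsKahler.sum_inv_mul_christoffel (hg : IsKahler g)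
    (hφ : φ ∈ IsManifold.maximalAtlas 𝓘(ℂ, CSpace n) ω M) {z : CSpace n} (hz : z ∈ φ.target)
    (e : Fin n ⊕ Fin n) :
    ∑ a, ∑ c, (metricMatrix g φ (realFrame n) z)⁻¹ a c *
      christoffel (realFrame n) (metricMatrix g φ (realFrame n)) e a c z = 0 := by
  have hφ' := mem_maximalAtlas_real_of_complex hφ
  have hJ := hg.hermitian φ hφ z hz
  have hG := isMetricOn_metricMatrix g hφ' (linearIndependent_realFrame n)
  have hu := hG.isUnit z hz
  have hc := hermMatrix_inv_conj g hJ
  have hinv := metricMatrix_inv g hJ hu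
  set R := (metricMatrix g φ (realFrame n) z)⁻¹ with hR
  have hRs : ∀ a c, R a c = R c a := by
    have : (metricMatrix g φ (realFrame n) z).IsSymm := by
      ext a c; exact hG.symm z hz c a
    intro a c
    exact (this.inv).apply c a
  -- The two terms of `IsKahler.fderiv_chartMetric` have the same trace, since the inverse metric is
  -- `J`-invariant.
  have key : ∀ w, ∑ a, ∑ c, R a c *
      fderiv ℝ (fun y => chartMetric g φ y (realFrame n a) (realFrame n c)) z w =
      2 * ∑ a, ∑ c, R a c *
      fderiv ℝ (fun y => chartMetric g φ y (realFrame n c) w) z (realFrame n a) := by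
    intro w
    simp only [hg.fderiv_chartMetric hφ hz _ _ w, mul_add, Finset.sum_add_distrib]
    rw [two_mul]
    congr 1
    have neg1 : ∀ v, fderiv ℝ (fun y => chartMetric g φ y (-v) w) z =
        -fderiv ℝ (fun y => chartMetric g φ y v w) z := by
      intro v
      simp only [chartMetric_neg_left]
      exact fderiv_fun_neg
    rw [hinv]
    simp only [Fintype.sum_sum_type, Matrix.fromBlocks_apply₁₁, Matrix.fromBlocks_apply₁₂,
      Matrix.fromBlocks_apply₂₁, Matrix.fromBlocks_apply₂₂, Matrix.map_apply, Matrix.neg_apply,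
      realFrame, Sum.elim_inl, Sum.elim_inr, cplxJ_eX, cplxJ_eY, neg1, map_neg, neg_apply,
      ← Finset.sum_add_distrib]
    rw [Finset.sum_comm]
    refine Finset.sum_congr rfl fun α _ => Finset.sum_congr rfl fun β _ => ?_
    rw [← hc α β, Complex.conj_re, Complex.conj_im]
    ring
  have hsymm : ∀ a c v, fderiv ℝ (fun y => chartMetric g φ y a c) z v =
      fderiv ℝ (fun y => chartMetric g φ y c a) z v := by
    intro a c v
    simp only [chartMetric_symm g _ a c]
  have h2 : ∀ w, ∑ a, ∑ c, R a c * (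
      fderiv ℝ (fun y => chartMetric g φ y w (realFrame n c)) z (realFrame n a)
      + fderiv ℝ (fun y => chartMetric g φ y w (realFrame n a)) z (realFrame n c)
      - fderiv ℝ (fun y => chartMetric g φ y (realFrame n a) (realFrame n c)) z w)
      = 0 := by
    intro w
    have e : ∑ a, ∑ c, R a c *
        fderiv ℝ (fun y => chartMetric g φ y w (realFrame n a)) z (realFrame n c) =
        ∑ a, ∑ c, R a c *
        fderiv ℝ (fun y => chartMetric g φ y w (realFrame n c)) z (realFrame n a) := by
      rw [Finset.sum_comm]
      exact Finset.sum_congr rfl fun a _ => Finset.sum_congr rfl fun c _ => by rw [hRs]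
    simp only [mul_sub, mul_add, Finset.sum_sub_distrib, Finset.sum_add_distrib, key, e]
    simp only [hsymm w]
    ring
  have h3 : ∀ a c, R a c * christoffel (realFrame n) (metricMatrix g φ (realFrame n)) e a c z =
      ∑ f, (1 / 2 * R e f) * (R a c * (
      fderiv ℝ (fun y => chartMetric g φ y (realFrame n f) (realFrame n c)) z (realFrame n a)
      + fderiv ℝ (fun y => chartMetric g φ y (realFrame n f) (realFrame n a)) z (realFrame n c)
      - fderiv ℝ (fun y => chartMetric g φ y (realFrame n a) (realFrame n c)) z
        (realFrame n f))) := by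
    intro a c
    simp only [christoffel, metricMatrix, Matrix.of_apply, Finset.mul_sum]
    refine Finset.sum_congr rfl fun f _ => ?_
    rw [hR, metricMatrix]
    ring
  simp only [h3]
  rw [Finset.sum_congr rfl fun a _ => Finset.sum_comm, Finset.sum_comm]
  refine Finset.sum_eq_zero fun f _ => ?_
  simp only [← Finset.mul_sum, h2, mul_zero]

end KaehlerClosed

/-! ### Forms attached to a map -/

theorem toExt_wedge_oneForm {n : ℕ} (θ θ' : CDual n) :
    toExt (wedge (oneForm θ) (oneForm θ')) =
      ExteriorAlgebra.ι ℂ θ * ExteriorAlgebra.ι ℂ θ' := by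
  rw [toExt_wedge, toExt_oneForm, toExt_oneForm]

theorem oneForm_sum {n : ℕ} {ι' : Type*} (s : Finset ι') (θ : ι' → CDual n) :
    oneForm (∑ i ∈ s, θ i) = ∑ i ∈ s, oneForm (θ i) :=
  toExt_injective (by simp only [toExt_oneForm, map_sum])

theorem conjForm_sub {n k : ℕ} (η ζ : CForm n k) : conjForm (η - ζ) = conjForm η - conjForm ζ := by
  ext v; simp [conjForm]

theorem conjForm_oneForm {n : ℕ} (θ : CDual n) :
    conjForm (oneForm θ) = oneForm ((Complex.conjCLE : ℂ →L[ℝ] ℂ).comp θ) := rfl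

theorem ι_mul_ι_swap {n : ℕ} (θ θ' : CDual n) :
    (ExteriorAlgebra.ι ℂ θ * ExteriorAlgebra.ι ℂ θ' : ExtAlg n) =
      -(ExteriorAlgebra.ι ℂ θ' * ExteriorAlgebra.ι ℂ θ) :=
  eq_neg_of_add_eq_zero_left (ExteriorAlgebra.ι_add_mul_swap θ θ')

theorem eq_zero_of_eq_neg {n : ℕ} {x : ExtAlg n} (h : x = -x) : x = 0 := by
  have h2 : (2 : ℂ) • x = 0 := by rw [two_smul]; nth_rewrite 2 [h]; exact add_neg_cancel x
  exact (smul_eq_zero.mp h2).resolve_left two_ne_zero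

section MapForms

variable {n m : ℕ} (F : CSpace n → RSpace m)

/-- The functional underlying `d'F^i`. -/
def delMap (i : Fin m) (z : CSpace n) : CDual n := ∑ α, dFz F i α z • dzL α

/-- The functional underlying `d''F^i`. -/
def delbarMap (i : Fin m) (z : CSpace n) : CDual n := ∑ α, dFzbar F i α z • dzbarL α

theorem dComp_eq (i : Fin m) (z : CSpace n) : dComp F i z = delMap F i z + delbarMap F i z := by
  conv_lhs => rw [dual_eq_sum_dz (dComp F i z), Finset.sum_add_distrib]
  rfl

theorem dComp_comp_cplxJ (i : Fin m) (z : CSpace n) : (dComp F i z).comp (cplxJ n) =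
    Complex.I • delMap F i z - Complex.I • delbarMap F i z := by
  have h1 : (delMap F i z).comp (cplxJ n) = Complex.I • delMap F i z := by
    ext v
    simp only [delMap, ContinuousLinearMap.comp_apply, sum_apply, smul_apply, smul_eq_mul,
      dzL_apply, cplxJ_apply, Finset.mul_sum]
    exact Finset.sum_congr rfl fun _ _ => by ring
  have h2 : (delbarMap F i z).comp (cplxJ n) = -(Complex.I • delbarMap F i z) := by
    ext v
    simp only [delbarMap, ContinuousLinearMap.comp_apply, sum_apply, smul_apply, smul_eq_mul,
      dzbarL_apply, cplxJ_apply, Finset.mul_sum, neg_apply, map_mul, Complex.conj_I,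
      ← Finset.sum_neg_distrib]
    exact Finset.sum_congr rfl fun _ _ => by ring
  rw [dComp_eq, ContinuousLinearMap.add_comp, h1, h2, sub_eq_add_neg]

theorem dPrimeMap_eq (i : Fin m) (z : CSpace n) : dPrimeMap F i z = oneForm (delMap F i z) := by
  unfold dPrimeMap
  rw [dComp_comp_cplxJ, dComp_eq]
  congr 1
  simp only [smul_sub, smul_smul, Complex.I_mul_I]
  module

theorem dDoublePrimeMap_eq (i : Fin m) (z : CSpace n) :
    dDoublePrimeMap F i z = oneForm (delbarMap F i z) := by
  unfold dDoublePrimeMap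
  rw [dComp_comp_cplxJ, dComp_eq]
  congr 1
  simp only [smul_sub, smul_smul, Complex.I_mul_I]
  module

theorem conj_dFz (i : Fin m) (α : Fin n) (z : CSpace n) :
    (starRingEnd ℂ) (dFz F i α z) = dFzbar F i α z := by
  simp [dFz, dFzbar, dComp, map_ofNat (starRingEnd ℂ) 2]

theorem conj_dFzbar (i : Fin m) (α : Fin n) (z : CSpace n) :
    (starRingEnd ℂ) (dFzbar F i α z) = dFz F i α z := by
  rw [← conj_dFz, Complex.conj_conj]

theorem conj_delMap (i : Fin m) (z : CSpace n) :
    (Complex.conjCLE : ℂ →L[ℝ] ℂ).comp (delMap F i z) = delbarMap F i z := by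
  ext v
  simp [delMap, delbarMap, dzL_apply, dzbarL_apply, conj_dFz]

theorem conj_delbarMap (i : Fin m) (z : CSpace n) :
    (Complex.conjCLE : ℂ →L[ℝ] ℂ).comp (delbarMap F i z) = delMap F i z := by
  ext v
  simp [delMap, delbarMap, dzL_apply, dzbarL_apply, conj_dFzbar]

/-- The components of `f` are real, so conjugation exchanges `d'f` and `d''f`. -/
theorem conjForm_dDoublePrimeMap_sub (i : Fin m) (z : CSpace n) :
    conjForm ((dDoublePrimeMap F - dPrimeMap F) i z) = dPrimeMap F i z - dDoublePrimeMap F i z := by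
  rw [Pi.sub_apply, Pi.sub_apply, conjForm_sub, dPrimeMap_eq, dDoublePrimeMap_eq,
    conjForm_oneForm, conjForm_oneForm, conj_delMap, conj_delbarMap]

variable {F} {z : CSpace n}

section Smooth

variable (hF : ContDiffAt ℝ ∞ F z)

include hF

theorem contDiffAt_coord (i : Fin m) : ContDiffAt ℝ ∞ (fun w => F w i) z :=
  ((EuclideanSpace.proj i : RSpace m →L[ℝ] ℝ).contDiff (n := ∞)).contDiffAt.comp z hF

theorem contDiffAt_dComp_apply (i : Fin m) (v : CSpace n) :
    ContDiffAt ℝ ∞ (fun w => dComp F i w v) z :=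
  (Complex.ofRealCLM.contDiff (n := ∞)).contDiffAt.comp z
    (contDiffAt_fderiv_apply (contDiffAt_coord hF i) v)

theorem contDiffAt_dFz (i : Fin m) (α : Fin n) : ContDiffAt ℝ ∞ (dFz F i α) z :=
  contDiffAt_const.mul ((contDiffAt_dComp_apply hF i _).sub
    (contDiffAt_const.mul (contDiffAt_dComp_apply hF i _)))

theorem contDiffAt_dFzbar (i : Fin m) (α : Fin n) : ContDiffAt ℝ ∞ (dFzbar F i α) z :=
  contDiffAt_const.mul ((contDiffAt_dComp_apply hF i _).add
    (contDiffAt_const.mul (contDiffAt_dComp_apply hF i _)))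

theorem fderiv_dComp_apply (i : Fin m) (v w : CSpace n) :
    fderiv ℝ (fun y => dComp F i y v) z w =
      (fderiv ℝ (fun y => fderiv ℝ (fun x => F x i) y v) z w : ℂ) := by
  have h := Complex.ofRealCLM.hasFDerivAt.comp z ((contDiffAt_fderiv_apply
    (contDiffAt_coord hF i) v).differentiableAt (by simp)).hasFDerivAt
  exact congrArg (fun L => L w) h.fderiv

theorem fderiv_dComp_comm (i : Fin m) (v w : CSpace n) :
    fderiv ℝ (fun y => dComp F i y v) z w = fderiv ℝ (fun y => dComp F i y w) z v := by
  rw [fderiv_dComp_apply hF, fderiv_dComp_apply hF, fderiv_fderiv_comm (contDiffAt_coord hF i)]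

theorem fderiv_dFz_apply (i : Fin m) (α : Fin n) (v : CSpace n) :
    fderiv ℝ (dFz F i α) z v = (1 / 2 : ℂ) * (fderiv ℝ (fun y => dComp F i y (eX α)) z v
      - Complex.I * fderiv ℝ (fun y => dComp F i y (eY α)) z v) := by
  have h := fun u => ((contDiffAt_dComp_apply hF i u).differentiableAt (by simp)).hasFDerivAt
  have := ((h (eX α)).sub ((h (eY α)).const_mul Complex.I)).const_mul (1 / 2 : ℂ)
  exact congrArg (fun L => L v) this.fderiv

theorem fderiv_dFzbar_apply (i : Fin m) (α : Fin n) (v : CSpace n) :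
    fderiv ℝ (dFzbar F i α) z v = (1 / 2 : ℂ) * (fderiv ℝ (fun y => dComp F i y (eX α)) z v
      + Complex.I * fderiv ℝ (fun y => dComp F i y (eY α)) z v) := by
  have h := fun u => ((contDiffAt_dComp_apply hF i u).differentiableAt (by simp)).hasFDerivAt
  have := ((h (eX α)).add ((h (eY α)).const_mul Complex.I)).const_mul (1 / 2 : ℂ)
  exact congrArg (fun L => L v) this.fderiv

theorem delZ_fderiv_dFz_comm (i : Fin m) (α β : Fin n) :
    delZ α (fderiv ℝ (dFz F i β) z) = delZ β (fderiv ℝ (dFz F i α) z) := by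
  simp only [delZ_apply, fderiv_dFz_apply hF, fderiv_dComp_comm hF i (eX β),
    fderiv_dComp_comm hF i (eY β)]
  ring

theorem delZbar_fderiv_dFzbar_comm (i : Fin m) (α β : Fin n) :
    delZbar α (fderiv ℝ (dFzbar F i β) z) = delZbar β (fderiv ℝ (dFzbar F i α) z) := by
  simp only [delZbar_apply, fderiv_dFzbar_apply hF, fderiv_dComp_comm hF i (eX β),
    fderiv_dComp_comm hF i (eY β)]
  ring

theorem delZbar_fderiv_dFz (i : Fin m) (α β : Fin n) :
    delZbar α (fderiv ℝ (dFz F i β) z) = delZ β (fderiv ℝ (dFzbar F i α) z) := by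
  simp only [delZ_apply, delZbar_apply, fderiv_dFz_apply hF, fderiv_dFzbar_apply hF,
    fderiv_dComp_comm hF i (eX β), fderiv_dComp_comm hF i (eY β)]
  ring

theorem fderiv_dPrimeMap (i : Fin m) (v : CSpace n) :
    fderiv ℝ (dPrimeMap F i) z v = ∑ β, fderiv ℝ (dFz F i β) z v • dz β := by
  have e : dPrimeMap F i = fun w => ∑ β, dFz F i β w • dz β := by
    funext w
    rw [dPrimeMap_eq, delMap, oneForm_sum]
    rfl
  have h : HasFDerivAt (fun w => ∑ β, dFz F i β w • (dz β : CForm n 1)) _ z :=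
    HasFDerivAt.fun_sum fun β _ =>
      ((contDiffAt_dFz hF i β).differentiableAt (by simp)).hasFDerivAt.smul_const (dz β)
  rw [e, h.fderiv, sum_apply]
  rfl

theorem fderiv_dDoublePrimeMap (i : Fin m) (v : CSpace n) :
    fderiv ℝ (dDoublePrimeMap F i) z v = ∑ β, fderiv ℝ (dFzbar F i β) z v • dzbar β := by
  have e : dDoublePrimeMap F i = fun w => ∑ β, dFzbar F i β w • dzbar β := by
    funext w
    rw [dDoublePrimeMap_eq, delbarMap, oneForm_sum]
    rfl
  have h : HasFDerivAt (fun w => ∑ β, dFzbar F i β w • (dzbar β : CForm n 1)) _ z :=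
    HasFDerivAt.fun_sum fun β _ =>
      ((contDiffAt_dFzbar hF i β).differentiableAt (by simp)).hasFDerivAt.smul_const (dzbar β)
  rw [e, h.fderiv, sum_apply]
  rfl

theorem contDiffAt_dPrimeMap (i : Fin m) : ContDiffAt ℝ ∞ (dPrimeMap F i) z := by
  have e : dPrimeMap F i = fun w => ∑ β, dFz F i β w • dz β := by
    funext w
    rw [dPrimeMap_eq, delMap, oneForm_sum]
    rfl
  rw [e]
  exact ContDiffAt.sum fun β _ => (contDiffAt_dFz hF i β).smul contDiffAt_const

theorem contDiffAt_dDoublePrimeMap (i : Fin m) : ContDiffAt ℝ ∞ (dDoublePrimeMap F i) z := by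
  have e : dDoublePrimeMap F i = fun w => ∑ β, dFzbar F i β w • dzbar β := by
    funext w
    rw [dDoublePrimeMap_eq, delbarMap, oneForm_sum]
    rfl
  rw [e]
  exact ContDiffAt.sum fun β _ => (contDiffAt_dFzbar hF i β).smul contDiffAt_const

/-- `d'd''F^i` in the exterior algebra. -/
theorem toExt_dPrime_dDoublePrimeMap (i : Fin m) :
    toExt (dPrime (dDoublePrimeMap F i) z) = ∑ α, ∑ β, delZ α (fderiv ℝ (dFzbar F i β) z) •
      (ExteriorAlgebra.ι ℂ (dzL α) * ExteriorAlgebra.ι ℂ (dzbarL β)) := by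
  rw [dPrime, map_sum]
  refine Finset.sum_congr rfl fun α _ => ?_
  rw [toExt_wedge, dz_eq, toExt_oneForm, fderiv_dDoublePrimeMap hF, fderiv_dDoublePrimeMap hF]
  simp only [map_smul, map_sub, map_sum, dzbar_eq, toExt_oneForm, Finset.smul_sum,
    ← Finset.sum_sub_distrib, Finset.mul_sum, delZ_apply]
  refine Finset.sum_congr rfl fun β _ => ?_
  rw [smul_smul, ← sub_smul, smul_smul, mul_smul_comm]

theorem toExt_dDoublePrime_dPrimeMap (i : Fin m) :
    toExt (dDoublePrime (dPrimeMap F i) z) = -∑ α, ∑ β, delZ α (fderiv ℝ (dFzbar F i β) z) •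
      (ExteriorAlgebra.ι ℂ (dzL α) * ExteriorAlgebra.ι ℂ (dzbarL β)) := by
  rw [dDoublePrime, map_sum, Finset.sum_comm, ← Finset.sum_neg_distrib]
  refine Finset.sum_congr rfl fun α _ => ?_
  rw [toExt_wedge, dzbar_eq, toExt_oneForm, fderiv_dPrimeMap hF, fderiv_dPrimeMap hF]
  simp only [map_smul, map_add, map_sum, dz_eq, toExt_oneForm, Finset.smul_sum,
    ← Finset.sum_add_distrib, Finset.mul_sum, ← delZbar_fderiv_dFz hF, ← Finset.sum_neg_distrib]
  refine Finset.sum_congr rfl fun β _ => ?_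
  rw [smul_smul, ← add_smul, smul_smul, mul_smul_comm, ι_mul_ι_swap, smul_neg]
  rfl

/-- The `(0,2)`-part of `d(d''F)` pairs the symmetric second derivatives with an antisymmetric
product, hence vanishes. The `(2,0)`-part of `d(d'F)` vanishes for the same reason. -/
theorem toExt_extDeriv_dDoublePrimeMap (i : Fin m) :
    toExt (extDeriv (dDoublePrimeMap F i) z) = toExt (dPrime (dDoublePrimeMap F i) z) := by
  have e : dDoublePrimeMap F i = fun w => ∑ β, dFzbar F i β w • dzbar β := by
    funext w
    rw [dDoublePrimeMap_eq, delbarMap, oneForm_sum]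
    rfl
  have hd := fun β => (contDiffAt_dFzbar hF i β).differentiableAt (by simp)
  rw [toExt_dPrime_dDoublePrimeMap hF, e, toExt_extDeriv_sum _ fun β _ => (hd β).smul_const _]
  simp only [toExt_extDeriv_smul_const (hd _), dzbar_eq, toExt_oneForm]
  have h0 : ∑ β, ∑ α, delZbar α (fderiv ℝ (dFzbar F i β) z) •
      (ExteriorAlgebra.ι ℂ (dzbarL α) * ExteriorAlgebra.ι ℂ (dzbarL β)) = (0 : ExtAlg n) := by
    refine eq_zero_of_eq_neg ?_
    conv_lhs => rw [Finset.sum_comm]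
    simp only [← Finset.sum_neg_distrib, ← smul_neg]
    refine Finset.sum_congr rfl fun β _ => Finset.sum_congr rfl fun α _ => ?_
    rw [delZbar_fderiv_dFzbar_comm hF, ι_mul_ι_swap]
  rw [Finset.sum_comm, ← add_zero (∑ β, ∑ α, _), ← h0, ← Finset.sum_add_distrib]
  refine Finset.sum_congr rfl fun β _ => ?_
  conv_lhs => rw [dual_eq_sum_dz (fderiv ℝ (dFzbar F i β) z)]
  simp only [map_sum, map_add, map_smul, Finset.sum_mul, add_mul, smul_mul_assoc,
    Finset.sum_add_distrib]

theorem toExt_extDeriv_dPrimeMap (i : Fin m) :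
    toExt (extDeriv (dPrimeMap F i) z) = toExt (dDoublePrime (dPrimeMap F i) z) := by
  have e : dPrimeMap F i = fun w => ∑ β, dFz F i β w • dz β := by
    funext w
    rw [dPrimeMap_eq, delMap, oneForm_sum]
    rfl
  have hd := fun β => (contDiffAt_dFz hF i β).differentiableAt (by simp)
  rw [toExt_dDoublePrime_dPrimeMap hF, e, toExt_extDeriv_sum _ fun β _ => (hd β).smul_const _]
  simp only [toExt_extDeriv_smul_const (hd _), dz_eq, toExt_oneForm]
  have h0 : ∑ β, ∑ α, delZ α (fderiv ℝ (dFz F i β) z) •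
      (ExteriorAlgebra.ι ℂ (dzL α) * ExteriorAlgebra.ι ℂ (dzL β)) = (0 : ExtAlg n) := by
    refine eq_zero_of_eq_neg ?_
    conv_lhs => rw [Finset.sum_comm]
    simp only [← Finset.sum_neg_distrib, ← smul_neg]
    refine Finset.sum_congr rfl fun β _ => Finset.sum_congr rfl fun α _ => ?_
    rw [delZ_fderiv_dFz_comm hF, ι_mul_ι_swap]
  rw [← zero_add (-∑ β, ∑ α, _), ← h0, ← Finset.sum_neg_distrib, ← Finset.sum_add_distrib]
  refine Finset.sum_congr rfl fun β _ => ?_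
  conv_lhs => rw [dual_eq_sum_dz (fderiv ℝ (dFz F i β) z)]
  simp only [map_sum, map_add, map_smul, Finset.sum_mul, add_mul, smul_mul_assoc,
    Finset.sum_add_distrib, ← Finset.sum_neg_distrib, ← smul_neg]
  congr 1
  refine Finset.sum_congr rfl fun α _ => ?_
  rw [delZbar_fderiv_dFz hF, ι_mul_ι_swap]

/-- The chain rule with `dF^l = d'F^l + d''F^l`, used to differentiate `h_{ij}(f)` and
`Γ^i_{jk}(f)`. -/
theorem fderiv_comp_eq_sum {u : RSpace m → ℝ} (hu : DifferentiableAt ℝ u (F z)) :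
    fderiv ℝ (fun w => (u (F w) : ℂ)) z =
      ∑ l, (fderiv ℝ u (F z) (stdFrame m l) : ℂ) • (delMap F l z + delbarMap F l z) := by
  have hF' : DifferentiableAt ℝ F z := hF.differentiableAt (by simp)
  have h := Complex.ofRealCLM.hasFDerivAt.comp z (hu.hasFDerivAt.comp z hF'.hasFDerivAt)
  have hc : ∀ l, fderiv ℝ (fun w => F w l) z =
      (EuclideanSpace.proj l : RSpace m →L[ℝ] ℝ).comp (fderiv ℝ F z) := fun l =>
    ((EuclideanSpace.proj l : RSpace m →L[ℝ] ℝ).hasFDerivAt.comp z hF'.hasFDerivAt).fderiv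
  ext v
  have h1 := congrArg (fun L => L v) h.fderiv
  refine Eq.trans h1 ?_
  have h2 : fderiv ℝ F z v = ∑ l, fderiv ℝ F z v l • stdFrame m l := by
    ext i
    simp [stdFrame, Pi.single_apply]
  simp only [← dComp_eq, sum_apply, smul_apply, dComp, hc, ContinuousLinearMap.comp_apply,
    Complex.ofRealCLM_apply, smul_eq_mul]
  rw [h2, map_sum]
  push_cast
  refine Finset.sum_congr rfl fun l _ => ?_
  rw [map_smul, ← h2]
  simp [mul_comm]

end Smooth

/-- The components `f^i_{α\bar β}` of the Levi form `d'_E d''F`. -/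
def leviForm (H : RSpace m → Matrix (Fin m) (Fin m) ℝ) (F : CSpace n → RSpace m) (i : Fin m)
    (z : CSpace n) (α β : Fin n) : ℂ :=
  delZ α (fderiv ℝ (dFzbar F i β) z) + ∑ j, ∑ k,
    ((christoffel (stdFrame m) H i j k (F z) : ℝ) : ℂ) * (dFz F j α z * dFzbar F k β z)

theorem ι_delMap_mul_ι_delbarMap (j k : Fin m) :
    (ExteriorAlgebra.ι ℂ (delMap F j z) * ExteriorAlgebra.ι ℂ (delbarMap F k z) : ExtAlg n) =
      ∑ α, ∑ β, (dFz F j α z * dFzbar F k β z) •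
        (ExteriorAlgebra.ι ℂ (dzL α) * ExteriorAlgebra.ι ℂ (dzbarL β)) := by
  simp only [delMap, delbarMap, map_sum, map_smul, Finset.sum_mul_sum, smul_mul_smul_comm]

theorem toExt_dPrimeE_dDoublePrimeMap (hF : ContDiffAt ℝ ∞ F z)
    (H : RSpace m → Matrix (Fin m) (Fin m) ℝ) (i : Fin m) :
    toExt (dPrimeE H F (dDoublePrimeMap F) i z) = ∑ α, ∑ β, leviForm H F i z α β •
      (ExteriorAlgebra.ι ℂ (dzL α) * ExteriorAlgebra.ι ℂ (dzbarL β)) := by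
  simp only [dPrimeE, map_add, map_sum, map_smul, toExt_dPrime_dDoublePrimeMap hF, dPrimeMap_eq,
    dDoublePrimeMap_eq, toExt_wedge_oneForm, ι_delMap_mul_ι_delbarMap, leviForm, add_smul,
    Finset.sum_add_distrib, Finset.smul_sum, Finset.sum_smul, smul_smul]
  congr 1
  rw [Finset.sum_congr rfl fun j _ => Finset.sum_comm, Finset.sum_comm]
  refine Finset.sum_congr rfl fun α _ => ?_
  rw [Finset.sum_congr rfl fun j _ => Finset.sum_comm, Finset.sum_comm]

theorem toExt_dDoublePrimeE_dPrimeMap (hF : ContDiffAt ℝ ∞ F z)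
    (H : RSpace m → Matrix (Fin m) (Fin m) ℝ) (i : Fin m) :
    toExt (dDoublePrimeE H F (dPrimeMap F) i z) = toExt (extDeriv (dPrimeMap F i) z) +
      ∑ j, ∑ k, ((christoffel (stdFrame m) H i j k (F z) : ℝ) : ℂ) •
        (ExteriorAlgebra.ι ℂ (delbarMap F j z) * ExteriorAlgebra.ι ℂ (delMap F k z)) := by
  simp only [dDoublePrimeE, map_add, map_sum, map_smul, toExt_extDeriv_dPrimeMap hF, dPrimeMap_eq,
    dDoublePrimeMap_eq, toExt_wedge_oneForm]

/-- Absence of torsion gives `d''_E d'f = -d'_E d''f`. Thus the form under the bracket and the form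
in the norm have the same components up to sign. -/
theorem toExt_dDoublePrimeE_eq_neg {H : RSpace m → Matrix (Fin m) (Fin m) ℝ}
    (hF : ContDiffAt ℝ ∞ F z) (hΓ : ∀ i j k, christoffel (stdFrame m) H i j k (F z) =
      christoffel (stdFrame m) H i k j (F z)) (i : Fin m) :
    toExt (dDoublePrimeE H F (dPrimeMap F) i z) = -∑ α, ∑ β, leviForm H F i z α β •
      (ExteriorAlgebra.ι ℂ (dzL α) * ExteriorAlgebra.ι ℂ (dzbarL β)) := by
  rw [← toExt_dPrimeE_dDoublePrimeMap hF, toExt_dDoublePrimeE_dPrimeMap hF,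
    toExt_extDeriv_dPrimeMap hF, toExt_dDoublePrime_dPrimeMap hF]
  simp only [dPrimeE, map_add, map_sum, map_smul, toExt_dPrime_dDoublePrimeMap hF, dPrimeMap_eq,
    dDoublePrimeMap_eq, toExt_wedge_oneForm]
  rw [neg_add]
  congr 1
  rw [Finset.sum_comm, ← Finset.sum_neg_distrib]
  refine Finset.sum_congr rfl fun j _ => ?_
  rw [← Finset.sum_neg_distrib]
  refine Finset.sum_congr rfl fun k _ => ?_
  rw [hΓ, ι_mul_ι_swap, smul_neg]

theorem comp11_dPrimeE (hF : ContDiffAt ℝ ∞ F z)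
    (H : RSpace m → Matrix (Fin m) (Fin m) ℝ) (i : Fin m) (α β : Fin n) :
    comp11 (dPrimeE H F (dDoublePrimeMap F) i z) α β = leviForm H F i z α β := by
  have h : ∀ v w : CSpace n, (dPrimeE H F (dDoublePrimeMap F) i z : CForm n 2) ![v, w] =
      ∑ γ, ∑ δ, leviForm H F i z γ δ * (dzL γ v * dzbarL δ w - dzL γ w * dzbarL δ v) := by
    intro v w
    have := extEval_toExt ![v, w] (dPrimeE H F (dDoublePrimeMap F) i z)
    rw [toExt_dPrimeE_dDoublePrimeMap hF] at this
    simp only [map_sum, map_smul, extEval_ι_mul_ι, smul_eq_mul] at this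
    exact this.symm
  -- The left side is `dz^γ ∧ d\bar z^δ` on `(∂/∂z^α, ∂/∂\bar z^β)`; the exchanged product drops out
  -- because `dz^γ(∂/∂\bar z^β) = 0`, which is `e1`.
  have h2 : ∀ γ δ, (1 / 4 : ℂ) * ((dzL γ (eX α) * dzbarL δ (eX β) - dzL γ (eX β) * dzbarL δ (eX α))
      + Complex.I * (dzL γ (eX α) * dzbarL δ (eY β) - dzL γ (eY β) * dzbarL δ (eX α))
      - Complex.I * (dzL γ (eY α) * dzbarL δ (eX β) - dzL γ (eX β) * dzbarL δ (eY α))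
      + (dzL γ (eY α) * dzbarL δ (eY β) - dzL γ (eY β) * dzbarL δ (eY α))) =
      (if α = γ then 1 else 0) * (if β = δ then 1 else 0) := by
    intro γ δ
    rw [← delZ_dzL, ← delZbar_dzbarL]
    have e1 := delZbar_dzL β γ
    rw [delZbar_apply] at e1
    rw [delZ_apply, delZbar_apply]
    linear_combination (-(1 / 2) * (dzbarL δ (eX α) - Complex.I * dzbarL δ (eY α))) * e1
      + ((1 / 4) * dzL γ (eY α) * dzbarL δ (eY β) - (1 / 4) * dzL γ (eY β) * dzbarL δ (eY α)) *
        Complex.I_sq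
  rw [comp11, h, h, h, h]
  have h3 : leviForm H F i z α β = ∑ γ, ∑ δ, leviForm H F i z γ δ *
      ((if α = γ then 1 else 0) * (if β = δ then 1 else 0)) := by
    simp [mul_ite]
  rw [h3]
  simp only [Finset.mul_sum, ← Finset.sum_add_distrib, ← Finset.sum_sub_distrib, ← h2]
  refine Finset.sum_congr rfl fun γ _ => Finset.sum_congr rfl fun δ _ => ?_
  ring

/-- `T` is the real Hessian of `f` without the Christoffel symbols of the domain, and the Levi form
is its `(1,1)`-part. This is the shape required by `sum_hermInv_mul`. -/
theorem leviForm_eq (hF : ContDiffAt ℝ ∞ F z) (H : RSpace m → Matrix (Fin m) (Fin m) ℝ)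
    (i : Fin m) (α β : Fin n) :
    let T : Fin n ⊕ Fin n → Fin n ⊕ Fin n → ℝ := fun a c =>
      fderiv ℝ (fun y => fderiv ℝ (fun w => F w i) y (realFrame n c)) z (realFrame n a)
        + ∑ j, ∑ k, christoffel (stdFrame m) H i j k (F z) *
          fderiv ℝ (fun w => F w j) z (realFrame n a) * fderiv ℝ (fun w => F w k) z (realFrame n c)
    leviForm H F i z α β = (1 / 4 : ℂ) *
      ((T (.inl α) (.inl β) : ℂ) + T (.inr α) (.inr β)
        + Complex.I * ((T (.inl α) (.inr β) : ℂ) - T (.inr α) (.inl β))) := by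
  intro T
  simp only [leviForm, T, delZ_apply, fderiv_dFzbar_apply hF, fderiv_dComp_apply hF, realFrame,
    Sum.elim_inl, Sum.elim_inr, dFz, dFzbar]
  simp only [dComp, ContinuousLinearMap.comp_apply, Complex.ofRealCLM_apply]
  push_cast
  have e : ∀ x1 x2 x3 x4 : ℂ, ∀ f1 f2 f3 f4 : Fin m → Fin m → ℂ,
      (1 / 4 : ℂ) * ((x1 + ∑ j, ∑ k, f1 j k) + (x2 + ∑ j, ∑ k, f2 j k) + Complex.I *
      ((x3 + ∑ j, ∑ k, f3 j k) - (x4 + ∑ j, ∑ k, f4 j k))) =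
      (1 / 4 : ℂ) * (x1 + x2 + Complex.I * (x3 - x4)) + ∑ j, ∑ k, (1 / 4 : ℂ) *
        (f1 j k + f2 j k + Complex.I * (f3 j k - f4 j k)) := by
    intro x1 x2 x3 x4 f1 f2 f3 f4
    simp only [← Finset.mul_sum, Finset.sum_add_distrib, Finset.sum_sub_distrib]
    ring
  rw [e]
  congr 1
  · linear_combination (-(1 / 4 : ℂ) * (fderiv ℝ (fun y => fderiv ℝ (fun w => F w i) y (eY β)) z
      (eY α) : ℂ)) * Complex.I_sq
  · refine Finset.sum_congr rfl fun j _ => Finset.sum_congr rfl fun k _ => ?_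
    linear_combination (-(1 / 4 : ℂ) * (christoffel (stdFrame m) H i j k (F z) : ℂ) *
      (fderiv ℝ (fun w => F w j) z (eY α) : ℂ) * (fderiv ℝ (fun w => F w k) z (eY β) : ℂ)) *
      Complex.I_sq

/-- The `(1,1)`-part of a real symmetric tensor is Hermitian. Hence the conjugate in the norm can be
traded for a transposition. -/
theorem conj_leviForm (hF : ContDiffAt ℝ ∞ F z) {H : RSpace m → Matrix (Fin m) (Fin m) ℝ}
    (hΓ : ∀ i j k, christoffel (stdFrame m) H i j k (F z) =
      christoffel (stdFrame m) H i k j (F z)) (i : Fin m) (α β : Fin n) :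
    (starRingEnd ℂ) (leviForm H F i z α β) = leviForm H F i z β α := by
  simp only [leviForm, map_add, map_sum, map_mul, Complex.conj_ofReal, conj_dFz, conj_dFzbar]
  congr 1
  · simp only [delZ_apply, fderiv_dFzbar_apply hF, fderiv_dComp_apply hF,
      fderiv_fderiv_comm (contDiffAt_coord hF i) (eX β),
      fderiv_fderiv_comm (contDiffAt_coord hF i) (eY β)]
    simp only [map_add, map_sub, map_mul, map_div₀, map_one, map_ofNat, Complex.conj_I,
      Complex.conj_ofReal]
    ring
  · rw [Finset.sum_comm]
    refine Finset.sum_congr rfl fun j _ => Finset.sum_congr rfl fun k _ => ?_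
    rw [hΓ]
    ring

end MapForms

/-! ### The Bochner identity in the exterior algebra -/

theorem sum_smul_of_antisymm {ι' V : Type*} [Fintype ι'] [AddCommGroup V] [Module ℂ V]
    (c : ι' → ι' → ℂ) {X : ι' → ι' → V} (hX : ∀ j k, X j k = -X k j) :
    ∑ j, ∑ k, c j k • X j k = ∑ j, ∑ k, ((1 / 2 : ℂ) * (c j k - c k j)) • X j k := by
  have h : ∑ j, ∑ k, c j k • X j k = -∑ j, ∑ k, c k j • X j k := by
    rw [Finset.sum_comm, ← Finset.sum_neg_distrib]
    refine Finset.sum_congr rfl fun j _ => ?_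
    rw [← Finset.sum_neg_distrib]
    exact Finset.sum_congr rfl fun k _ => by rw [hX, smul_neg]
  have h2 : ∑ j, ∑ k, ((1 / 2 : ℂ) * (c j k - c k j)) • X j k =
      (1 / 2 : ℂ) • (∑ j, ∑ k, c j k • X j k - ∑ j, ∑ k, c k j • X j k) := by
    simp only [← Finset.sum_sub_distrib, Finset.smul_sum, smul_smul, ← sub_smul, mul_sub]
  rw [h2, sub_eq_add_neg, ← h, ← two_smul ℂ, smul_smul]
  norm_num

theorem sum_smul_eq_zero_of_symm {ι' V : Type*} [Fintype ι'] [AddCommGroup V] [Module ℂ V]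
    {c : ι' → ι' → ℂ} {X : ι' → ι' → V} (hc : ∀ j k, c j k = c k j) (hX : ∀ j k, X j k = -X k j) :
    ∑ j, ∑ k, c j k • X j k = 0 := by
  rw [sum_smul_of_antisymm c hX]
  refine Finset.sum_eq_zero fun j _ => Finset.sum_eq_zero fun k _ => ?_
  rw [hc, sub_self, mul_zero, zero_smul]

section Algebra

variable {ι' R : Type*} [Fintype ι'] [Ring R] [Algebra ℂ R] {p q s : ι' → R}
  {Γ : ι' → ι' → ι' → ℂ} {dΓ : ι' → ι' → ι' → ι' → ℂ}

/-- The left side is `dA^i + Γ^i_{lr} (p^l + q^l) ∧ A^r`, that is `DA`, with `dp = s` and `dq = -s`;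
the right side is the curvature of the target. -/
theorem second_derivative_identity
    (hpp : ∀ j k, p j * p k = -(p k * p j)) (hqq : ∀ j k, q j * q k = -(q k * q j))
    (hqp : ∀ j k, q j * p k = -(p k * q j)) (hsp : ∀ j k, s j * p k = p k * s j)
    (hΓ : ∀ i j k, Γ i j k = Γ i k j) (hdΓ : ∀ l i j k, dΓ l i j k = dΓ l i k j) (i : ι') :
    (∑ j, ∑ k, ((∑ l, dΓ l i j k • (p l + q l)) * (q j * p k)
        + Γ i j k • (-(s j * p k) - q j * s k)))
      + ∑ l, ∑ r, Γ i l r • ((p l + q l) * (s r + ∑ j, ∑ k, Γ r j k • (q j * p k))) =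
    ∑ l, ∑ j, ∑ k, (((1 / 2 : ℂ) * (dΓ l i j k - dΓ j i l k
        + ∑ r, (Γ i l r * Γ r j k - Γ i j r * Γ r l k))) • (q l * q j * p k)
      - ((1 / 2 : ℂ) * (dΓ l i k j - dΓ k i l j
        + ∑ r, (Γ i l r * Γ r k j - Γ i k r * Γ r l j))) • (p l * p k * q j)) := by
  -- `C` is symmetric in its last two indices, and its antisymmetrisation in the first two is the
  -- curvature. The products `q^l q^j` and `p^l p^k` perform that antisymmetrisation.
  set C : ι' → ι' → ι' → ℂ := fun l j k => dΓ l i j k + ∑ r, Γ i l r * Γ r j k with hC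
  have hCs : ∀ l j k, C l j k = C l k j := by
    intro l j k
    simp only [hC, hdΓ l i j k, fun r => hΓ r j k]
  have hCd : ∀ l j k, dΓ l i j k - dΓ j i l k
        + ∑ r, (Γ i l r * Γ r j k - Γ i j r * Γ r l k) = C l j k - C j l k := by
    intro l j k
    simp only [hC, Finset.sum_sub_distrib]
    ring
  simp only [hCd]
  have h1 : ∑ j, ∑ k, (∑ l, dΓ l i j k • (p l + q l)) * (q j * p k) =
      ∑ l, ∑ j, ∑ k, dΓ l i j k • ((p l + q l) * (q j * p k)) := by
    simp only [Finset.sum_mul, smul_mul_assoc]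
    rw [Finset.sum_congr rfl fun j _ => Finset.sum_comm, Finset.sum_comm]
  have h2 : ∑ l, ∑ r, Γ i l r • ((p l + q l) * ∑ j, ∑ k, Γ r j k • (q j * p k)) =
      ∑ l, ∑ j, ∑ k, (∑ r, Γ i l r * Γ r j k) • ((p l + q l) * (q j * p k)) := by
    refine Finset.sum_congr rfl fun l _ => ?_
    simp only [Finset.mul_sum, Finset.smul_sum, mul_smul_comm, smul_smul, Finset.sum_smul]
    rw [Finset.sum_comm]
    exact Finset.sum_congr rfl fun j _ => Finset.sum_comm
  -- All terms with second derivatives of `f` cancel: those of `d(q ∧ p)` against those of `(p + q)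
  -- ∧ s`.
  have h3 : ∑ j, ∑ k, Γ i j k • (-(s j * p k) - q j * s k) +
      ∑ l, ∑ r, Γ i l r • ((p l + q l) * s r) = 0 := by
    have e : ∑ j, ∑ k, Γ i j k • (s j * p k) = ∑ j, ∑ k, Γ i j k • (p j * s k) := by
      rw [Finset.sum_comm]
      exact Finset.sum_congr rfl fun j _ => Finset.sum_congr rfl fun k _ => by rw [hΓ, hsp]
    simp only [add_mul, smul_add, smul_sub, smul_neg, Finset.sum_add_distrib,
      Finset.sum_sub_distrib, Finset.sum_neg_distrib, e]
    abel
  have h4 : (∑ j, ∑ k, ((∑ l, dΓ l i j k • (p l + q l)) * (q j * p k)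
        + Γ i j k • (-(s j * p k) - q j * s k)))
      + ∑ l, ∑ r, Γ i l r • ((p l + q l) * (s r + ∑ j, ∑ k, Γ r j k • (q j * p k))) =
      ∑ l, ∑ j, ∑ k, C l j k • ((p l + q l) * (q j * p k)) := by
    have e : ∀ l r, Γ i l r • ((p l + q l) * (s r + ∑ j, ∑ k, Γ r j k • (q j * p k))) =
        Γ i l r • ((p l + q l) * s r) +
          Γ i l r • ((p l + q l) * ∑ j, ∑ k, Γ r j k • (q j * p k)) := by
      intro l r
      rw [mul_add, smul_add]
    simp only [e, hC, add_smul, Finset.sum_add_distrib, h1, h2]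
    rw [add_comm (∑ l, ∑ r, Γ i l r • ((p l + q l) * s r)), add_add_add_comm, h3, add_zero]
  rw [h4]
  have h5 : ∑ l, ∑ j, ∑ k, C l j k • (q l * (q j * p k)) =
      ∑ l, ∑ j, ∑ k, ((1 / 2 : ℂ) * (C l j k - C j l k)) • (q l * q j * p k) := by
    rw [Finset.sum_congr rfl fun l _ => Finset.sum_comm, Finset.sum_comm,
      Finset.sum_congr rfl fun l _ => Finset.sum_comm (f := fun j k => _ • (q l * q j * p k)),
      Finset.sum_comm (f := fun l k => ∑ j, _ • (q l * q j * p k))]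
    refine Finset.sum_congr rfl fun k _ => ?_
    simp only [← mul_assoc]
    exact sum_smul_of_antisymm (fun l j => C l j k) fun l j => by rw [hqq, neg_mul]
  have h6 : ∑ l, ∑ j, ∑ k, C l j k • (p l * (q j * p k)) =
      -∑ l, ∑ j, ∑ k, ((1 / 2 : ℂ) * (C l k j - C k l j)) • (p l * p k * q j) := by
    rw [Finset.sum_comm, Finset.sum_comm (f := fun l j => ∑ k, _ • (p l * p k * q j)),
      ← Finset.sum_neg_distrib]
    refine Finset.sum_congr rfl fun j _ => ?_
    rw [← sum_smul_of_antisymm (fun l k => C l k j) fun l k => by rw [hpp, neg_mul]]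
    simp only [← Finset.sum_neg_distrib]
    refine Finset.sum_congr rfl fun l _ => Finset.sum_congr rfl fun k _ => ?_
    rw [hqp, hCs, mul_neg, smul_neg, mul_assoc]
  simp only [add_mul, smul_add, Finset.sum_add_distrib, Finset.sum_sub_distrib]
  rw [h5, h6]
  abel

/-- The Leibniz rule for `D`: by compatibility, `dh` splits into one connection term completing `dA`
to `DA` and another completing `d(p - q) = 2s` to `2A`. -/
theorem bracket_derivative_identity {h : ι' → ι' → ℂ} {dh : ι' → ι' → ι' → ℂ} {A dA : ι' → R}
    (hpp : ∀ j k, p j * p k = -(p k * p j)) (hqq : ∀ j k, q j * q k = -(q k * q j))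
    (hqp : ∀ j k, q j * p k = -(p k * q j))
    (hAp : ∀ j k, A j * p k = p k * A j) (hAq : ∀ j k, A j * q k = q k * A j)
    (hΓ : ∀ i j k, Γ i j k = Γ i k j) (hh : ∀ i j, h i j = h j i)
    (hdh : ∀ l i j, dh l i j = ∑ r, (h j r * Γ r l i + h i r * Γ r l j))
    (hA : ∀ i, A i = s i + ∑ j, ∑ k, Γ i j k • (q j * p k)) :
    ∑ i, ∑ j, ((∑ l, dh l i j • (p l + q l)) * (A i * (p j - q j))
      + h i j • (dA i * (p j - q j) + A i * ((2 : ℂ) • s j))) =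
    ∑ i, ∑ j, h i j • ((dA i + ∑ l, ∑ r, Γ i l r • ((p l + q l) * A r)) * (p j - q j)
      + (2 : ℂ) • (A i * A j)) := by
  -- This is `D(p - q) = 2A`: the `pp` and `qq` terms die against the symmetric `Γ`, while the two
  -- mixed terms add up.
  have h3 : ∀ r, (2 : ℂ) • A r = (2 : ℂ) • s r + ∑ l, ∑ j, Γ r l j • ((p l + q l) * (p j - q j)) := by
    intro r
    have e0 : ∀ l j, (p l + q l) * (p j - q j) = p l * p j - q l * q j + q l * p j + q j * p l := by
      intro l j
      rw [hqp j l]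
      noncomm_ring
    have e1 : ∑ l, ∑ j, Γ r l j • (q j * p l) = ∑ l, ∑ j, Γ r l j • (q l * p j) := by
      rw [Finset.sum_comm]
      exact Finset.sum_congr rfl fun l _ => Finset.sum_congr rfl fun j _ => by rw [hΓ]
    simp only [e0, smul_add, smul_sub, Finset.sum_add_distrib, Finset.sum_sub_distrib, e1, hA,
      sum_smul_eq_zero_of_symm (hΓ r) hpp, sum_smul_eq_zero_of_symm (hΓ r) hqq]
    rw [two_smul ℂ (∑ j, ∑ k, Γ r j k • (q j * p k))]
    abel
  have h1 : ∑ i, ∑ j, (∑ l, dh l i j • (p l + q l)) * (A i * (p j - q j)) =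
      ∑ i, ∑ j, h i j • ((∑ l, ∑ r, Γ i l r • ((p l + q l) * A r)) * (p j - q j))
      + ∑ i, ∑ j, h i j • (A i * ∑ l, ∑ r, Γ j l r • ((p l + q l) * (p r - q r))) := by
    have f1 : ∑ i, ∑ j, ∑ l, (∑ r, h j r * Γ r l i) • ((p l + q l) * (A i * (p j - q j))) =
        ∑ i, ∑ j, h i j • ((∑ l, ∑ r, Γ i l r • ((p l + q l) * A r)) * (p j - q j)) := by
      simp only [Finset.sum_mul, Finset.smul_sum, Finset.sum_smul, smul_mul_assoc, smul_smul]
      rw [Finset.sum_congr rfl fun i _ => Finset.sum_congr rfl fun j _ => Finset.sum_comm,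
        Finset.sum_congr rfl fun i _ => Finset.sum_comm, Finset.sum_comm]
      refine Finset.sum_congr rfl fun r _ => ?_
      rw [Finset.sum_comm]
      refine Finset.sum_congr rfl fun j _ => ?_
      rw [Finset.sum_comm]
      refine Finset.sum_congr rfl fun l _ => Finset.sum_congr rfl fun i _ => ?_
      rw [hh, mul_assoc]
    have f2 : ∑ i, ∑ j, ∑ l, (∑ r, h i r * Γ r l j) • ((p l + q l) * (A i * (p j - q j))) =
        ∑ i, ∑ j, h i j • (A i * ∑ l, ∑ r, Γ j l r • ((p l + q l) * (p r - q r))) := by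
      simp only [Finset.mul_sum, Finset.smul_sum, Finset.sum_smul, mul_smul_comm, smul_smul]
      refine Finset.sum_congr rfl fun i _ => ?_
      rw [Finset.sum_congr rfl fun j _ => Finset.sum_comm, Finset.sum_comm]
      refine Finset.sum_congr rfl fun r _ => ?_
      rw [Finset.sum_comm]
      refine Finset.sum_congr rfl fun l _ => Finset.sum_congr rfl fun j _ => ?_
      rw [← mul_assoc, ← mul_assoc, mul_add, add_mul, hAp, hAq]
    have f0 : ∀ i j, (∑ l, dh l i j • (p l + q l)) * (A i * (p j - q j)) =
        ∑ l, (∑ r, h j r * Γ r l i) • ((p l + q l) * (A i * (p j - q j))) +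
          ∑ l, (∑ r, h i r * Γ r l j) • ((p l + q l) * (A i * (p j - q j))) := by
      intro i j
      rw [Finset.sum_mul, ← Finset.sum_add_distrib]
      refine Finset.sum_congr rfl fun l _ => ?_
      rw [smul_mul_assoc, hdh, Finset.sum_add_distrib, add_smul]
    rw [← f1, ← f2]
    simp only [f0, Finset.sum_add_distrib]
  have e : ∀ i j, h i j • ((dA i + ∑ l, ∑ r, Γ i l r • ((p l + q l) * A r)) * (p j - q j)
      + (2 : ℂ) • (A i * A j)) = h i j • (dA i * (p j - q j))
      + h i j • ((∑ l, ∑ r, Γ i l r • ((p l + q l) * A r)) * (p j - q j))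
      + (h i j • (A i * ((2 : ℂ) • s j))
      + h i j • (A i * ∑ l, ∑ r, Γ j l r • ((p l + q l) * (p r - q r)))) := by
    intro i j
    rw [← mul_smul_comm, h3, mul_add, add_mul, smul_add, smul_add, smul_add]
  have e' : ∀ i j, h i j • (dA i * (p j - q j) + A i * ((2 : ℂ) • s j)) =
      h i j • (dA i * (p j - q j)) + h i j • (A i * ((2 : ℂ) • s j)) := fun i j => smul_add _ _ _
  simp only [e, e', Finset.sum_add_distrib, h1]
  abel

end Algebra

/-! ### The exterior derivative of `{d''_E d'f, d''f - d'f}` -/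

theorem differentiableAt_clm_fderiv {E V W : Type*} [NormedAddCommGroup E] [NormedSpace ℝ E]
    [NormedAddCommGroup V] [NormedSpace ℝ V] [NormedAddCommGroup W] [NormedSpace ℝ W]
    (L : (E →L[ℝ] V) →L[ℝ] W) {η : E → V} {z : E} (hη : ContDiffAt ℝ ∞ η z) :
    DifferentiableAt ℝ (fun w => L (fderiv ℝ η w)) z := by
  have h : DifferentiableAt ℝ (fderiv ℝ η) z :=
    (hη.fderiv_right (m := ∞) (by simp)).differentiableAt (by simp)
  exact L.differentiableAt.comp z h

theorem differentiableAt_extDeriv {n k : ℕ} {η : CSpace n → CForm n k} {z : CSpace n}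
    (hη : ContDiffAt ℝ ∞ η z) : DifferentiableAt ℝ (extDeriv η) z :=
  differentiableAt_clm_fderiv
    (ContinuousAlternatingMap.alternatizeUncurryFinCLM ℝ (CSpace n) ℂ) hη

theorem extDeriv_extDeriv_eq_zero {n k : ℕ} {η : CSpace n → CForm n k} {z : CSpace n}
    (hη : ContDiffAt ℝ ∞ η z) : extDeriv (extDeriv η) z = 0 :=
  extDeriv_extDeriv_apply hη (by
    rw [minSmoothness_of_isRCLikeNormedField]; exact ENat.LEInfty.out)

section MapDerivatives

variable {n m : ℕ} {F : CSpace n → RSpace m} {z : CSpace n}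

/-- Exposes an exact summand, so that differentiating once more involves only the derivatives of `Γ`
and of the two `1`-forms. -/
theorem dDoublePrimeE_dPrimeMap_eq (hF : ContDiffAt ℝ ∞ F z)
    (H : RSpace m → Matrix (Fin m) (Fin m) ℝ) (i : Fin m) :
    dDoublePrimeE H F (dPrimeMap F) i z = extDeriv (dPrimeMap F i) z +
      ∑ j, ∑ k, ((christoffel (stdFrame m) H i j k (F z) : ℝ) : ℂ) •
        wedge (dDoublePrimeMap F j z) (dPrimeMap F k z) :=
  toExt_injective <| by
    rw [toExt_dDoublePrimeE_dPrimeMap hF]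
    simp only [map_add, map_sum, map_smul, dPrimeMap_eq, dDoublePrimeMap_eq, toExt_wedge_oneForm]

theorem toExt_extDeriv_dDoublePrimeMap_eq_neg (hF : ContDiffAt ℝ ∞ F z) (i : Fin m) :
    toExt (extDeriv (dDoublePrimeMap F i) z) = -toExt (extDeriv (dPrimeMap F i) z) := by
  rw [toExt_extDeriv_dDoublePrimeMap hF, toExt_extDeriv_dPrimeMap hF,
    toExt_dDoublePrime_dPrimeMap hF, toExt_dPrime_dDoublePrimeMap hF, neg_neg]

theorem differentiableAt_ofReal_comp (hF : ContDiffAt ℝ ∞ F z) {u : RSpace m → ℝ}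
    (hu : ContDiffAt ℝ ∞ u (F z)) : DifferentiableAt ℝ (fun w => (u (F w) : ℂ)) z :=
  Complex.ofRealCLM.differentiableAt.comp z
    ((hu.differentiableAt (by simp)).comp z (hF.differentiableAt (by simp)))

/-- The formula has to be differentiated, hence it is needed near `z`; the open set `S` of points
where `F` is smooth supplies the neighbourhood. -/
theorem eventuallyEq_dDoublePrimeE_dPrimeMap {S : Set (CSpace n)} (hS : IsOpen S)
    (hF : ∀ w ∈ S, ContDiffAt ℝ ∞ F w) (hz : z ∈ S) (H : RSpace m → Matrix (Fin m) (Fin m) ℝ)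
    (i : Fin m) :
    dDoublePrimeE H F (dPrimeMap F) i =ᶠ[nhds z] fun w => extDeriv (dPrimeMap F i) w +
      ∑ j, ∑ k, ((christoffel (stdFrame m) H i j k (F w) : ℝ) : ℂ) •
        wedge (dDoublePrimeMap F j w) (dPrimeMap F k w) :=
  Filter.mem_of_superset (hS.mem_nhds hz) fun w hw => dDoublePrimeE_dPrimeMap_eq (hF w hw) H i

theorem mochizukiForm_eq (H : RSpace m → Matrix (Fin m) (Fin m) ℝ) (F : CSpace n → RSpace m) :
    mochizukiForm H F = fun w => ∑ i, ∑ j, ((H (F w) i j : ℝ) : ℂ) •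
      wedge (dDoublePrimeE H F (dPrimeMap F) i w) (dPrimeMap F j w - dDoublePrimeMap F j w) := by
  funext w
  simp only [mochizukiForm, bracket, conjForm_dDoublePrimeMap_sub]

variable {H : RSpace m → Matrix (Fin m) (Fin m) ℝ} {S : Set (CSpace n)} {T : Set (RSpace m)}
  (hS : IsOpen S) (hF : ∀ w ∈ S, ContDiffAt ℝ ∞ F w) (hST : MapsTo F S T) (hH : IsMetricOn H T)
  (hz : z ∈ S)

include hS hF hST hH hz

theorem differentiableAt_dDoublePrimeE_dPrimeMap (i : Fin m) :
    DifferentiableAt ℝ (dDoublePrimeE H F (dPrimeMap F) i) z := by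
  refine (Filter.EventuallyEq.differentiableAt_iff
    (eventuallyEq_dDoublePrimeE_dPrimeMap hS hF hz H i)).mpr ?_
  refine (differentiableAt_extDeriv (contDiffAt_dPrimeMap (hF z hz) i)).add ?_
  refine DifferentiableAt.fun_sum fun j _ => DifferentiableAt.fun_sum fun k _ => ?_
  exact (differentiableAt_ofReal_comp (hF z hz)
    (hH.contDiffAt_christoffel (stdFrame m) (hST hz) i j k)).smul
    (DifferentiableAt.wedgeForm
      ((contDiffAt_dDoublePrimeMap (hF z hz) j).differentiableAt (by simp))
      ((contDiffAt_dPrimeMap (hF z hz) k).differentiableAt (by simp)))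

theorem toExt_extDeriv_dDoublePrimeE_dPrimeMap (i : Fin m) :
    toExt (extDeriv (dDoublePrimeE H F (dPrimeMap F) i) z) = ∑ j, ∑ k,
      ((∑ l, (fderiv ℝ (christoffel (stdFrame m) H i j k) (F z) (stdFrame m l) : ℂ) •
          (ExteriorAlgebra.ι ℂ (delMap F l z) + ExteriorAlgebra.ι ℂ (delbarMap F l z))) *
          (ExteriorAlgebra.ι ℂ (delbarMap F j z) * ExteriorAlgebra.ι ℂ (delMap F k z))
        + ((christoffel (stdFrame m) H i j k (F z) : ℝ) : ℂ) •
          (-(toExt (extDeriv (dPrimeMap F j) z) * ExteriorAlgebra.ι ℂ (delMap F k z)) -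
            ExteriorAlgebra.ι ℂ (delbarMap F j z) * toExt (extDeriv (dPrimeMap F k) z))) := by
  have hFz := hF z hz
  have hp := fun k => (contDiffAt_dPrimeMap hFz k).differentiableAt (n := ∞) (by simp)
  have hq := fun k => (contDiffAt_dDoublePrimeMap hFz k).differentiableAt (n := ∞) (by simp)
  have hΓ := fun j k => hH.contDiffAt_christoffel (stdFrame m) (hST hz) i j k
  have hd := fun j k => (differentiableAt_ofReal_comp hFz (hΓ j k)).fun_smul (DifferentiableAt.wedgeForm (hq j) (hp k))
  rw [(eventuallyEq_dDoublePrimeE_dPrimeMap hS hF hz H i).extDeriv_eq,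
    extDeriv_fun_add (differentiableAt_extDeriv (contDiffAt_dPrimeMap hFz i))
      (DifferentiableAt.fun_sum fun j _ => DifferentiableAt.fun_sum fun k _ => hd j k),
    extDeriv_extDeriv_eq_zero (contDiffAt_dPrimeMap hFz i), zero_add,
    toExt_extDeriv_sum _ fun j _ => DifferentiableAt.fun_sum fun k _ => hd j k]
  refine Finset.sum_congr rfl fun j _ => ?_
  rw [toExt_extDeriv_sum _ fun k _ => hd j k]
  refine Finset.sum_congr rfl fun k _ => ?_
  rw [toExt_extDeriv_smul (differentiableAt_ofReal_comp hFz (hΓ j k)) (DifferentiableAt.wedgeForm (hq j) (hp k)),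
    toExt_extDeriv_wedge (hq j) (hp k), toExt_extDeriv_dDoublePrimeMap_eq_neg hFz,
    fderiv_comp_eq_sum hFz ((hΓ j k).differentiableAt (by simp)), dDoublePrimeMap_eq,
    dPrimeMap_eq, toExt_wedge_oneForm, toExt_oneForm, toExt_oneForm]
  simp only [map_sum, map_smul, map_add]
  rw [pow_one, neg_one_smul, neg_mul, ← sub_eq_add_neg]

theorem differentiableAt_mochizukiForm : DifferentiableAt ℝ (mochizukiForm H F) z := by
  have hFz := hF z hz
  rw [mochizukiForm_eq]
  refine DifferentiableAt.fun_sum fun i _ => DifferentiableAt.fun_sum fun j _ => ?_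
  exact (differentiableAt_ofReal_comp hFz (hH.smooth i j _ (hST hz))).smul
    (DifferentiableAt.wedgeForm (differentiableAt_dDoublePrimeE_dPrimeMap hS hF hST hH hz i)
      (((contDiffAt_dPrimeMap hFz j).differentiableAt (by simp)).sub
        ((contDiffAt_dDoublePrimeMap hFz j).differentiableAt (by simp))))

theorem toExt_extDeriv_mochizukiForm_aux :
    toExt (extDeriv (mochizukiForm H F) z) = ∑ i, ∑ j,
      ((∑ l, (fderiv ℝ (fun y => H y i j) (F z) (stdFrame m l) : ℂ) •
          (ExteriorAlgebra.ι ℂ (delMap F l z) + ExteriorAlgebra.ι ℂ (delbarMap F l z))) *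
          (toExt (dDoublePrimeE H F (dPrimeMap F) i z) *
            (ExteriorAlgebra.ι ℂ (delMap F j z) - ExteriorAlgebra.ι ℂ (delbarMap F j z)))
        + ((H (F z) i j : ℝ) : ℂ) • (toExt (extDeriv (dDoublePrimeE H F (dPrimeMap F) i) z) *
            (ExteriorAlgebra.ι ℂ (delMap F j z) - ExteriorAlgebra.ι ℂ (delbarMap F j z))
          + toExt (dDoublePrimeE H F (dPrimeMap F) i z) *
            ((2 : ℂ) • toExt (extDeriv (dPrimeMap F j) z)))) := by
  have hFz := hF z hz
  have hp := fun k => (contDiffAt_dPrimeMap hFz k).differentiableAt (n := ∞) (by simp)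
  have hq := fun k => (contDiffAt_dDoublePrimeMap hFz k).differentiableAt (n := ∞) (by simp)
  have hh := fun i j => hH.smooth i j _ (hST hz)
  have hA := differentiableAt_dDoublePrimeE_dPrimeMap hS hF hST hH hz
  have hpq := fun j => (hp j).fun_sub (hq j)
  have hd := fun i j => (differentiableAt_ofReal_comp hFz (hh i j)).fun_smul (DifferentiableAt.wedgeForm (hA i) (hpq j))
  rw [mochizukiForm_eq,
    toExt_extDeriv_sum _ fun j _ => DifferentiableAt.fun_sum fun k _ => hd j k]
  refine Finset.sum_congr rfl fun i _ => ?_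
  rw [toExt_extDeriv_sum _ fun k _ => hd i k]
  refine Finset.sum_congr rfl fun j _ => ?_
  have e : toExt (extDeriv (fun w => dPrimeMap F j w - dDoublePrimeMap F j w) z) =
      (2 : ℂ) • toExt (extDeriv (dPrimeMap F j) z) := by
    have e1 : toExt (extDeriv (fun w => dPrimeMap F j w - dDoublePrimeMap F j w) z) =
        toExt (extDeriv (dPrimeMap F j) z) - toExt (extDeriv (dDoublePrimeMap F j) z) := by
      simp only [toExt_extDeriv, fderiv_fun_sub (hp j) (hq j), sub_apply, map_sub, mul_sub,
        Finset.sum_sub_distrib]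
    rw [e1, toExt_extDeriv_dDoublePrimeMap_eq_neg hFz, sub_neg_eq_add, two_smul]
  rw [toExt_extDeriv_smul (differentiableAt_ofReal_comp hFz (hh i j)) (DifferentiableAt.wedgeForm (hA i) (hpq j)),
    toExt_extDeriv_wedge (hA i) (hpq j), e,
    fderiv_comp_eq_sum hFz ((hh i j).differentiableAt (by simp)), toExt_wedge, map_sub,
    dDoublePrimeMap_eq, dPrimeMap_eq, toExt_oneForm, toExt_oneForm]
  simp only [map_sum, map_smul, map_add]
  norm_num

/-- The exterior derivative of `{d''_E d'f, d''f - d'f}`: a curvature term and the square of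
`d''_E d'f`. -/
theorem toExt_extDeriv_mochizukiForm :
    toExt (extDeriv (mochizukiForm H F) z) = ∑ i, ∑ j, ((H (F z) i j : ℝ) : ℂ) •
      ((∑ l, ∑ a, ∑ k,
          (((1 / 2 : ℂ) * (curvatureUp (stdFrame m) H l a k i (F z) : ℝ)) •
            (ExteriorAlgebra.ι ℂ (delbarMap F l z) * ExteriorAlgebra.ι ℂ (delbarMap F a z) *
              ExteriorAlgebra.ι ℂ (delMap F k z))
          - ((1 / 2 : ℂ) * (curvatureUp (stdFrame m) H l k a i (F z) : ℝ)) •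
            (ExteriorAlgebra.ι ℂ (delMap F l z) * ExteriorAlgebra.ι ℂ (delMap F k z) *
              ExteriorAlgebra.ι ℂ (delbarMap F a z)))) *
          (ExteriorAlgebra.ι ℂ (delMap F j z) - ExteriorAlgebra.ι ℂ (delbarMap F j z))
        + (2 : ℂ) • (toExt (dDoublePrimeE H F (dPrimeMap F) i z) *
            toExt (dDoublePrimeE H F (dPrimeMap F) j z))) := by
  have hFz := hF z hz
  have hTz := hST hz
  have hΓ : ∀ i j k, ((christoffel (stdFrame m) H i j k (F z) : ℝ) : ℂ) =
      ((christoffel (stdFrame m) H i k j (F z) : ℝ) : ℂ) := fun i j k => by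
    rw [hH.christoffel_symm _ hTz]
  have hcomm : ∀ i (θ : CDual n), toExt (dDoublePrimeE H F (dPrimeMap F) i z) *
      ExteriorAlgebra.ι ℂ θ = ExteriorAlgebra.ι ℂ θ *
        toExt (dDoublePrimeE H F (dPrimeMap F) i z) := fun i θ => (ι_mul_toExt_two θ _).symm
  rw [toExt_extDeriv_mochizukiForm_aux hS hF hST hH hz]
  rw [bracket_derivative_identity (p := fun i => ExteriorAlgebra.ι ℂ (delMap F i z))
    (q := fun i => ExteriorAlgebra.ι ℂ (delbarMap F i z))
    (s := fun i => toExt (extDeriv (dPrimeMap F i) z))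
    (Γ := fun i j k => ((christoffel (stdFrame m) H i j k (F z) : ℝ) : ℂ))
    (h := fun i j => ((H (F z) i j : ℝ) : ℂ))
    (dh := fun l i j => (fderiv ℝ (fun y => H y i j) (F z) (stdFrame m l) : ℂ))
    (A := fun i => toExt (dDoublePrimeE H F (dPrimeMap F) i z))
    (dA := fun i => toExt (extDeriv (dDoublePrimeE H F (dPrimeMap F) i) z))
    (fun j k => ι_mul_ι_swap _ _) (fun j k => ι_mul_ι_swap _ _) (fun j k => ι_mul_ι_swap _ _)
    (fun j k => hcomm _ _) (fun j k => hcomm _ _) hΓ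
    (fun i j => by rw [hH.symm _ hTz])
    (fun l i j => by
      rw [hH.fderiv_eq (stdFrame m) hTz]
      push_cast
      rfl)
    (fun i => toExt_dDoublePrimeE_dPrimeMap hFz H i)]
  refine Finset.sum_congr rfl fun i _ => Finset.sum_congr rfl fun j _ => ?_
  congr 3
  -- After the bracket identity only `DA^i` remains to be identified with its curvature expression.
  have := second_derivative_identity (p := fun i => (ExteriorAlgebra.ι ℂ (delMap F i z) : ExtAlg n))
    (q := fun i => ExteriorAlgebra.ι ℂ (delbarMap F i z))
    (s := fun i => toExt (extDeriv (dPrimeMap F i) z))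
    (Γ := fun i j k => ((christoffel (stdFrame m) H i j k (F z) : ℝ) : ℂ))
    (dΓ := fun l i j k =>
      (fderiv ℝ (christoffel (stdFrame m) H i j k) (F z) (stdFrame m l) : ℂ))
    (fun j k => ι_mul_ι_swap _ _) (fun j k => ι_mul_ι_swap _ _) (fun j k => ι_mul_ι_swap _ _)
    (fun j k => (ι_mul_toExt_two _ _).symm) hΓ
    (fun l i j k => by rw [hH.fderiv_christoffel_symm (stdFrame m) hTz]) i
  simp only [toExt_extDeriv_dDoublePrimeE_dPrimeMap hS hF hST hH hz,
    toExt_dDoublePrimeE_dPrimeMap hFz]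
  refine Eq.trans this ?_
  simp only [curvatureUp]
  push_cast
  rfl

end MapDerivatives

/-! ### Evaluation against the powers of the Kähler form -/

theorem poisson_dzbarL_dzbarL {n : ℕ} (G : Matrix (Fin n) (Fin n) ℂ) (α β : Fin n) :
    poisson G (dzbarL α) (dzbarL β) = 0 := by
  simp [poisson, delZ_dzbarL]

theorem poisson_dzL_dzbarL {n : ℕ} (G : Matrix (Fin n) (Fin n) ℂ) (α β : Fin n) :
    poisson G (dzL α) (dzbarL β) = -2 * Complex.I * hermInv G α β := by
  simp [poisson, delZ_dzL, delZ_dzbarL, delZbar_dzbarL]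

theorem poisson_swap {n : ℕ} (G : Matrix (Fin n) (Fin n) ℂ) (θ θ' : CDual n) :
    poisson G θ θ' = -poisson G θ' θ := by
  simp only [poisson, ← mul_neg, ← Finset.sum_neg_distrib]
  congr 1
  exact Finset.sum_congr rfl fun _ _ => Finset.sum_congr rfl fun _ _ => by ring

/-- The `(1,1)` part of a quadratic expression in `2`-forms, paired with `ω^{n-2}`. -/
theorem sum_ι_dz_mul_sum_ι_dz_mul_divPow {n k : ℕ} {G : Matrix (Fin n) (Fin n) ℂ}
    (hG : IsUnit G.det) (hk : n = k + 2) (a b : Fin n → Fin n → ℂ)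
    (hb : ∑ α, ∑ β, hermInv G α β * b α β = 0) :
    (∑ α, ∑ β, a α β • (ExteriorAlgebra.ι ℂ (dzL α) * ExteriorAlgebra.ι ℂ (dzbarL β))) *
      (∑ γ, ∑ δ, b γ δ • (ExteriorAlgebra.ι ℂ (dzL γ) * ExteriorAlgebra.ι ℂ (dzbarL δ))) *
      toExt (divPow (hermForm G) k) =
    (4 * ∑ α, ∑ β, ∑ γ, ∑ δ, hermInv G α δ * hermInv G γ β * a α β * b γ δ) •
      toExt (divPow (hermForm G) (k + 2)) := by
  -- Of the three terms of the Pfaffian, the one pairing the two `d\bar z` vanishes. The crossed one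
  -- is `(-2√-1)(2√-1) = 4` times its contraction and the uncrossed one `(-2√-1)² = -4` times a
  -- product of traces, which `hb` kills.
  have h : ∀ α β γ δ, a α β • (ExteriorAlgebra.ι ℂ (dzL α) * ExteriorAlgebra.ι ℂ (dzbarL β)) *
      b γ δ • (ExteriorAlgebra.ι ℂ (dzL γ) * ExteriorAlgebra.ι ℂ (dzbarL δ)) *
      toExt (divPow (hermForm G) k) =
      (4 * (hermInv G α δ * hermInv G γ β * a α β * b γ δ) -
        4 * hermInv G α β * a α β * (hermInv G γ δ * b γ δ)) •
      toExt (divPow (hermForm G) (k + 2)) := by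
    intro α β γ δ
    rw [smul_mul_smul_comm, smul_mul_assoc, ← mul_assoc,
      ι_mul_ι_mul_ι_mul_ι_mul_divPow hG k hk, smul_smul, poisson_dzL_dzbarL,
      poisson_swap G (dzbarL β) (dzL γ), poisson_dzL_dzbarL, poisson_dzbarL_dzbarL,
      poisson_dzL_dzbarL, poisson_dzL_dzbarL]
    congr 1
    linear_combination (-4 * (hermInv G α δ * hermInv G γ β * a α β * b γ δ) +
      4 * hermInv G α β * a α β * (hermInv G γ δ * b γ δ)) * Complex.I_sq
  have h2 : ∀ α β, ∑ γ, ∑ δ, 4 * hermInv G α β * a α β * (hermInv G γ δ * b γ δ) = 0 := by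
    intro α β
    simp only [← Finset.mul_sum, hb, mul_zero]
  rw [Finset.sum_mul, Finset.sum_mul, Finset.mul_sum, Finset.sum_smul]
  refine Finset.sum_congr rfl fun α _ => ?_
  rw [Finset.sum_mul, Finset.sum_mul, Finset.mul_sum, Finset.sum_smul]
  refine Finset.sum_congr rfl fun β _ => ?_
  rw [Finset.mul_sum, Finset.sum_mul]
  simp only [Finset.mul_sum, Finset.sum_mul, h, ← Finset.sum_smul, Finset.sum_sub_distrib, h2,
    sub_zero]

/-- The two curvature contractions in the Bochner formula agree. -/
theorem curvature_contraction {ι' : Type*} [Fintype ι'] {R : ι' → ι' → ι' → ι' → ℂ}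
    (h1 : ∀ i j k l, R i j k l = -R j i k l) (h2 : ∀ i j k l, R i j k l = -R i j l k)
    (h3 : ∀ i j k l, R i j k l = R k l i j) (X : ι' → ι' → ℂ) :
    ∑ j, ∑ l, ∑ a, ∑ k, ((1 / 2 : ℂ) * R l a k j * (X j l * X k a - X j a * X k l)
      + (1 / 2 : ℂ) * R l k a j * (X l j * X k a - X k j * X l a)) =
    2 * ∑ l, ∑ k, ∑ a, ∑ j, R l k a j * (X l j * X k a) := by
  -- Antisymmetry in the first pair of indices makes each subtracted contraction equal to minus its
  -- partner, doubling it.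
  have e1 : ∑ j, ∑ l, ∑ a, ∑ k, R l a k j * (X j a * X k l) =
      -∑ j, ∑ l, ∑ a, ∑ k, R l a k j * (X j l * X k a) := by
    rw [← Finset.sum_neg_distrib]
    refine Finset.sum_congr rfl fun j _ => ?_
    rw [Finset.sum_comm, ← Finset.sum_neg_distrib]
    refine Finset.sum_congr rfl fun l _ => ?_
    simp only [← Finset.sum_neg_distrib]
    refine Finset.sum_congr rfl fun a _ => Finset.sum_congr rfl fun k _ => ?_
    rw [h1]
    ring
  have e2 : ∑ j, ∑ l, ∑ a, ∑ k, R l k a j * (X k j * X l a) =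
      -∑ j, ∑ l, ∑ a, ∑ k, R l k a j * (X l j * X k a) := by
    rw [← Finset.sum_neg_distrib]
    refine Finset.sum_congr rfl fun j _ => ?_
    rw [Finset.sum_comm, Finset.sum_comm (s := Finset.univ (α := ι')) (t := Finset.univ (α := ι'))
      (f := fun l a => ∑ k, R l k a j * (X l j * X k a)), ← Finset.sum_neg_distrib]
    refine Finset.sum_congr rfl fun a _ => ?_
    rw [Finset.sum_comm, ← Finset.sum_neg_distrib]
    refine Finset.sum_congr rfl fun k _ => ?_
    rw [← Finset.sum_neg_distrib]
    refine Finset.sum_congr rfl fun l _ => ?_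
    rw [h1]
    ring
  -- Pair symmetry identifies the contraction coming from `R(q,q)p` with the one coming from
  -- `R(p,p)q`.
  have e3 : ∑ j, ∑ l, ∑ a, ∑ k, R l a k j * (X j l * X k a) =
      ∑ l, ∑ k, ∑ a, ∑ j, R l k a j * (X l j * X k a) := by
    refine Finset.sum_congr rfl fun j _ => ?_
    rw [Finset.sum_congr rfl fun l _ => Finset.sum_comm, Finset.sum_comm]
    refine Finset.sum_congr rfl fun k _ => ?_
    rw [Finset.sum_comm]
    refine Finset.sum_congr rfl fun a _ => Finset.sum_congr rfl fun l _ => ?_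
    rw [h3, h1, h2, neg_neg]
  have e4 : ∑ j, ∑ l, ∑ a, ∑ k, R l k a j * (X l j * X k a) =
      ∑ l, ∑ k, ∑ a, ∑ j, R l k a j * (X l j * X k a) := by
    rw [Finset.sum_comm]
    refine Finset.sum_congr rfl fun l _ => ?_
    rw [Finset.sum_congr rfl fun j _ => Finset.sum_comm, Finset.sum_comm]
    refine Finset.sum_congr rfl fun k _ => ?_
    rw [Finset.sum_comm]
  have e : ∀ j l a k, (1 / 2 : ℂ) * R l a k j * (X j l * X k a - X j a * X k l)
      + (1 / 2 : ℂ) * R l k a j * (X l j * X k a - X k j * X l a) =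
      (1 / 2 : ℂ) * (R l a k j * (X j l * X k a)) - (1 / 2 : ℂ) * (R l a k j * (X j a * X k l))
      + (1 / 2 : ℂ) * (R l k a j * (X l j * X k a)) - (1 / 2 : ℂ) * (R l k a j * (X k j * X l a)) :=
    fun j l a k => by ring
  simp only [e, Finset.sum_add_distrib, Finset.sum_sub_distrib, ← Finset.mul_sum, e1, e2, e3, e4]
  ring

section MapEvaluation

variable {n m : ℕ} (F : CSpace n → RSpace m) (G : Matrix (Fin n) (Fin n) ℂ) (z : CSpace n)

theorem delZ_delMap (i : Fin m) (α : Fin n) : delZ α (delMap F i z) = dFz F i α z := by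
  simp [delMap, delZ_dzL]

theorem delZbar_delMap (i : Fin m) (α : Fin n) : delZbar α (delMap F i z) = 0 := by
  simp [delMap, delZbar_dzL]

theorem delZ_delbarMap (i : Fin m) (α : Fin n) : delZ α (delbarMap F i z) = 0 := by
  simp [delbarMap, delZ_dzbarL]

theorem delZbar_delbarMap (i : Fin m) (α : Fin n) :
    delZbar α (delbarMap F i z) = dFzbar F i α z := by
  simp [delbarMap, delZbar_dzbarL]

theorem poisson_delMap_delMap (i j : Fin m) : poisson G (delMap F i z) (delMap F j z) = 0 := by
  simp [poisson, delZbar_delMap]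

theorem poisson_delbarMap_delbarMap (i j : Fin m) :
    poisson G (delbarMap F i z) (delbarMap F j z) = 0 := by
  simp [poisson, delZ_delbarMap]

theorem poisson_delMap_delbarMap (i j : Fin m) : poisson G (delMap F i z) (delbarMap F j z) =
    -2 * Complex.I * ∑ α, ∑ β, hermInv G α β * (dFz F i α z * dFzbar F j β z) := by
  simp [poisson, delZ_delMap, delZbar_delMap, delZbar_delbarMap, delZ_delbarMap]

variable {G} {k : ℕ}

/-- Pairings within `p` or within `q` are zero, so only products of type `(2,2)` survive: here the
`p` term of `p - q`, and in the companion lemma the `q` term. -/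
theorem ι_delbarMap_delbarMap_delMap_mul_divPow (hG : IsUnit G.det) (hk : n = k + 2)
    (l a c j : Fin m) :
    ExteriorAlgebra.ι ℂ (delbarMap F l z) * ExteriorAlgebra.ι ℂ (delbarMap F a z) *
        ExteriorAlgebra.ι ℂ (delMap F c z) *
        (ExteriorAlgebra.ι ℂ (delMap F j z) - ExteriorAlgebra.ι ℂ (delbarMap F j z)) *
        toExt (divPow (hermForm G) k) =
      (poisson G (delMap F j z) (delbarMap F l z) * poisson G (delMap F c z) (delbarMap F a z)
        - poisson G (delMap F j z) (delbarMap F a z) * poisson G (delMap F c z) (delbarMap F l z)) •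
        toExt (divPow (hermForm G) (k + 2)) := by
  rw [mul_sub, sub_mul, ι_mul_ι_mul_ι_mul_ι_mul_divPow hG k hk,
    ι_mul_ι_mul_ι_mul_ι_mul_divPow hG k hk]
  simp only [poisson_delMap_delMap, poisson_delbarMap_delbarMap,
    poisson_swap G (delbarMap F _ z) (delMap F _ z)]
  rw [← sub_smul]
  congr 1
  ring

theorem ι_delMap_delMap_delbarMap_mul_divPow (hG : IsUnit G.det) (hk : n = k + 2)
    (l c a j : Fin m) :
    ExteriorAlgebra.ι ℂ (delMap F l z) * ExteriorAlgebra.ι ℂ (delMap F c z) *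
        ExteriorAlgebra.ι ℂ (delbarMap F a z) *
        (ExteriorAlgebra.ι ℂ (delMap F j z) - ExteriorAlgebra.ι ℂ (delbarMap F j z)) *
        toExt (divPow (hermForm G) k) =
      -(poisson G (delMap F l z) (delbarMap F j z) * poisson G (delMap F c z) (delbarMap F a z)
        - poisson G (delMap F c z) (delbarMap F j z) * poisson G (delMap F l z) (delbarMap F a z)) •
        toExt (divPow (hermForm G) (k + 2)) := by
  rw [mul_sub, sub_mul, ι_mul_ι_mul_ι_mul_ι_mul_divPow hG k hk,
    ι_mul_ι_mul_ι_mul_ι_mul_divPow hG k hk]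
  simp only [poisson_delMap_delMap, poisson_delbarMap_delbarMap,
    poisson_swap G (delbarMap F _ z) (delMap F _ z)]
  rw [← sub_smul]
  congr 1
  ring

variable {z F} {H : RSpace m → Matrix (Fin m) (Fin m) ℝ} {S : Set (CSpace n)} {T : Set (RSpace m)}

/-- Contracting with `h_{ij}` lowers the curvature index. The constant is `2 · (-2√-1)² = -8`, and
`Q0` carries the remaining minus sign. -/
theorem curvature_contraction_eq_Q0 (hST : MapsTo F S T) (hH : IsMetricOn H T) (hz : z ∈ S)
    (G : CSpace n → Matrix (Fin n) (Fin n) ℂ) :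
    let X : Fin m → Fin m → ℂ := fun a b => poisson (G z) (delMap F a z) (delbarMap F b z)
    ∑ i, ∑ j, ((H (F z) i j : ℝ) : ℂ) * ∑ l, ∑ a, ∑ k,
      ((1 / 2 : ℂ) * (curvatureUp (stdFrame m) H l a k i (F z) : ℝ) *
          (X j l * X k a - X j a * X k l) +
        (1 / 2 : ℂ) * (curvatureUp (stdFrame m) H l k a i (F z) : ℝ) *
          (X l j * X k a - X k j * X l a)) = 8 * Q0 H G F z := by
  intro X
  have hTz := hST hz
  have hR : ∀ l a k j, ((curvature (stdFrame m) H l a k j (F z) : ℝ) : ℂ) =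
      ∑ i, ((H (F z) i j : ℝ) : ℂ) * (curvatureUp (stdFrame m) H l a k i (F z) : ℝ) := by
    intro l a k j
    rw [curvature]
    push_cast
    exact Finset.sum_congr rfl fun i _ => by rw [hH.symm _ hTz]
  have h1 : ∑ i, ∑ j, ((H (F z) i j : ℝ) : ℂ) * ∑ l, ∑ a, ∑ k,
      ((1 / 2 : ℂ) * (curvatureUp (stdFrame m) H l a k i (F z) : ℝ) *
          (X j l * X k a - X j a * X k l) +
        (1 / 2 : ℂ) * (curvatureUp (stdFrame m) H l k a i (F z) : ℝ) *
          (X l j * X k a - X k j * X l a)) =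
      ∑ j, ∑ l, ∑ a, ∑ k,
      ((1 / 2 : ℂ) * (curvature (stdFrame m) H l a k j (F z) : ℝ) *
          (X j l * X k a - X j a * X k l) +
        (1 / 2 : ℂ) * (curvature (stdFrame m) H l k a j (F z) : ℝ) *
          (X l j * X k a - X k j * X l a)) := by
    rw [Finset.sum_comm]
    refine Finset.sum_congr rfl fun j _ => ?_
    simp only [Finset.mul_sum]
    rw [Finset.sum_comm]
    refine Finset.sum_congr rfl fun l _ => ?_
    rw [Finset.sum_comm]
    refine Finset.sum_congr rfl fun a _ => ?_
    rw [Finset.sum_comm]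
    refine Finset.sum_congr rfl fun k _ => ?_
    rw [hR, hR]
    simp only [Finset.mul_sum, Finset.sum_mul, ← Finset.sum_add_distrib]
    exact Finset.sum_congr rfl fun i _ => by ring
  rw [h1, curvature_contraction
    (R := fun i j k l => ((curvature (stdFrame m) H i j k l (F z) : ℝ) : ℂ))
    (fun i j k l => by rw [curvature_antisymm]; push_cast; rfl)
    (fun i j k l => by rw [hH.curvature_antisymm_right (stdFrame m) hTz]; push_cast; rfl)
    (fun i j k l => by rw [hH.curvature_pair_symm (stdFrame m) hTz]) X]
  have h2 : ∀ l k a j, ((curvature (stdFrame m) H l k a j (F z) : ℝ) : ℂ) * (X l j * X k a) =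
      -4 * ∑ α, ∑ β, ∑ γ, ∑ δ, hermInv (G z) α δ * hermInv (G z) γ β *
        ((curvature (stdFrame m) H l k a j (F z) : ℝ) : ℂ) *
        dFz F l α z * dFzbar F a β z * dFz F k γ z * dFzbar F j δ z := by
    intro l k a j
    simp only [X, poisson_delMap_delbarMap]
    have e : (∑ α, ∑ δ, hermInv (G z) α δ * (dFz F l α z * dFzbar F j δ z)) *
        (∑ γ, ∑ β, hermInv (G z) γ β * (dFz F k γ z * dFzbar F a β z)) =
        ∑ α, ∑ β, ∑ γ, ∑ δ, (hermInv (G z) α δ * (dFz F l α z * dFzbar F j δ z)) *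
          (hermInv (G z) γ β * (dFz F k γ z * dFzbar F a β z)) := by
      rw [Finset.sum_mul]
      refine Finset.sum_congr rfl fun α _ => ?_
      rw [Finset.sum_comm, Finset.mul_sum]
      refine Finset.sum_congr rfl fun β _ => ?_
      rw [Finset.mul_sum]
      exact Finset.sum_congr rfl fun γ _ => Finset.sum_mul _ _ _
    have e2 : ∀ x y : ℂ, -2 * Complex.I * x * (-2 * Complex.I * y) = -4 * (x * y) := by
      intro x y
      linear_combination 4 * x * y * Complex.I_sq
    rw [e2, e, mul_left_comm]
    congr 1
    simp only [Finset.mul_sum]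
    refine Finset.sum_congr rfl fun α _ => Finset.sum_congr rfl fun β _ =>
      Finset.sum_congr rfl fun γ _ => Finset.sum_congr rfl fun δ _ => ?_
    ring
  simp only [h2, ← Finset.mul_sum, Q0]
  have h3 : ∀ f : Fin m → Fin m → Fin m → Fin m → Fin n → Fin n → Fin n → Fin n → ℂ,
      ∑ l, ∑ k, ∑ a, ∑ j, ∑ α, ∑ β, ∑ γ, ∑ δ, f l k a j α β γ δ =
      ∑ α, ∑ β, ∑ γ, ∑ δ, ∑ l, ∑ k, ∑ a, ∑ j, f l k a j α β γ δ := by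
    intro f
    have hc : ∀ g : Fin m → Fin m → Fin m → Fin m → Fin n → ℂ,
        ∑ l, ∑ k, ∑ a, ∑ j, ∑ α, g l k a j α = ∑ α, ∑ l, ∑ k, ∑ a, ∑ j, g l k a j α := by
      intro g
      simp only [Finset.sum_comm (s := Finset.univ (α := Fin m)) (t := Finset.univ (α := Fin n))]
    rw [hc]
    refine Finset.sum_congr rfl fun α _ => ?_
    rw [hc]
    refine Finset.sum_congr rfl fun β _ => ?_
    rw [hc]
    refine Finset.sum_congr rfl fun γ _ => ?_
    rw [hc]
  rw [h3]
  ring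

theorem toExt_extDeriv_mochizukiForm_mul_divPow (hS : IsOpen S)
    (hF : ∀ w ∈ S, ContDiffAt ℝ ∞ F w) (hST : MapsTo F S T) (hH : IsMetricOn H T) (hz : z ∈ S)
    (G : CSpace n → Matrix (Fin n) (Fin n) ℂ) (hG : IsUnit (G z).det) (hk : n = k + 2)
    (htr : ∀ i, ∑ α, ∑ β, hermInv (G z) α β * leviForm H F i z α β = 0) :
    toExt (extDeriv (mochizukiForm H F) z) * toExt (divPow (hermForm (G z)) k) =
      (8 * (normSq11 (H (F z)) (G z) (fun i => dPrimeE H F (dDoublePrimeMap F) i z) +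
        Q0 H G F z)) • toExt (divPow (hermForm (G z)) (k + 2)) := by
  have hFz := hF z hz
  have hΓ : ∀ i j k, christoffel (stdFrame m) H i j k (F z) =
      christoffel (stdFrame m) H i k j (F z) := hH.christoffel_symm (stdFrame m) (hST hz)
  -- Conjugation transposes the Levi form, so the norm becomes the crossed contraction produced by
  -- the Pfaffian. The factor is `8 = 2 · 4`: `2` from `D(p - q) = 2A`, `4` from the pairings.
  have hN : 8 * normSq11 (H (F z)) (G z) (fun i => dPrimeE H F (dDoublePrimeMap F) i z) =
      ∑ i, ∑ j, ((H (F z) i j : ℝ) : ℂ) * (2 * (4 * ∑ α, ∑ β, ∑ γ, ∑ δ, hermInv (G z) α δ *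
        hermInv (G z) γ β * leviForm H F i z α β * leviForm H F j z γ δ)) := by
    simp only [normSq11, comp11_dPrimeE hFz, conj_leviForm hFz hΓ, Finset.mul_sum]
    refine Finset.sum_congr rfl fun i _ => Finset.sum_congr rfl fun j _ =>
      Finset.sum_congr rfl fun α _ => Finset.sum_congr rfl fun β _ => ?_
    rw [Finset.sum_comm]
    refine Finset.sum_congr rfl fun γ _ => Finset.sum_congr rfl fun δ _ => ?_
    ring
  rw [mul_add, hN, ← curvature_contraction_eq_Q0 hST hH hz G,
    toExt_extDeriv_mochizukiForm hS hF hST hH hz, Finset.sum_mul, ← Finset.sum_add_distrib,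
    Finset.sum_smul]
  refine Finset.sum_congr rfl fun i _ => ?_
  rw [Finset.sum_mul, ← Finset.sum_add_distrib, Finset.sum_smul]
  refine Finset.sum_congr rfl fun j _ => ?_
  rw [smul_mul_assoc, ← mul_add, mul_smul, add_mul, add_smul, add_comm]
  congr 2
  · rw [toExt_dDoublePrimeE_eq_neg hFz hΓ, toExt_dDoublePrimeE_eq_neg hFz hΓ, neg_mul_neg,
      smul_mul_assoc, sum_ι_dz_mul_sum_ι_dz_mul_divPow hG hk _ _ (htr j), smul_smul]
  · simp only [Finset.sum_mul, Finset.sum_smul]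
    refine Finset.sum_congr rfl fun l _ => Finset.sum_congr rfl fun a _ =>
      Finset.sum_congr rfl fun c _ => ?_
    rw [sub_mul, sub_mul, smul_mul_assoc, smul_mul_assoc, smul_mul_assoc, smul_mul_assoc,
      ι_delbarMap_delbarMap_delMap_mul_divPow F z hG hk,
      ι_delMap_delMap_delbarMap_mul_divPow F z hG hk, smul_smul, smul_smul, ← sub_smul]
    congr 1
    ring

end MapEvaluation

/-! ### The trace of the Levi form of a harmonic map -/

section Trace

variable {n m : ℕ} {M : Type*} [TopologicalSpace M] [ChartedSpace (CSpace n) M]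
  [IsManifold 𝓘(ℂ, CSpace n) ω M] [IsManifold 𝓘(ℝ, CSpace n) ∞ M]
  {g : ContMDiffRiemannianMetric 𝓘(ℝ, CSpace n) ∞ (CSpace n)
    (fun x : M => TangentSpace 𝓘(ℝ, CSpace n) x)}
  {φ : OpenPartialHomeomorph M (CSpace n)} {z : CSpace n}
  {H : RSpace m → Matrix (Fin m) (Fin m) ℝ} {F : CSpace n → RSpace m}

/-- On a Kähler manifold, the trace of the Levi form vanishes where the tension field does. -/
theorem IsKahler.sum_hermInv_mul_leviForm (hg : IsKahler g)
    (hφ : φ ∈ IsManifold.maximalAtlas 𝓘(ℂ, CSpace n) ω M) (hz : z ∈ φ.target)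
    (hF : ContDiffAt ℝ ∞ F z) (hΓ : ∀ i j k, christoffel (stdFrame m) H i j k (F z) =
      christoffel (stdFrame m) H i k j (F z)) (i : Fin m)
    (hτ : tension (realFrame n) (metricMatrix g φ (realFrame n)) H F i z = 0) :
    ∑ α, ∑ β, hermInv (hermMatrix g φ z) α β * leviForm H F i z α β = 0 := by
  have hu := (isMetricOn_metricMatrix g (mem_maximalAtlas_real_of_complex hφ)
    (linearIndependent_realFrame n)).isUnit z hz
  simp only [leviForm_eq hF H i]
  refine sum_hermInv_mul g (hg.hermitian φ hφ z hz) hu (T := fun a c =>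
      fderiv ℝ (fun y => fderiv ℝ (fun w => F w i) y (realFrame n c)) z (realFrame n a)
        + ∑ j, ∑ k, christoffel (stdFrame m) H i j k (F z) *
          fderiv ℝ (fun w => F w j) z (realFrame n a) *
            fderiv ℝ (fun w => F w k) z (realFrame n c)) (fun a c => ?_) ?_
  · rw [fderiv_fderiv_comm (contDiffAt_coord hF i), Finset.sum_comm]
    congr 1
    refine Finset.sum_congr rfl fun j _ => Finset.sum_congr rfl fun k _ => ?_
    rw [hΓ]
    ring
  · rw [← hτ, tension]
    -- The part of the tension field containing the Christoffel symbols of the domain has zero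
    -- trace.
    have h0 : ∑ a, ∑ c, (metricMatrix g φ (realFrame n) z)⁻¹ a c *
        ∑ e, christoffel (realFrame n) (metricMatrix g φ (realFrame n)) e a c z *
          fderiv ℝ (fun w => F w i) z (realFrame n e) = 0 := by
      simp only [Finset.mul_sum]
      rw [Finset.sum_congr rfl fun a _ => Finset.sum_comm, Finset.sum_comm]
      refine Finset.sum_eq_zero fun e _ => ?_
      simp only [← mul_assoc, ← Finset.sum_mul]
      rw [hg.sum_inv_mul_christoffel hφ hz e, zero_mul]
    rw [← sub_zero (∑ a, _), ← h0, ← Finset.sum_sub_distrib]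
    refine Finset.sum_congr rfl fun a _ => ?_
    rw [← Finset.sum_sub_distrib]
    exact Finset.sum_congr rfl fun c _ => by ring

end Trace

end KahlerBochner

end

/-! ### Assembly of the Bochner formula in charts -/

theorem mainTheorem7 {n m : ℕ} (hn : 2 ≤ n)
    {M : Type*} [TopologicalSpace M] [ChartedSpace (CSpace n) M]
    [IsManifold 𝓘(ℂ, CSpace n) ω M]
    [IsManifold 𝓘(ℝ, CSpace n) ∞ M]
    {N : Type*} [TopologicalSpace N] [ChartedSpace (RSpace m) N]
    [IsManifold 𝓘(ℝ, RSpace m) ∞ N]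
    (g : ContMDiffRiemannianMetric 𝓘(ℝ, CSpace n) ∞ (CSpace n)
      (fun x : M => TangentSpace 𝓘(ℝ, CSpace n) x))
    (hg : IsKahler g)
    (h : ContMDiffRiemannianMetric 𝓘(ℝ, RSpace m) ∞ (RSpace m)
      (fun y : N => TangentSpace 𝓘(ℝ, RSpace m) y))
    (f : M → N)
    (hf : ContMDiff 𝓘(ℝ, CSpace n) 𝓘(ℝ, RSpace m) ∞ f)
    (hharm : IsHarmonic g h f)
    -- holomorphic coordinates of `M`, coordinates of `N`, and a point where both are defined
    (φ : OpenPartialHomeomorph M (CSpace n))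
    (hφ : φ ∈ IsManifold.maximalAtlas 𝓘(ℂ, CSpace n) ω M)
    (ψ : OpenPartialHomeomorph N (RSpace m))
    (hψ : ψ ∈ IsManifold.maximalAtlas 𝓘(ℝ, RSpace m) ∞ N)
    (z : CSpace n) (hz : z ∈ φ.target) (hfz : f (φ.symm z) ∈ ψ.source) :
    castDeg (by omega)
        (wedge (extDeriv (mochizukiForm (targetMatrix h ψ) (coordMap f φ ψ)) z)
          (divPow (kahlerForm g φ z) (n - 2)))
      = (8 * (normSq11 (targetMatrix h ψ (coordMap f φ ψ z)) (hermMatrix g φ z)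
            (fun i => dPrimeE (targetMatrix h ψ) (coordMap f φ ψ)
              (dDoublePrimeMap (coordMap f φ ψ)) i z)
          + Q0 (targetMatrix h ψ) (hermMatrix g φ) (coordMap f φ ψ) z)) •
        divPow (kahlerForm g φ z) n
    -- the left-hand side is the exterior derivative of `{d''_E d'f, d''f - d'f} ∧ ω^{n-2}/(n-2)!`
    ∧ wedge (extDeriv (mochizukiForm (targetMatrix h ψ) (coordMap f φ ψ)) z)
          (divPow (kahlerForm g φ z) (n - 2))
      = castDeg (by omega)
        (extDeriv (fun w => wedge (mochizukiForm (targetMatrix h ψ) (coordMap f φ ψ) w)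
          (divPow (kahlerForm g φ w) (n - 2))) z) := by
  have hφ' := mem_maximalAtlas_real_of_complex hφ
  have hS : IsOpen (coordDomain f φ ψ) := isOpen_coordDomain hf.continuous
  have hF : ∀ w ∈ coordDomain f φ ψ, ContDiffAt ℝ ∞ (coordMap f φ ψ) w := fun w hw =>
    contDiffAt_coordMap hf hφ' hψ hw
  have hST : MapsTo (coordMap f φ ψ) (coordDomain f φ ψ) ψ.target := fun w hw =>
    coordMap_mem_target hw
  have hH : IsMetricOn (targetMatrix h ψ) ψ.target :=
    isMetricOn_metricMatrix h hψ (linearIndependent_stdFrame m)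
  have hzS : z ∈ coordDomain f φ ψ := ⟨hz, hfz⟩
  have hu := (isMetricOn_metricMatrix g hφ' (linearIndependent_realFrame n)).isUnit z hz
  obtain ⟨k, hk⟩ : ∃ k, n = k + 2 := ⟨n - 2, by omega⟩
  have hk2 : n - 2 = k := by omega
  -- In the exterior algebra `castDeg` is invisible, so both claims become equations between
  -- products.
  refine ⟨toExt_injective ?_, toExt_injective ?_⟩
  · rw [toExt_castDeg, toExt_wedge, map_smul, kahlerForm_eq, hk2,
      toExt_extDeriv_mochizukiForm_mul_divPow hS hF hST hH hzS (hermMatrix g φ)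
        (isUnit_det_hermMatrix g (hg.hermitian φ hφ z hz) hu) hk fun i =>
          hg.sum_hermInv_mul_leviForm hφ hz (hF z hzS)
            (hH.christoffel_symm (stdFrame m) (hST hzS)) i (hharm φ hφ' ψ hψ z hz hfz i),
      toExt_divPow, toExt_divPow, ← hk]
  -- Since `ω` is closed, the exterior derivative falls only on the `3`-form.
  · rw [toExt_castDeg, toExt_wedge, toExt_extDeriv_wedge_divPow
      (differentiableAt_mochizukiForm hS hF hST hH hzS)
      (differentiableAt_kahlerForm g hφ' hz) (hg.closed φ hφ z hz)]
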